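/- **Notation.** Let $d\ge 1$. For $p\in[1,\infty]$ let $p'$ be the dual exponent, $\frac1p+\frac1{p'}=1$, with $\frac1\infty=0$; an inequality or equation $q\ge c\,p'$, $q=c\,p'$, $\frac q{p'}\ge c$ is read as $\frac cq\le\frac1{p'}$, resp. $\frac cq=\frac1{p'}$ (with the denominators of $c$ cleared if one of them vanishes). For $\ell=(l_1,\dots,l_d)\in(0,\infty]^d$ let $Q^\ell=\prod_{j=1}^d(-l_j,l_j)$, and let $\mathbb 1=(1,\dots,1)$. **Ellipticity.** Let $N\ge0$ be an integer and $0<\varepsilon_0\le\frac12$. A function $g\in C^{N+2}_{\rm loc}(Q^\ell)$ with $D^2g$ positive definite throughout $Q^\ell$ is *elliptic over $Q^\ell$ with parameters $N,\varepsilon_0$* if $g(\xi)=|\xi|^2+h(\xi)$ with $h(0)=0$, $\nabla h(0)=0$, $D^2h(0)=0$, and $\|(D^2h)(\tilde l_1\,\cdot\,,\dots,\tilde l_d\,\cdot\,)\|_{C^N(Q^{\mathbb 1})}<\varepsilon_0$ for every bounded $Q^{\tilde\ell}\subseteq Q^\ell$, where $\|F\|_{C^N(Q^{\mathbb 1})}=\max_{n\le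 N}\sup_{Q^{\mathbb 1}}\|D^nF\|$. Put $$\mathcal E^\ell_g f(t,x)=\int_{Q^\ell}e^{i(t,x)\cdot(g(\xi),\xi)}f(\xi)\,d\xi,\qquad (t,x)\in\mathbb R^{1+d},$$ for $f \in L^1(Q^\ell)$, and let $\|\mathcal E^\ell_g\|_{L^p\to L^q}$ be its norm as an operator from $L^1\cap L^p(Q^\ell)$, with the $L^p$ norm, to $L^q(\mathbb R^{1+d})$. **The conjecture $\mathrm{R}_d(p,q)$** (restriction above rectangles, at the pair $(p,q)$). There are $N$ and $\varepsilon_0$, depending on $d,p,q$, such that the following bounds hold for all $\ell\in(0,\infty]^d$ with $l_1\le\dots\le l_d$ and all $g$ elliptic over $Q^\ell$ with parameters $N,\varepsilon_0$, with implicit constants independent of $\ell$ and $g$: * (a) if $q>p$ and $q=\frac{d-j-\theta+2}{d-j-\theta}p'$ for some integer $0\le j<d$ and some $0\le\theta\le1$, then $\|\mathcal E^\ell_g\|_{L^p\to L^q}\lesssim(l_1\cdots l_jl_{j+1}^\theta)^{\frac1{p'}-\frac1q}$; * (b) if $l_d<\infty$ and $q=\frac{2(d-j-\theta+1)}{d-j-\theta}\le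 p$ for some integer $0\le j\le d-2$ and some $0<\theta\le1$, then for every $\varepsilon>0$, $\|\mathcal E^\ell_g\|_{L^p\to L^q}\lesssim_\varepsilon(l_1\cdots l_d)^{\frac1q-\frac1p}\bigl(\tfrac{l_d}{l_{j+1}}\bigr)^\varepsilon(l_1\cdots l_jl_{j+1}^\theta)^{1-\frac2q}$; * (c) if $l_d<\infty$, $q>4$ and $p\ge(\frac q3)'$, then $\|\mathcal E^\ell_g\|_{L^p\to L^q}\lesssim(l_1\cdots l_{d-1})^{\frac1{p'}-\frac1q}\,l_d^{1-\frac3q-\frac1p}$. **The operator $\mathcal E_\beta$.** Let $\beta\in(1,\infty)^d$ with $\beta_1\ge\dots\ge\beta_d$, and put $$\mathcal E_\beta f(t,x)=\int_{Q^{\mathbb 1}}e^{i(t,x)\cdot(g_\beta(\xi),\xi)}f(\xi)\,d\xi,\qquad g_\beta(\xi)=\sum_{j=1}^d|\xi_j|^{\beta_j},\qquad J_n=\tfrac1{\beta_1}+\dots+\tfrac1{\beta_n}\quad(0\le n\le d),$$ $$T_d=\bigl\{(p,q)\in[1,\infty]^2:\ q>\tfrac{2(d+1)}d,\ q\ge\tfrac{d+2}d\,p'\bigr\}.$$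 The operator is of *restricted weak type $(p,q)$* if $|\langle\mathcal E_\beta f,g\rangle|\lesssim|E|^{\frac1p}|F|^{\frac1{q'}}$ for all measurable $E\subseteq\mathbb R^d$, $F\subseteq\mathbb R^{1+d}$ of finite measure and all measurable $f,g$ with $|f|\le\chi_E$, $|g|\le\chi_F$. **Theorem.** Let $V\subseteq T_d$ be relatively open with $(p,q)\in V$, and assume that $\mathrm{R}_d(\tilde p,\tilde q)$ holds for all $(\tilde p,\tilde q)\in V$. Then $\mathcal E_\beta$ is bounded from $L^p(Q^{\mathbb 1})$ to $L^q(\mathbb R^{1+d})$ if at least one of the following holds: * (i) $q>p$ and $\frac q{p'}\ge1+\frac1{J_n+\frac{d-n}2}$ for all $0\le n\le d$; * (ii) $q\le p$ and $\frac{1+J_n+d-n}q<\frac{J_n}{p'}+\frac{d-n}2$ for all $0\le n\le d$; * (iii) $q=p$, $\frac{1+J_d}q=\frac{J_d}{p'}$, and $\frac{1+J_n+d-n}q<\frac{J_n}{p'}+\frac{d-n}2$ for all $0\le n<d$. Furthermore, $\mathcal E_\beta$ is of restricted weak type $(p,q)$ if * (iv) $q\le p\le\infty$, $\frac{1+J_d}q=\frac{J_d}{p'}$,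 and $\frac{1+J_n+d-n}q<\frac{J_n}{p'}+\frac{d-n}2$ for all $0\le n<d$. -/

import Mathlib

open MeasureTheory
open scoped ENNReal NNReal

noncomputable section

namespace RectRestriction

/-! ### Exponents -/

/-- The reciprocal `1/p` of a Lebesgue exponent `p ∈ [1,∞]`, as a real number (`1/∞ = 0`). -/
def recip (p : ℝ≥0∞) : ℝ := (p⁻¹).toReal

/-- The reciprocal `1/p'` of the dual exponent `p'` of `p`, where `1/p + 1/p' = 1`. -/
def recip' (p : ℝ≥0∞) : ℝ := recip (ENNReal.conjExponent p)

/-- The set `T_d` of all `(p,q) ∈ [1,∞]²` with `q > 2(d+1)/d` and `q ≥ ((d+2)/d) p'`; both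
inequalities are written through reciprocals, so that they make sense for infinite exponents. -/
def T (d : ℕ) : Set (ℝ≥0∞ × ℝ≥0∞) :=
  {r | 1 ≤ r.1 ∧ 1 ≤ r.2 ∧ recip r.2 < (d : ℝ) / (2 * ((d : ℝ) + 1)) ∧
    ((d : ℝ) + 2) / d * recip r.2 ≤ recip' r.1}

/-! ### Rectangles, ellipticity and extension operators -/

/-- The open rectangle `Q^ℓ = ∏ (-ℓ_j, ℓ_j)`, `ℓ ∈ (0,∞]^d`. -/
def box {d : ℕ} (ℓ : Fin d → ℝ≥0∞) : Set (EuclideanSpace ℝ (Fin d)) :=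
  {ξ | ∀ j, ENNReal.ofReal |ξ j| < ℓ j}

/-- The dilation `A^l ξ = (l_1 ξ_1, …, l_d ξ_d)`. -/
def dilate {d : ℕ} (l : Fin d → ℝ) (ξ : EuclideanSpace ℝ (Fin d)) : EuclideanSpace ℝ (Fin d) :=
  WithLp.toLp 2 (fun j => l j * ξ j)

/-- The second derivative `D²g(ξ)`, as a bilinear form. -/
def hess {d : ℕ} (g : EuclideanSpace ℝ (Fin d) → ℝ) (ξ : EuclideanSpace ℝ (Fin d)) :
    EuclideanSpace ℝ (Fin d) →L[ℝ] EuclideanSpace ℝ (Fin d) →L[ℝ] ℝ :=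
  fderiv ℝ (fderiv ℝ g) ξ

/-- The perturbation `h(ξ) = g(ξ) - |ξ|²`. -/
def pert {d : ℕ} (g : EuclideanSpace ℝ (Fin d) → ℝ) (ξ : EuclideanSpace ℝ (Fin d)) : ℝ :=
  g ξ - ‖ξ‖ ^ 2

/-- `g` is elliptic over `Q^ℓ` with parameters `N`, `ε₀`. The `C^N(Q^𝟙)` norm of a map `F` is
`max_{n ≤ N} sup_{Q^𝟙} ‖D^n F‖`; that it is `< ε₀` is expressed by a bound `δ < ε₀`. -/
structure IsElliptic {d : ℕ} (N : ℕ) (ε₀ : ℝ) (ℓ : Fin d → ℝ≥0∞)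
    (g : EuclideanSpace ℝ (Fin d) → ℝ) : Prop where
  contDiffOn : ContDiffOn ℝ ((N + 2 : ℕ) : WithTop ℕ∞) g (box ℓ)
  posDef : ∀ ξ ∈ box ℓ, ∀ v : EuclideanSpace ℝ (Fin d), v ≠ 0 → 0 < hess g ξ v v
  pert_zero : pert g 0 = 0
  fderiv_pert_zero : fderiv ℝ (pert g) 0 = 0
  hess_pert_zero : hess (pert g) 0 = 0
  norm_lt : ∀ l : Fin d → ℝ, (∀ j, 0 < l j) → box (fun j => ENNReal.ofReal (l j)) ⊆ box ℓ →
    ∃ δ < ε₀, ∀ n ≤ N, ∀ ξ ∈ box (fun _ : Fin d => 1),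
      ‖iteratedFDeriv ℝ n (fun η => hess (pert g) (dilate l η)) ξ‖ ≤ δ

/-- The extension operator
`ℰ_g^ℓ f(t,x) = ∫_{Q^ℓ} exp(i (t g(ξ) + x·ξ)) f(ξ) dξ`, `(t,x) ∈ ℝ × ℝ^d`. -/
def extensionOp {d : ℕ} (ℓ : Fin d → ℝ≥0∞) (g : EuclideanSpace ℝ (Fin d) → ℝ)
    (f : EuclideanSpace ℝ (Fin d) → ℂ) (z : ℝ × EuclideanSpace ℝ (Fin d)) : ℂ :=
  ∫ ξ in box ℓ, Complex.exp (Complex.I * ((z.1 * g ξ + inner ℝ z.2 ξ : ℝ) : ℂ)) * f ξ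

/-- `‖ℰ_g^ℓ‖_{L^p → L^q} ≤ B`, where the operator is initially defined on `L^1 ∩ L^p(Q^ℓ)`. -/
def OpNormLE {d : ℕ} (ℓ : Fin d → ℝ≥0∞) (g : EuclideanSpace ℝ (Fin d) → ℝ) (p q B : ℝ≥0∞) :
    Prop :=
  ∀ f : EuclideanSpace ℝ (Fin d) → ℂ,
    Integrable f (volume.restrict (box ℓ)) → MemLp f p (volume.restrict (box ℓ)) →
      eLpNorm (extensionOp ℓ g f) q volume ≤ B * eLpNorm f p (volume.restrict (box ℓ))

/-! ### The restriction conjecture above rectangles, at one pair of exponents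

Indices are 0-based: with `j : Fin d`, the sides `l_1, …, l_j` are the `ℓ i` with `i < j`, the side
`l_{j+1}` is `ℓ j`, and the largest side `l_d` is `ℓ ⊤`. -/

/-- The quantity `l_1 ⋯ l_j l_{j+1}^θ`. -/
def sideProd {d : ℕ} (ℓ : Fin d → ℝ≥0∞) (j : Fin d) (θ : ℝ) : ℝ≥0∞ :=
  (∏ i with i < j, ℓ i) * ℓ j ^ θ

/-- The bound for `p < q = ((d-j-θ+2)/(d-j-θ)) p'`. -/
def BoundLt (d N : ℕ) (ε₀ : ℝ) (p q : ℝ≥0∞) : Prop :=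
  p < q → ∀ (j : Fin d) (θ : ℝ), 0 ≤ θ → θ ≤ 1 →
    ((d : ℝ) - (j : ℕ) - θ + 2) * recip q = ((d : ℝ) - (j : ℕ) - θ) * recip' p →
    ∃ C : ℝ≥0, ∀ (ℓ : Fin d → ℝ≥0∞) (g : EuclideanSpace ℝ (Fin d) → ℝ),
      (∀ i, 0 < ℓ i) → Monotone ℓ → IsElliptic N ε₀ ℓ g →
      OpNormLE ℓ g p q (C * sideProd ℓ j θ ^ (recip' p - recip q))

/-- The bound for `q = 2(d-j-θ+1)/(d-j-θ) ≤ p`, with an `ε`-loss. -/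
def BoundLe (d : ℕ) [NeZero d] (N : ℕ) (ε₀ : ℝ) (p q : ℝ≥0∞) : Prop :=
  q ≤ p → ∀ (j : Fin d) (θ : ℝ), (j : ℕ) + 2 ≤ d → 0 < θ → θ ≤ 1 →
    2 * ((d : ℝ) - (j : ℕ) - θ + 1) * recip q = (d : ℝ) - (j : ℕ) - θ →
    ∀ ε : ℝ, 0 < ε →
    ∃ C : ℝ≥0, ∀ (ℓ : Fin d → ℝ≥0∞) (g : EuclideanSpace ℝ (Fin d) → ℝ),
      (∀ i, 0 < ℓ i) → Monotone ℓ → ℓ ⊤ < ∞ → IsElliptic N ε₀ ℓ g →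
      OpNormLE ℓ g p q (C * (∏ i, ℓ i) ^ (recip q - recip p) * (ℓ ⊤ / ℓ j) ^ ε *
        sideProd ℓ j θ ^ (1 - 2 * recip q))

/-- The bound for `q > 4`, `p ≥ (q/3)'`. -/
def BoundGtFour (d : ℕ) [NeZero d] (N : ℕ) (ε₀ : ℝ) (p q : ℝ≥0∞) : Prop :=
  4 < q → ENNReal.conjExponent (q / 3) ≤ p →
    ∃ C : ℝ≥0, ∀ (ℓ : Fin d → ℝ≥0∞) (g : EuclideanSpace ℝ (Fin d) → ℝ),
      (∀ i, 0 < ℓ i) → Monotone ℓ → ℓ ⊤ < ∞ → IsElliptic N ε₀ ℓ g →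
      OpNormLE ℓ g p q (C * (∏ i with i < (⊤ : Fin d), ℓ i) ^ (recip' p - recip q) *
        ℓ ⊤ ^ (1 - 3 * recip q - recip p))

/-- The restriction conjecture above rectangles at the pair `(p,q)`: for `N` large enough and
`ε₀` small enough the bounds hold, uniformly in `ℓ` and in `g` elliptic over `Q^ℓ` with parameters
`N`, `ε₀`. As ellipticity gets stronger when `N` grows and `ε₀` shrinks, one pair is enough. -/
def RectConjecture (d : ℕ) [NeZero d] (p q : ℝ≥0∞) : Prop :=
  ∃ (N : ℕ) (ε₀ : ℝ), 0 < ε₀ ∧ ε₀ ≤ 1 / 2 ∧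
    BoundLt d N ε₀ p q ∧ BoundLe d N ε₀ p q ∧ BoundGtFour d N ε₀ p q

/-! ### The operator `ℰ_β` -/

/-- `g_β(ξ) = ∑ |ξ_j|^{β_j}`. -/
def gBeta {d : ℕ} (β : Fin d → ℝ) (ξ : EuclideanSpace ℝ (Fin d)) : ℝ :=
  ∑ j, |ξ j| ^ β j

/-- The extension operator `ℰ_β`, over the cube `Q^𝟙 = (-1,1)^d`. -/
def extBeta {d : ℕ} (β : Fin d → ℝ) (f : EuclideanSpace ℝ (Fin d) → ℂ) :
    ℝ × EuclideanSpace ℝ (Fin d) → ℂ :=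
  extensionOp (fun _ => 1) (gBeta β) f

/-- The partial heights `J_n = 1/β_1 + ⋯ + 1/β_n`. -/
def J {d : ℕ} (β : Fin d → ℝ) (n : ℕ) : ℝ :=
  ∑ i ∈ Finset.univ.filter (fun i : Fin d => (i : ℕ) < n), 1 / β i

/-- `ℰ_β` is bounded from `L^p(Q^𝟙)` to `L^q(ℝ^{1+d})`. The integral converges for every
`f ∈ L^p(Q^𝟙)`, since the cube has finite measure. -/
def StrongType {d : ℕ} (β : Fin d → ℝ) (p q : ℝ≥0∞) : Prop :=
  ∃ C : ℝ≥0, ∀ f : EuclideanSpace ℝ (Fin d) → ℂ,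
    MemLp f p (volume.restrict (box (fun _ : Fin d => 1))) →
      MemLp (extBeta β f) q volume ∧
      eLpNorm (extBeta β f) q volume ≤
        C * eLpNorm f p (volume.restrict (box (fun _ : Fin d => 1)))

/-- `ℰ_β` is of restricted weak type `(p,q)`: `|⟨ℰ_β f, g⟩| ≲ |E|^{1/p} |F|^{1/q'}` for all
measurable `E`, `F` of finite measure and measurable `|f| ≤ χ_E`, `|g| ≤ χ_F`. -/
def RestrictedWeakType {d : ℕ} (β : Fin d → ℝ) (p q : ℝ≥0∞) : Prop :=
  ∃ C : ℝ, ∀ (E : Set (EuclideanSpace ℝ (Fin d))) (F : Set (ℝ × EuclideanSpace ℝ (Fin d)))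
    (f : EuclideanSpace ℝ (Fin d) → ℂ) (g : ℝ × EuclideanSpace ℝ (Fin d) → ℂ),
    MeasurableSet E → MeasurableSet F → volume E < ∞ → volume F < ∞ →
    Measurable f → Measurable g →
    (∀ ξ, ‖f ξ‖ ≤ E.indicator (fun _ => (1 : ℝ)) ξ) →
    (∀ z, ‖g z‖ ≤ F.indicator (fun _ => (1 : ℝ)) z) →
    ‖∫ z, extBeta β f z * (starRingEnd ℂ) (g z)‖ ≤
      C * volume.real E ^ recip p * volume.real F ^ recip' q

/-- `(1 + J_n + d - n)/q < J_n/p' + (d-n)/2`. -/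
def StrictAt {d : ℕ} (β : Fin d → ℝ) (p q : ℝ≥0∞) (n : ℕ) : Prop :=
  (1 + J β n + ((d : ℝ) - n)) * recip q < J β n * recip' p + ((d : ℝ) - n) / 2

/-- `q > p`, and `q/p' ≥ 1 + 1/(J_n + (d-n)/2)` for `0 ≤ n ≤ d`. -/
def CondI {d : ℕ} (β : Fin d → ℝ) (p q : ℝ≥0∞) : Prop :=
  p < q ∧ ∀ n ≤ d, (1 + 1 / (J β n + ((d : ℝ) - n) / 2)) * recip q ≤ recip' p

/-- `q ≤ p`, with strict inequalities for `0 ≤ n ≤ d`. -/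
def CondII {d : ℕ} (β : Fin d → ℝ) (p q : ℝ≥0∞) : Prop :=
  q ≤ p ∧ ∀ n ≤ d, StrictAt β p q n

/-- `q = p`, with equality for `n = d` and strict inequalities for `0 ≤ n < d`. -/
def CondIII {d : ℕ} (β : Fin d → ℝ) (p q : ℝ≥0∞) : Prop :=
  q = p ∧ (1 + J β d) * recip q = J β d * recip' p ∧ ∀ n < d, StrictAt β p q n

/-- `q ≤ p ≤ ∞`, with equality for `n = d` and strict inequalities for `0 ≤ n < d`. -/
def CondIV {d : ℕ} (β : Fin d → ℝ) (p q : ℝ≥0∞) : Prop :=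
  q ≤ p ∧ (1 + J β d) * recip q = J β d * recip' p ∧ ∀ n < d, StrictAt β p q n

end RectRestriction

end

namespace RectRestriction

/-! ### Exponents -/

/-! Cut the cube into pieces on which each |ξ_i| is comparable to 2^{-k_i}, each shell being split
into finitely many boxes; no dyadic cut is made where β_i = 2. On a piece, remove the affine Taylor
part of the phase and rescale ξ_i by the root of half the second derivative. What remains is |ζ|²
plus a small perturbation, elliptic over a rectangle with sides comparable to 2^{-β_i k_i/2}
(`isElliptic_modelPhase`, `RectBound.local_bound`).

Write s = 1/p' - 1/q. The three bounds of the conjecture have one common form,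
`exists_opNormLE_prod`: the norm over a rectangle is at most a constant times ∏ l_i^{s - u_i}, with
an ε-loss in the eccentricity if q ≤ p, for every choice of weights 0 ≤ u_i ≤ min(s, 1 - 2/q) of
total 2/q. Undoing the scaling, a piece is bounded by ∏ 2^{-k_i(s - u_i β_i/2)} up to that loss
(`exists_piece_bound`). The theorem becomes a question about the available weights.

If u_i β_i < 2s is possible wherever β_i ≠ 2, the pieces decay geometrically and can be summed
(`strongType_of_strict`). Such weights exist as soon as ∑ min(2s/β_i, c) > 2/q for an admissible cap
c (`strongType_of_scaled`). As β decreases, this sum equals 2s J_n + (d-n)c for some n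
(`exists_sum_min_eq`); that is how the inequalities in n enter.

In the critical case there is no decay in the coordinates with β_i > 2. Keep p and move q to
exponents q₁ > q > q₂. The total weight then differs from the critical one by ±e, and this excess
may be put on any single coordinate with β_i > 2, so the bounds gain or lose 2^{eβ_i k_i/2} with i
at one's choice (`exists_critical_bounds`). For the strong type, a product of two pieces is
estimated with one factor in L^{q₁} and the other in L^{q₂}; it decays in the distance of the
levels, and a Schur test for q-th powers (`lintegral_tsum_rpow_le`) together with ℓ^p ⊂ ℓ^q sums the
pieces. This last embedding needs p ≤ q. In case (iv), where p may exceed q, one tests against a set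
F and uses for each piece the better of the two exponents (`restrictedWeakType_of_pieces`). -/

lemma recip_nonneg (p : ℝ≥0∞) : 0 ≤ recip p := ENNReal.toReal_nonneg

lemma recip_le_one {p : ℝ≥0∞} (hp : 1 ≤ p) : recip p ≤ 1 := by
  have h : p⁻¹ ≤ 1 := ENNReal.inv_le_one.2 hp
  simpa [recip] using ENNReal.toReal_mono ENNReal.one_ne_top h

lemma recip'_eq {p : ℝ≥0∞} (hp : 1 ≤ p) : recip' p = 1 - recip p := by
  have h := (ENNReal.HolderConjugate.conjExponent hp).inv_add_inv_eq_one
  have h1 : p⁻¹ ≠ ∞ := by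
    simpa using (zero_lt_one.trans_le hp).ne'
  have h2 : (ENNReal.conjExponent p)⁻¹ ≠ ∞ := fun h' => by simp [h'] at h
  have := congrArg ENNReal.toReal h
  rw [ENNReal.toReal_add h1 h2] at this
  simp only [recip', recip]
  simp only [ENNReal.toReal_one] at this
  linarith

lemma recip_pos {q : ℝ≥0∞} (hq : 1 ≤ q) (hq' : q ≠ ∞) : 0 < recip q := by
  refine ENNReal.toReal_pos (by simpa using hq') ?_
  simpa using (zero_lt_one.trans_le hq).ne'

lemma recip_le_recip {p q : ℝ≥0∞} (hp : 1 ≤ p) (h : p ≤ q) : recip q ≤ recip p := by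
  refine ENNReal.toReal_mono ?_ (ENNReal.inv_le_inv.2 h)
  simpa using (zero_lt_one.trans_le hp).ne'

lemma recip_lt_recip {p q : ℝ≥0∞} (hp : 1 ≤ p) (h : p < q) : recip q < recip p := by
  have h1 : p⁻¹ ≠ ∞ := by simpa using (zero_lt_one.trans_le hp).ne'
  exact (ENNReal.toReal_lt_toReal ((ENNReal.inv_lt_inv.2 h).trans h1.lt_top).ne h1).2
    (ENNReal.inv_lt_inv.2 h)

lemma recip_eq_inv (q : ℝ≥0∞) : recip q = q.toReal⁻¹ := ENNReal.toReal_inv q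

lemma recip_top : recip ∞ = 0 := by simp [recip]

/-! ### Products of powers of the sides of a rectangle -/

lemma prod_rpow_eq_exp {ι : Type*} (s : Finset ι) {l : ι → ℝ} (hl : ∀ i, 0 < l i) (w : ι → ℝ) :
    ∏ i ∈ s, l i ^ w i = Real.exp (∑ i ∈ s, w i * Real.log (l i)) := by
  rw [Real.exp_sum]
  refine Finset.prod_congr rfl fun i _ => ?_
  rw [Real.rpow_def_of_pos (hl i), mul_comm]

lemma ofReal_prod_rpow {ι : Type*} (s : Finset ι) {l : ι → ℝ} (hl : ∀ i, 0 < l i) (w : ι → ℝ) :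
    ENNReal.ofReal (∏ i ∈ s, l i ^ w i) = ∏ i ∈ s, ENNReal.ofReal (l i) ^ w i := by
  rw [ENNReal.ofReal_prod_of_nonneg fun i _ => (Real.rpow_pos_of_pos (hl i) _).le]
  exact Finset.prod_congr rfl fun i _ => (ENNReal.ofReal_rpow_of_pos (hl i)).symm

/-- The greedy weight `1` on the first `j` indices, `θ` on the next one. -/
def greedy {d : ℕ} (j : Fin d) (θ : ℝ) (i : Fin d) : ℝ :=
  if i < j then 1 else if i = j then θ else 0

lemma sum_greedy {d : ℕ} (j : Fin d) (θ : ℝ) : ∑ i, greedy j θ i = (j : ℕ) + θ := by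
  have h : ∀ i, greedy j θ i = (if i < j then (1 : ℝ) else 0) + if i = j then θ else 0 := by
    intro i
    unfold greedy
    split_ifs with h1 h2 <;> simp_all
  simp_rw [h, Finset.sum_add_distrib]
  rw [← Finset.sum_filter, Finset.sum_const,
    show Finset.univ.filter (fun i => i < j) = Finset.Iio j by
    ext; simp, Fin.card_Iio]
  simp

lemma prod_greedy {d : ℕ} (l : Fin d → ℝ≥0∞) (j : Fin d) (θ : ℝ) :
    ∏ i, l i ^ greedy j θ i = sideProd l j θ := by
  have h : ∀ i, l i ^ greedy j θ i = (if i < j then l i else 1) * if i = j then l i ^ θ else 1 := by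
    intro i
    unfold greedy
    split_ifs with h1 h2 <;> simp_all
  simp_rw [h, Finset.prod_mul_distrib]
  simp [sideProd, Finset.prod_filter]

/-- Bathtub principle: subtract x_j throughout, which is allowed since the totals agree. Then each
term (w_i - greedy_i)(x_i - x_j) is nonnegative, as both factors change sign at i = j. -/
lemma sum_greedy_log_le {d : ℕ} {x : Fin d → ℝ} (hx : Monotone x) (j : Fin d) {θ : ℝ}
    {w : Fin d → ℝ}
    (hw0 : ∀ i, 0 ≤ w i) (hw1 : ∀ i, w i ≤ 1) (hw : ∑ i, w i = (j : ℕ) + θ) :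
    ∑ i, greedy j θ i * x i ≤ ∑ i, w i * x i := by
  have h : ∑ i, (w i - greedy j θ i) * x j ≤ ∑ i, (w i - greedy j θ i) * x i := by
    refine Finset.sum_le_sum fun i _ => ?_
    unfold greedy
    rcases lt_trichotomy i j with h | h | h
    · have := hx h.le
      have := hw1 i
      simp only [h, if_true]
      nlinarith
    · simp [h]
    · have := hx h.le
      have := hw0 i
      simp only [h.not_gt, h.ne', if_false]
      nlinarith
  rw [← Finset.sum_mul, Finset.sum_sub_distrib, sum_greedy, hw, sub_self, zero_mul] at h
  simp only [sub_mul, Finset.sum_sub_distrib] at h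
  linarith

/-- The bathtub principle for the logarithms of the sides and the weights 1 - u_i/c. It turns the
side products of the conjecture, which single out an index, into products with freely chosen
weights. -/
lemma sideProd_rpow_le {d : ℕ} {l : Fin d → ℝ} (hl : ∀ i, 0 < l i) (hmono : Monotone l) (j : Fin d)
    {θ c : ℝ} (hc : 0 < c) {u : Fin d → ℝ} (hu0 : ∀ i, 0 ≤ u i) (hu1 : ∀ i, u i ≤ c)
    (hu : ∑ i, u i = c * (d - (j : ℕ) - θ)) :
    sideProd (fun i => ENNReal.ofReal (l i)) j θ ^ c ≤ ENNReal.ofReal (∏ i, l i ^ (c - u i)) := by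
  rw [← prod_greedy, ← ofReal_prod_rpow _ hl,
    ENNReal.ofReal_rpow_of_pos (Finset.prod_pos fun i _ => Real.rpow_pos_of_pos (hl i) _)]
  refine ENNReal.ofReal_le_ofReal ?_
  rw [prod_rpow_eq_exp _ hl, prod_rpow_eq_exp _ hl, ← Real.exp_mul]
  refine Real.exp_le_exp.2 ?_
  have h := sum_greedy_log_le (x := fun i => Real.log (l i))
    (fun i k hik => Real.log_le_log (hl i) (hmono hik)) j (θ := θ) (w := fun i => 1 - u i / c)
    (fun i => by rw [sub_nonneg, div_le_one hc]; exact hu1 i)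
    (fun i => by have := div_nonneg (hu0 i) hc.le; linarith)
    (by
      rw [Finset.sum_sub_distrib, ← Finset.sum_div, hu]
      field_simp
      simp only [Finset.sum_const, Finset.card_univ, Fintype.card_fin, nsmul_eq_mul]
      ring)
  have h' := mul_le_mul_of_nonneg_right h hc.le
  refine h'.trans_eq ?_
  rw [Finset.sum_mul]
  refine Finset.sum_congr rfl fun i _ => ?_
  field_simp

lemma exists_fin_add {d : ℕ} {x : ℝ} (h0 : 0 ≤ x) (h1 : x < d) :
    ∃ (j : Fin d) (θ : ℝ), 0 ≤ θ ∧ θ ≤ 1 ∧ (j : ℕ) + θ = x := by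
  refine ⟨⟨⌊x⌋₊, (Nat.floor_lt h0).2 h1⟩, x - ⌊x⌋₊, ?_, ?_, by simp⟩
  · have := Nat.floor_le h0
    linarith
  · have := Nat.lt_floor_add_one x
    linarith

/-- The ceiling replaces the floor because bound (b) excludes θ = 0; x ≤ d - 1 then yields the
required j ≤ d - 2. -/
lemma exists_fin_add_pos {d : ℕ} {x : ℝ} (h0 : 0 < x) (h1 : x + 1 ≤ d) :
    ∃ (j : Fin d) (θ : ℝ), (j : ℕ) + 2 ≤ d ∧ 0 < θ ∧ θ ≤ 1 ∧ (j : ℕ) + θ = x := by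
  have hc : 0 < ⌈x⌉₊ := Nat.ceil_pos.2 h0
  have hle : ⌈x⌉₊ + 1 ≤ d := by
    have : x ≤ ((d - 1 : ℕ) : ℝ) := by
      have hd : 1 ≤ d := by
        by_contra h
        have : d = 0 := by omega
        subst this
        norm_num at h1
        linarith
      push_cast [hd]
      linarith
    have := Nat.ceil_le.2 this
    omega
  have hcast : ((⌈x⌉₊ - 1 : ℕ) : ℝ) = (⌈x⌉₊ : ℝ) - 1 := by
    push_cast [Nat.one_le_iff_ne_zero.2 hc.ne']
    ring
  refine ⟨⟨⌈x⌉₊ - 1, by omega⟩, x - (⌈x⌉₊ - 1 : ℕ), ?_, ?_, ?_, by simp⟩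
  · simp only
    omega
  · have := Nat.ceil_lt_add_one h0.le
    rw [hcast]
    linarith
  · have := Nat.le_ceil x
    rw [hcast]
    linarith

/-! ### A common form of the three rectangle bounds. -/

lemma OpNormLE.mono {d : ℕ} {l : Fin d → ℝ≥0∞} {g : EuclideanSpace ℝ (Fin d) → ℝ}
    {p q B B' : ℝ≥0∞} (h : OpNormLE l g p q B) (hB : B ≤ B') : OpNormLE l g p q B' :=
  fun f hf hf' => (h f hf hf').trans (by gcongr)

/-- The gap `1/p' - 1/q`. -/
noncomputable def gap (p q : ℝ≥0∞) : ℝ := 1 - recip p - recip q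

/-- The largest weight `min (1/p' - 1/q) (1 - 2/q)` that a single side may carry. -/
noncomputable def cap (p q : ℝ≥0∞) : ℝ := min (gap p q) (1 - 2 * recip q)

lemma gap_of_mem_T {d : ℕ} {p q : ℝ≥0∞} (hT : (p, q) ∈ T d) :
    (d + 2 : ℝ) / d * recip q ≤ gap p q + recip q := by
  have := hT.2.2.2
  rw [recip'_eq hT.1] at this
  unfold gap
  simp only at this
  linarith

/-- This is q ≥ ((d+2)/d) p' rewritten for the gap. It says that d sides carrying at most the gap
each have room for the total weight 2/q. -/
lemma two_mul_recip_le {d : ℕ} [NeZero d] {p q : ℝ≥0∞} (hT : (p, q) ∈ T d) :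
    2 * recip q ≤ d * gap p q := by
  have h := gap_of_mem_T hT
  have hd : (0 : ℝ) < d := by exact_mod_cast NeZero.pos d
  rw [div_mul_eq_mul_div, div_le_iff₀ hd] at h
  linarith

lemma gap_pos {d : ℕ} [NeZero d] {p q : ℝ≥0∞} (hT : (p, q) ∈ T d) (hq : q ≠ ∞) : 0 < gap p q := by
  have h := two_mul_recip_le hT
  have hd : (0 : ℝ) < d := by exact_mod_cast NeZero.pos d
  have := recip_pos hT.2.1 hq
  by_contra! h'
  nlinarith

lemma four_mul_recip {q : ℝ≥0∞} (hq : 1 ≤ q) :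
    (4 < q → 4 * recip q < 1) ∧ (q ≤ 4 → 1 ≤ 4 * recip q) := by
  have h4 : recip 4 = 1 / 4 := by simp [recip]
  constructor
  · intro h
    have := recip_lt_recip (by norm_num) h
    linarith
  · intro h
    have := recip_le_recip hq h
    linarith

lemma conjExponent_div_three_le {p q : ℝ≥0∞} (hq : 4 < q) (hqp : q ≤ p) :
    ENNReal.conjExponent (q / 3) ≤ p := by
  have h1 : 1 + 3⁻¹ ≤ q / 3 := by
    rw [ENNReal.le_div_iff_mul_le (by simp) (by simp), add_mul,
      ENNReal.inv_mul_cancel (by simp) (by simp)]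
    norm_num
    exact hq.le
  have h2 : 3⁻¹ ≤ q / 3 - 1 := ENNReal.le_sub_of_add_le_left (by simp) h1
  have h3 : (q / 3 - 1)⁻¹ ≤ 3 := by
    rw [ENNReal.inv_le_iff_inv_le]
    exact h2
  calc ENNReal.conjExponent (q / 3) ≤ 1 + 3 := by
        unfold ENNReal.conjExponent
        gcongr
    _ = 4 := by norm_num
    _ ≤ p := hq.le.trans hqp

/-- The three bounds of the restriction conjecture above rectangles in a common form: the side
`l_i` may be given any weight `u_i ∈ [0, cap]`, of total weight `2/q`. -/
theorem exists_opNormLE_prod {d : ℕ} [NeZero d] {p q : ℝ≥0∞} (hT : (p, q) ∈ T d) (hq : q ≠ ∞)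
    (hc : RectConjecture d p q) :
    ∃ (N : ℕ) (ε₀ : ℝ), 0 < ε₀ ∧ ε₀ ≤ 1 / 2 ∧ ∀ ε : ℝ, 0 ≤ ε → (q ≤ p → 0 < ε) →
      ∃ C : ℝ≥0, ∀ u : Fin d → ℝ, (∀ i, 0 ≤ u i) → (∀ i, u i ≤ cap p q) →
        ∑ i, u i = 2 * recip q → ∀ l : Fin d → ℝ, (∀ i, 0 < l i) → Monotone l →
        ∀ R : ℝ, 1 ≤ R → (∀ i j, l i ≤ R * l j) → ∀ g : EuclideanSpace ℝ (Fin d) → ℝ,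
        IsElliptic N ε₀ (fun i => ENNReal.ofReal (l i)) g →
        OpNormLE (fun i => ENNReal.ofReal (l i)) g p q
          (C * ENNReal.ofReal ((∏ i, l i ^ (gap p q - u i)) * R ^ ε)) := by
  obtain ⟨N, ε₀, hε₀, hε₀', hlt, hle, hfour⟩ := hc
  refine ⟨N, ε₀, hε₀, hε₀', fun ε hε hε' => ?_⟩
  have hp1 : 1 ≤ p := hT.1
  have hq1 : 1 ≤ q := hT.2.1
  have hQ := recip_pos hq1 hq
  have hs := gap_pos hT hq
  have hsd := two_mul_recip_le hT
  have hd : (0 : ℝ) < d := by exact_mod_cast NeZero.pos d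
  have hTq : recip q < (d : ℝ) / (2 * ((d : ℝ) + 1)) := hT.2.2.1
  rw [lt_div_iff₀ (by positivity)] at hTq
  have hgap : recip' p - recip q = gap p q := by rw [recip'_eq hp1, gap]
  have hRε : ∀ R : ℝ, 1 ≤ R → 1 ≤ R ^ ε := fun R hR => Real.one_le_rpow hR hε
  rcases lt_or_ge p q with hpq | hqp
  -- The relation in (a) reads gap · (d - j - θ) = 2/q, so it prescribes j + θ.
  · have hx0 : 0 ≤ d - 2 * recip q / gap p q := by
      rw [sub_nonneg, div_le_iff₀ hs]; exact hsd
    have hx1 : d - 2 * recip q / gap p q < d := by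
      have : 0 < 2 * recip q / gap p q := by positivity
      linarith
    obtain ⟨j, θ, hθ0, hθ1, hjθ⟩ := exists_fin_add hx0 hx1
    have hD : gap p q * ((d : ℝ) - (j : ℕ) - θ) = 2 * recip q := by
      have : (d : ℝ) - (j : ℕ) - θ = 2 * recip q / gap p q := by linarith
      rw [this]
      field_simp
    obtain ⟨C, hC⟩ := hlt hpq j θ hθ0 hθ1 (by
      rw [recip'_eq hp1]
      unfold gap at hD
      linarith)
    refine ⟨C, fun u hu0 hu1 hu l hl hmono R hR hRl g hg => (hC _ g (by simpa using hl)
      (fun i k hik => ENNReal.ofReal_le_ofReal (hmono hik)) hg).mono ?_⟩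
    rw [hgap]
    gcongr
    refine (sideProd_rpow_le hl hmono j hs hu0 (fun i => (hu1 i).trans (min_le_left _ _))
      (by rw [hu, hD])).trans (ENNReal.ofReal_le_ofReal ?_)
    exact le_mul_of_one_le_right (Finset.prod_nonneg fun i _ => (Real.rpow_pos_of_pos (hl i) _).le)
      (hRε R hR)
  · have hε1 := hε' hqp
    rcases lt_or_ge 4 q with hq4 | hq4
    · obtain ⟨C, hC⟩ := hfour hq4 (conjExponent_div_three_le hq4 hqp)
      refine ⟨C, fun u hu0 hu1 hu l hl hmono R hR hRl g hg => (hC _ g (by simpa using hl)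
        (fun i k hik => ENNReal.ofReal_le_ofReal (hmono hik)) (by simp) hg).mono ?_⟩
      rw [hgap, mul_assoc]
      gcongr
      rw [ENNReal.ofReal_rpow_of_pos (hl _), ← ENNReal.ofReal_prod_of_nonneg (fun i _ => (hl i).le),
        ENNReal.ofReal_rpow_of_pos (Finset.prod_pos fun i _ => hl i),
        ← ENNReal.ofReal_mul (Real.rpow_nonneg (Finset.prod_nonneg fun i _ => (hl i).le) _)]
      refine ENNReal.ofReal_le_ofReal (le_trans ?_ (le_mul_of_one_le_right
        (Finset.prod_nonneg fun i _ => (Real.rpow_pos_of_pos (hl i) _).le) (hRε R hR)))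
      -- Bound (c) corresponds to all of the weight 2/q on the largest side, which is the best
      -- choice; moving weight to smaller sides only enlarges the product.
      have hlog : ∑ i, u i * Real.log (l i) ≤ ∑ i, u i * Real.log (l ⊤) :=
        Finset.sum_le_sum fun i _ => mul_le_mul_of_nonneg_left
          (Real.log_le_log (hl i) (hmono le_top)) (hu0 i)
      rw [← Finset.sum_mul, hu] at hlog
      have hsplit : ∑ i, Real.log (l i) =
          ∑ i with i < (⊤ : Fin d), Real.log (l i) + Real.log (l ⊤) := by
        rw [← Finset.sum_filter_add_sum_filter_not _ (fun i => i < (⊤ : Fin d))]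
        congr 1
        rw [Finset.sum_eq_single_of_mem ⊤ (by simp)]
        intro i hi hne
        simp [lt_top_iff_ne_top, hne] at hi
      rw [prod_rpow_eq_exp _ hl, Real.rpow_def_of_pos (Finset.prod_pos fun i _ => hl i),
        Real.rpow_def_of_pos (hl _), ← Real.exp_add, Real.log_prod (fun i _ => (hl i).ne')]
      refine Real.exp_le_exp.2 ?_
      simp only [sub_mul, Finset.sum_sub_distrib, ← Finset.mul_sum]
      rw [hsplit]
      unfold gap
      nlinarith [hlog]
    -- Now (b) applies, with (1 - 2/q)(d - j - θ) = 2/q. Since q ≤ 4, the quotient 2/q : (1 - 2/q)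
    -- is at least 1, which leaves j ≤ d - 2.
    · have hQ4 := (four_mul_recip hq1).2 hq4
      have hc0 : 0 < 1 - 2 * recip q := by nlinarith
      obtain ⟨j, θ, hj2, hθ0, hθ1, hjθ⟩ := exists_fin_add_pos (d := d)
        (x := d - 2 * recip q / (1 - 2 * recip q))
        (by rw [sub_pos, div_lt_iff₀ hc0]; linarith)
        (by
          have : 1 ≤ 2 * recip q / (1 - 2 * recip q) := by rw [le_div_iff₀ hc0]; linarith
          linarith)
      have hD : (1 - 2 * recip q) * ((d : ℝ) - (j : ℕ) - θ) = 2 * recip q := by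
        have : (d : ℝ) - (j : ℕ) - θ = 2 * recip q / (1 - 2 * recip q) := by linarith
        rw [this]
        field_simp
      obtain ⟨C, hC⟩ := hle hqp j θ hj2 hθ0 hθ1 (by linarith) ε hε1
      refine ⟨C, fun u hu0 hu1 hu l hl hmono R hR hRl g hg => (hC _ g (by simpa using hl)
        (fun i k hik => ENNReal.ofReal_le_ofReal (hmono hik)) (by simp) hg).mono ?_⟩
      -- As q ≤ p, the gap splits into 1/q - 1/p, shared by all sides, and the cap 1 - 2/q, to which
      -- the weights refer.
      have hprod : (∏ i, l i ^ (gap p q - u i)) =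
          (∏ i, l i) ^ (recip q - recip p) * ∏ i, l i ^ ((1 - 2 * recip q) - u i) := by
        rw [← Real.finsetProd_rpow _ _ fun i _ => (hl i).le, ← Finset.prod_mul_distrib]
        refine Finset.prod_congr rfl fun i _ => ?_
        rw [← Real.rpow_add (hl i)]
        congr 1
        unfold gap
        ring
      have hP : 0 < ∏ i, l i := Finset.prod_pos fun i _ => hl i
      rw [hprod, mul_right_comm, mul_assoc (C : ℝ≥0∞), mul_assoc (C : ℝ≥0∞),
        ENNReal.ofReal_mul (by
          have := Finset.prod_nonneg (s := Finset.univ)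
            (f := fun i => l i ^ ((1 - 2 * recip q) - u i))
            fun i _ => (Real.rpow_pos_of_pos (hl i) _).le
          positivity),
        ENNReal.ofReal_mul (Real.rpow_nonneg hP.le _),
        ← ENNReal.ofReal_prod_of_nonneg (fun i _ => (hl i).le), ENNReal.ofReal_rpow_of_pos hP]
      gcongr
      · exact sideProd_rpow_le hl hmono j hc0 hu0 (fun i => (hu1 i).trans (min_le_right _ _))
          (by rw [hu, hD])
      · rw [← ENNReal.ofReal_div_of_pos (hl j), ENNReal.ofReal_rpow_of_pos (div_pos (hl _) (hl _))]
        refine ENNReal.ofReal_le_ofReal (Real.rpow_le_rpow (div_pos (hl _) (hl _)).le ?_ hε)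
        rw [div_le_iff₀ (hl j)]
        exact hRl _ _

/-! ### The normalised phase `2/(β(β-1)) ((1+y)^β - 1 - βy)` -/

/-- The second order Taylor remainder of `(1+y)^β` at `0`, normalised to second derivative `2`. -/
noncomputable def taylorRem (β y : ℝ) : ℝ := 2 / (β * (β - 1)) * ((1 + y) ^ β - 1 - β * y)

noncomputable def taylorRemDeriv (β y : ℝ) : ℝ := 2 / (β - 1) * ((1 + y) ^ (β - 1) - 1)

/-- The second derivative of `taylorRem β y - y²`. -/
noncomputable def curvExcess (β y : ℝ) : ℝ := 2 * ((1 + y) ^ (β - 2) - 1)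

lemma hasDerivAt_taylorRem {β y : ℝ} (hβ : 1 < β) (hy : |y| < 1) :
    HasDerivAt (taylorRem β) (taylorRemDeriv β y) y := by
  have h1 : 1 + y ≠ 0 := by rw [abs_lt] at hy; linarith
  have h := ((((hasDerivAt_id y).const_add 1).rpow_const (p := β) (Or.inl h1)).sub_const 1).sub
    ((hasDerivAt_id y).const_mul β)
  have h' := h.const_mul (2 / (β * (β - 1)))
  have : β ≠ 0 := by linarith
  have : β - 1 ≠ 0 := by linarith
  refine h'.congr_deriv ?_
  simp only [id, taylorRemDeriv]
  field_simp

lemma hasDerivAt_taylorRemDeriv {β y : ℝ} (hβ : 1 < β) (hy : |y| < 1) :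
    HasDerivAt (taylorRemDeriv β) (2 + curvExcess β y) y := by
  have h1 : 1 + y ≠ 0 := by rw [abs_lt] at hy; linarith
  have h := (((hasDerivAt_id y).const_add 1).rpow_const (p := β - 1) (Or.inl h1)).sub_const 1
  have h' := h.const_mul (2 / (β - 1))
  have : β - 1 ≠ 0 := by linarith
  refine h'.congr_deriv ?_
  simp only [id, curvExcess]
  rw [show β - 1 - 1 = β - 2 by ring]
  field_simp
  ring

lemma curvExcess_zero (β : ℝ) : curvExcess β 0 = 0 := by simp [curvExcess]

lemma contDiffOn_curvExcess (β : ℝ) {n : WithTop ℕ∞} :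
    ContDiffOn ℝ n (curvExcess β) (Metric.ball 0 1) := by
  refine contDiffOn_const.mul (((contDiffOn_const.add contDiffOn_id).rpow_const_of_ne ?_).sub
    contDiffOn_const)
  intro y hy
  rw [Metric.mem_ball, dist_zero_right, Real.norm_eq_abs, abs_lt] at hy
  simp only [id]
  linarith

lemma contDiffOn_taylorRem (β : ℝ) {n : WithTop ℕ∞} :
    ContDiffOn ℝ n (taylorRem β) (Metric.ball 0 1) := by
  refine contDiffOn_const.mul ((((contDiffOn_const.add contDiffOn_id).rpow_const_of_ne ?_).sub
    contDiffOn_const).sub (contDiffOn_const.mul contDiffOn_id))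
  intro y hy
  rw [Metric.mem_ball, dist_zero_right, Real.norm_eq_abs, abs_lt] at hy
  simp only [id]
  linarith

/-- The derivatives of `curvExcess` up to order `N`, rescaled to `[-ρ, ρ]`, are at most `ε`. -/
def CurvSmall (N : ℕ) (ε β ρ : ℝ) : Prop :=
  ∀ n ≤ N, ∀ t : ℝ, |t| ≤ ρ → ρ ^ n * ‖iteratedFDeriv ℝ n (curvExcess β) t‖ ≤ ε

/-- In order zero the excess is small near 0 because it is continuous and vanishes there. In higher
orders the derivatives are merely bounded on [-1/2, 1/2], and the factor ρ^n ≤ ρ makes them small.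
-/
lemma exists_curvSmall (N : ℕ) {ε : ℝ} (hε : 0 < ε) (β : ℝ) :
    ∃ ρ₀ : ℝ, 0 < ρ₀ ∧ ∀ ρ, 0 < ρ → ρ ≤ ρ₀ → CurvSmall N ε β ρ := by
  have hcont : ∀ n : ℕ, ContinuousOn (iteratedFDeriv ℝ n (curvExcess β)) (Metric.ball 0 1) := by
    intro n
    refine ((contDiffOn_curvExcess β (n := n)).continuousOn_iteratedFDerivWithin le_rfl
      Metric.isOpen_ball.uniqueDiffOn).congr ?_
    intro t ht
    exact (iteratedFDerivWithin_of_isOpen n Metric.isOpen_ball ht).symm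
  have hsub : Metric.closedBall (0 : ℝ) (1 / 2) ⊆ Metric.ball 0 1 :=
    Metric.closedBall_subset_ball (by norm_num)
  have hb : ∀ n : ℕ, ∃ K, ∀ t ∈ Metric.closedBall (0 : ℝ) (1 / 2),
      ‖iteratedFDeriv ℝ n (curvExcess β) t‖ ≤ K := fun n =>
    (isCompact_closedBall _ _).exists_bound_of_continuousOn ((hcont n).mono hsub)
  choose K hK using hb
  obtain ⟨δ, hδ, hδ'⟩ := Metric.continuousAt_iff.1
    (((contDiffOn_curvExcess β (n := 0)).continuousOn).continuousAt
      (Metric.ball_mem_nhds (0 : ℝ) one_pos)) ε hε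
  set S := ∑ n ∈ Finset.range (N + 1), |K n| with hS
  have hS0 : 0 ≤ S := Finset.sum_nonneg fun _ _ => abs_nonneg _
  refine ⟨min (1 / 2) (min (δ / 2) (ε / (S + 1))), by positivity, fun ρ hρ hρ' n hn t ht => ?_⟩
  have h1 : ρ ≤ 1 / 2 := hρ'.trans (min_le_left _ _)
  have h2 : ρ ≤ δ / 2 := hρ'.trans ((min_le_right _ _).trans (min_le_left _ _))
  have h3 : ρ ≤ ε / (S + 1) := hρ'.trans ((min_le_right _ _).trans (min_le_right _ _))
  rw [le_div_iff₀ (by positivity)] at h3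
  rcases n.eq_zero_or_pos with rfl | hn0
  · have := hδ' (x := t) (by rw [dist_zero_right, Real.norm_eq_abs]; linarith)
    rw [curvExcess_zero, dist_zero_right] at this
    simpa using this.le
  · have hKn : ‖iteratedFDeriv ℝ n (curvExcess β) t‖ ≤ S := by
      refine (hK n t ?_).trans ((le_abs_self _).trans ?_)
      · rw [mem_closedBall_zero_iff, Real.norm_eq_abs]
        linarith
      · exact Finset.single_le_sum (f := fun n => |K n|) (fun _ _ => abs_nonneg _)
          (Finset.mem_range.2 (by omega))
    have hpow : ρ ^ n ≤ ρ := pow_le_of_le_one hρ.le (by linarith) hn0.ne'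
    calc ρ ^ n * ‖iteratedFDeriv ℝ n (curvExcess β) t‖ ≤ ρ * S := by gcongr
      _ ≤ ε := by nlinarith

/-! ### Separable phases -/

variable {d : ℕ}

/-- The `i`-th coordinate functional. -/
noncomputable def coordL (i : Fin d) : EuclideanSpace ℝ (Fin d) →L[ℝ] ℝ := EuclideanSpace.proj i

@[simp] lemma coordL_apply (i : Fin d) (ξ : EuclideanSpace ℝ (Fin d)) : coordL i ξ = ξ i := rfl

lemma norm_coordL_le (i : Fin d) : ‖coordL i‖ ≤ 1 :=
  ContinuousLinearMap.opNorm_le_bound _ zero_le_one fun ξ => by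
    simpa using PiLp.norm_apply_le ξ i

/-- The bilinear form `(v, w) ↦ v_i w_i`. -/
noncomputable def coordSq (i : Fin d) :
    EuclideanSpace ℝ (Fin d) →L[ℝ] EuclideanSpace ℝ (Fin d) →L[ℝ] ℝ :=
  (coordL i).smulRight (coordL i)

@[simp] lemma coordSq_apply (i : Fin d) (v w : EuclideanSpace ℝ (Fin d)) :
    coordSq i v w = v i * w i := rfl

lemma norm_coordSq_le (i : Fin d) : ‖coordSq i‖ ≤ 1 := by
  rw [coordSq, ContinuousLinearMap.norm_smulRight_apply]
  exact mul_le_one₀ (norm_coordL_le i) (norm_nonneg _) (norm_coordL_le i)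

lemma isOpen_box (l : Fin d → ℝ≥0∞) : IsOpen (box l) := by
  have : box l = ⋂ j, {ξ : EuclideanSpace ℝ (Fin d) | ENNReal.ofReal |ξ j| < l j} := by
    ext; simp [box]
  rw [this]
  refine isOpen_iInter_of_finite fun j => ?_
  exact isOpen_lt (ENNReal.continuous_ofReal.comp (by fun_prop)) continuous_const

lemma hasFDerivAt_separable {φ φ' : Fin d → ℝ → ℝ} {ξ : EuclideanSpace ℝ (Fin d)}
    (h : ∀ i, HasDerivAt (φ i) (φ' i (ξ i)) (ξ i)) :
    HasFDerivAt (fun ξ : EuclideanSpace ℝ (Fin d) => ∑ i, φ i (ξ i))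
      (∑ i, φ' i (ξ i) • coordL i) ξ := by
  refine HasFDerivAt.fun_sum fun i _ => ?_
  exact (h i).comp_hasFDerivAt ξ (coordL i).hasFDerivAt

lemma hess_separable {φ φ' φ'' : Fin d → ℝ → ℝ} {U : Set (EuclideanSpace ℝ (Fin d))}
    (hU : IsOpen U) (h : ∀ ξ ∈ U, ∀ i, HasDerivAt (φ i) (φ' i (ξ i)) (ξ i))
    (h' : ∀ ξ ∈ U, ∀ i, HasDerivAt (φ' i) (φ'' i (ξ i)) (ξ i))
    {ξ : EuclideanSpace ℝ (Fin d)} (hξ : ξ ∈ U) :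
    hess (fun ξ => ∑ i, φ i (ξ i)) ξ = ∑ i, φ'' i (ξ i) • coordSq i := by
  have h1 : fderiv ℝ (fun ξ : EuclideanSpace ℝ (Fin d) => ∑ i, φ i (ξ i)) =ᶠ[nhds ξ]
      fun ξ => ∑ i, φ' i (ξ i) • coordL i := by
    filter_upwards [hU.mem_nhds hξ] with η hη
    exact (hasFDerivAt_separable (h η hη)).fderiv
  rw [hess, h1.fderiv_eq]
  refine HasFDerivAt.fderiv ?_
  refine HasFDerivAt.fun_sum fun i _ => ?_
  have := ((h' ξ hξ i).comp_hasFDerivAt ξ (coordL i).hasFDerivAt).smul_const (coordL i)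
  refine this.congr_fderiv ?_
  ext v w
  simp [mul_assoc]

/-- The model phase `∑ b_i² Φ_{β_i}(ζ_i / b_i)` on a small rectangle. -/
noncomputable def modelPhase (β b : Fin d → ℝ) (ζ : EuclideanSpace ℝ (Fin d)) : ℝ :=
  ∑ i, b i ^ 2 * taylorRem (β i) (ζ i / b i)

lemma pert_modelPhase (β b : Fin d → ℝ) :
    pert (modelPhase β b) = fun ζ => ∑ i, (b i ^ 2 * taylorRem (β i) (ζ i / b i) - ζ i ^ 2) := by
  ext ζ
  rw [pert, modelPhase, EuclideanSpace.norm_sq_eq, Finset.sum_sub_distrib]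
  simp

/-- Used with c = b and then with c = 1, so that two differentiations of b² f(z/b) cancel both
factors b. -/
lemma hasDerivAt_scaled {b z : ℝ} (hb : b ≠ 0) {f : ℝ → ℝ} {f' c : ℝ}
    (h : HasDerivAt f f' (z / b)) : HasDerivAt (fun z => c * b * f (z / b)) (c * f') z := by
  have h1 : HasDerivAt (fun z : ℝ => z / b) (1 / b) z := (hasDerivAt_id z).div_const b
  have := (h.comp z h1).const_mul (c * b)
  refine this.congr_deriv ?_
  field_simp

lemma hess_modelPhase {β b : Fin d → ℝ} (hβ : ∀ i, 1 < β i) (hb : ∀ i, b i ≠ 0)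
    {U : Set (EuclideanSpace ℝ (Fin d))} (hU : IsOpen U) (hUb : ∀ ξ ∈ U, ∀ i, |ξ i / b i| < 1)
    {ξ : EuclideanSpace ℝ (Fin d)} (hξ : ξ ∈ U) :
    hess (modelPhase β b) ξ = ∑ i, (2 + curvExcess (β i) (ξ i / b i)) • coordSq i := by
  refine hess_separable (φ := fun i z => b i ^ 2 * taylorRem (β i) (z / b i))
    (φ' := fun i z => b i * taylorRemDeriv (β i) (z / b i))
    (φ'' := fun i z => 2 + curvExcess (β i) (z / b i)) hU ?_ ?_ hξ
  · intro ξ hξ i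
    simpa [sq] using hasDerivAt_scaled (c := b i) (hb i) (hasDerivAt_taylorRem (hβ i) (hUb ξ hξ i))
  · intro ξ hξ i
    simpa using hasDerivAt_scaled (c := 1) (hb i) (hasDerivAt_taylorRemDeriv (hβ i) (hUb ξ hξ i))

lemma fderiv_hess_pert_modelPhase {β b : Fin d → ℝ} (hβ : ∀ i, 1 < β i) (hb : ∀ i, b i ≠ 0)
    {U : Set (EuclideanSpace ℝ (Fin d))} (hU : IsOpen U) (hUb : ∀ ξ ∈ U, ∀ i, |ξ i / b i| < 1)
    {ξ : EuclideanSpace ℝ (Fin d)} (hξ : ξ ∈ U) :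
    fderiv ℝ (pert (modelPhase β b)) ξ =
        ∑ i, (b i * taylorRemDeriv (β i) (ξ i / b i) - 2 * ξ i) • coordL i ∧
      hess (pert (modelPhase β b)) ξ = ∑ i, curvExcess (β i) (ξ i / b i) • coordSq i := by
  have h1 : ∀ ξ ∈ U, ∀ i, HasDerivAt (fun z => b i ^ 2 * taylorRem (β i) (z / b i) - z ^ 2)
      (b i * taylorRemDeriv (β i) (ξ i / b i) - 2 * ξ i) (ξ i) := by
    intro ξ hξ i
    have := (hasDerivAt_scaled (c := b i) (hb i) (hasDerivAt_taylorRem (hβ i) (hUb ξ hξ i))).sub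
      (hasDerivAt_pow 2 (ξ i))
    refine (this.congr_deriv (by simp)).congr_of_eventuallyEq (.of_forall fun z => ?_)
    simp [sq]
  have h2 : ∀ ξ ∈ U, ∀ i, HasDerivAt (fun z => b i * taylorRemDeriv (β i) (z / b i) - 2 * z)
      (curvExcess (β i) (ξ i / b i)) (ξ i) := by
    intro ξ hξ i
    have := (hasDerivAt_scaled (c := 1) (hb i)
      (hasDerivAt_taylorRemDeriv (hβ i) (hUb ξ hξ i))).sub ((hasDerivAt_id (ξ i)).const_mul 2)
    refine (this.congr_deriv (by ring)).congr_of_eventuallyEq (.of_forall fun z => ?_)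
    simp
  rw [pert_modelPhase]
  exact ⟨(hasFDerivAt_separable
      (φ := fun i z => b i ^ 2 * taylorRem (β i) (z / b i) - z ^ 2)
      (φ' := fun i z => b i * taylorRemDeriv (β i) (z / b i) - 2 * z) (h1 ξ hξ)).fderiv,
    hess_separable (φ := fun i z => b i ^ 2 * taylorRem (β i) (z / b i) - z ^ 2)
      (φ' := fun i z => b i * taylorRemDeriv (β i) (z / b i) - 2 * z)
      (φ'' := fun i z => curvExcess (β i) (z / b i)) hU h1 h2 hξ⟩

/-- Chain rule for the functional η ↦ τ η_i, of norm at most |τ|: each derivative costs one factor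
|τ|. This is the source of the powers ρ^n in `CurvSmall`. -/
lemma norm_iteratedFDeriv_comp_coord_le {F : Type*} [NormedAddCommGroup F] [NormedSpace ℝ F]
    {f : ℝ → ℝ} (hf : ∀ n : ℕ, ContDiffOn ℝ n f (Metric.ball 0 1)) (τ : ℝ) (i : Fin d) {B : F}
    (hB : ‖B‖ ≤ 1) (n : ℕ) {ξ : EuclideanSpace ℝ (Fin d)} (hξ : |τ * ξ i| < 1) :
    ContDiffAt ℝ n (fun η : EuclideanSpace ℝ (Fin d) => f (τ * η i) • B) ξ ∧
    ‖iteratedFDeriv ℝ n (fun η : EuclideanSpace ℝ (Fin d) => f (τ * η i) • B) ξ‖ ≤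
      |τ| ^ n * ‖iteratedFDeriv ℝ n f (τ * ξ i)‖ := by
  have hξ' : τ * ξ i ∈ Metric.ball (0 : ℝ) 1 := by simpa using hξ
  have hfB : ContDiffOn ℝ n (fun t => f t • B) (Metric.ball 0 1) := (hf n).smul contDiffOn_const
  set L : EuclideanSpace ℝ (Fin d) →L[ℝ] ℝ := τ • coordL i with hL
  have hLξ : ∀ η, L η = τ * η i := fun η => by simp [hL]
  have hopen : IsOpen (L ⁻¹' Metric.ball 0 1) := Metric.isOpen_ball.preimage L.continuous
  have hmem : ξ ∈ L ⁻¹' Metric.ball 0 1 := by rw [Set.mem_preimage, hLξ]; exact hξ'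
  have hcomp : (fun η : EuclideanSpace ℝ (Fin d) => f (τ * η i) • B) = (fun t => f t • B) ∘ L := by
    ext η
    simp [hLξ]
  have hLn : ‖L‖ ≤ |τ| := by
    rw [hL, norm_smul, Real.norm_eq_abs]
    exact mul_le_of_le_one_right (abs_nonneg _) (norm_coordL_le i)
  rw [hcomp]
  refine ⟨(hfB.comp_continuousLinearMap L).contDiffAt (hopen.mem_nhds hmem), ?_⟩
  rw [← iteratedFDerivWithin_of_isOpen n hopen hmem,
    L.iteratedFDerivWithin_comp_right hfB Metric.isOpen_ball.uniqueDiffOn hopen.uniqueDiffOn hmem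
      le_rfl,
    iteratedFDerivWithin_of_isOpen n Metric.isOpen_ball hmem]
  refine (ContinuousMultilinearMap.norm_compContinuousLinearMap_le _ _).trans ?_
  rw [Finset.prod_const, Finset.card_univ, Fintype.card_fin, mul_comm, hLξ]
  have hleft : ‖iteratedFDeriv ℝ n (fun t => f t • B) (τ * ξ i)‖ ≤
      ‖iteratedFDeriv ℝ n f (τ * ξ i)‖ := by
    have h := ContinuousLinearMap.norm_iteratedFDeriv_comp_left
      ((1 : ℝ →L[ℝ] ℝ).smulRight B) (((hf n).contDiffAt (Metric.isOpen_ball.mem_nhds hξ')))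
      (le_refl (n : WithTop ℕ∞))
    refine h.trans (mul_le_of_le_one_left (norm_nonneg _) ?_)
    simpa using hB
  gcongr

lemma norm_iteratedFDeriv_sum_le {E F ι : Type*} [NormedAddCommGroup E] [NormedSpace ℝ E]
    [NormedAddCommGroup F] [NormedSpace ℝ F] (s : Finset ι) {f : ι → E → F} {n : ℕ} {x : E}
    (hf : ∀ i ∈ s, ContDiffAt ℝ n (f i) x) :
    ‖iteratedFDeriv ℝ n (fun y => ∑ i ∈ s, f i y) x‖ ≤ ∑ i ∈ s, ‖iteratedFDeriv ℝ n (f i) x‖ := by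
  classical
  induction s using Finset.induction with
  | empty => simp
  | insert i s hi ih =>
    have h1 : ContDiffAt ℝ n (f i) x := hf i (Finset.mem_insert_self _ _)
    have h2 : ContDiffAt ℝ n (fun y => ∑ i ∈ s, f i y) x :=
      ContDiffAt.sum fun k hk => hf k (Finset.mem_insert_of_mem hk)
    have h3 : (fun y => ∑ k ∈ insert i s, f k y) = f i + fun y => ∑ k ∈ s, f k y := by
      ext y
      simp [Finset.sum_insert hi]
    rw [Finset.sum_insert hi, h3, iteratedFDeriv_add_apply h1 h2]
    exact (norm_add_le _ _).trans (by
      gcongr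
      exact ih fun k hk => hf k (Finset.mem_insert_of_mem hk))

lemma mem_box_ofReal {l : Fin d → ℝ} {ξ : EuclideanSpace ℝ (Fin d)} :
    ξ ∈ box (fun i => ENNReal.ofReal (l i)) ↔ ∀ i, |ξ i| < l i := by
  simp only [box, Set.mem_ofPred_eq]
  exact forall_congr' fun i => ENNReal.ofReal_lt_ofReal_iff_of_nonneg (abs_nonneg _)

lemma mem_box_one {ξ : EuclideanSpace ℝ (Fin d)} :
    ξ ∈ box (fun _ : Fin d => 1) ↔ ∀ i, |ξ i| < 1 := by
  simpa using mem_box_ofReal (l := fun _ => 1) (ξ := ξ)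

/-- Tested on the points a e_i of the coordinate axis, with a < l_i. -/
lemma le_of_box_subset {l m : Fin d → ℝ} (hl : ∀ i, 0 < l i)
    (h : box (fun i => ENNReal.ofReal (l i)) ⊆ box (fun i => ENNReal.ofReal (m i))) (i : Fin d) :
    l i ≤ m i := by
  refine le_of_forall_lt_imp_le_of_dense fun a ha => ?_
  rcases le_or_gt a 0 with ha0 | ha0
  · have := mem_box_ofReal.1 (h ((mem_box_ofReal (ξ := 0)).2 (by simpa using hl))) i
    simp at this
    linarith
  · have := mem_box_ofReal.1 (h ((mem_box_ofReal (ξ := EuclideanSpace.single i a)).2 (fun k => by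
      by_cases hk : k = i
      · subst hk; simpa [abs_of_pos ha0] using ha
      · simpa [hk] using hl k))) i
    simp [abs_of_pos ha0] at this
    exact this.le

/-- The model phase is elliptic over rectangles that are small compared with `b`. -/
theorem isElliptic_modelPhase {N : ℕ} {ε₀ ε ρ : ℝ} {β b l : Fin d → ℝ} (hβ : ∀ i, 1 < β i)
    (hb : ∀ i, b i ≠ 0) (hl : ∀ i, 0 < l i) (hlb : ∀ i, l i ≤ ρ * |b i|) (hρ : ρ ≤ 1 / 2)
    (hε : d * ε < ε₀) (hN : ∀ i, CurvSmall N ε (β i) ρ) :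
    IsElliptic N ε₀ (fun i => ENNReal.ofReal (l i)) (modelPhase β b) := by
  have hU := isOpen_box (fun i : Fin d => ENNReal.ofReal (l i))
  have hUb : ∀ ξ ∈ box (fun i => ENNReal.ofReal (l i)), ∀ i, |ξ i / b i| < 1 := by
    intro ξ hξ i
    have h1 := mem_box_ofReal.1 hξ i
    have h2 := hlb i
    have h3 := abs_pos.2 (hb i)
    rw [abs_div, div_lt_one h3]
    nlinarith
  have h0 : (0 : EuclideanSpace ℝ (Fin d)) ∈ box (fun i => ENNReal.ofReal (l i)) :=
    mem_box_ofReal.2 (by simpa using hl)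
  refine ⟨?_, ?_, ?_, ?_, ?_, ?_⟩
  · refine ContDiffOn.sum fun i _ => contDiffOn_const.mul ?_
    have hm : Set.MapsTo (fun ξ : EuclideanSpace ℝ (Fin d) => ξ i / b i)
        (box (fun i => ENNReal.ofReal (l i))) (Metric.ball 0 1) := fun ξ hξ => by
      rw [mem_ball_zero_iff, Real.norm_eq_abs]
      exact hUb ξ hξ i
    exact (contDiffOn_taylorRem (β i)).comp
      (((coordL i).contDiff.div_const (b i)).contDiffOn) hm
  · intro ξ hξ v hv
    rw [hess_modelPhase hβ hb hU hUb hξ]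
    simp only [sum_apply, smul_apply, coordSq_apply,
      smul_eq_mul]
    -- The sum is 2(1 + y)^{β - 2}, positive for |y| < 1 whatever the sign of β - 2.
    have hpos : ∀ i, 0 < 2 + curvExcess (β i) (ξ i / b i) := fun i => by
      have h1 := hUb ξ hξ i
      rw [abs_lt] at h1
      have : 0 < (1 + ξ i / b i) ^ (β i - 2) := Real.rpow_pos_of_pos (by linarith) _
      unfold curvExcess
      linarith
    obtain ⟨i, hi⟩ : ∃ i, v i ≠ 0 := by
      by_contra! h
      exact hv (by ext i; simp [h i])
    refine Finset.sum_pos' (fun k _ => mul_nonneg (hpos k).le (mul_self_nonneg _))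
      ⟨i, Finset.mem_univ _, mul_pos (hpos i) (mul_self_pos.2 hi)⟩
  · rw [pert_modelPhase]
    simp [taylorRem]
  · rw [(fderiv_hess_pert_modelPhase hβ hb hU hUb h0).1]
    simp [taylorRemDeriv]
  · rw [(fderiv_hess_pert_modelPhase hβ hb hU hUb h0).2]
    refine Finset.sum_eq_zero fun i _ => ?_
    refine ContinuousLinearMap.ext fun v => ContinuousLinearMap.ext fun w => ?_
    simp [curvExcess_zero]
  · intro m hm hsub
    have hml := le_of_box_subset hm hsub
    -- Each of the d coordinates contributes at most ε, since the dilated argument stays within ρ of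
    -- 0.
    refine ⟨d * ε, hε, fun n hn ξ hξ => ?_⟩
    rw [mem_box_one] at hξ
    have hτ : ∀ i, |m i / b i| ≤ ρ := fun i => by
      rw [abs_div, abs_of_pos (hm i), div_le_iff₀ (abs_pos.2 (hb i))]
      exact (hml i).trans (hlb i)
    have hτξ : ∀ i, |m i / b i * ξ i| ≤ ρ := fun i => by
      rw [abs_mul]
      exact (mul_le_of_le_one_right (abs_nonneg _) (hξ i).le).trans (hτ i)
    have heq : (fun η => hess (pert (modelPhase β b)) (dilate m η)) =ᶠ[nhds ξ]
        fun η => ∑ i, curvExcess (β i) (m i / b i * η i) • coordSq i := by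
      filter_upwards [(isOpen_box (fun _ : Fin d => 1)).mem_nhds (mem_box_one.2 hξ)] with η hη
      have hη' : dilate m η ∈ box (fun i => ENNReal.ofReal (l i)) := by
        refine hsub (mem_box_ofReal.2 fun i => ?_)
        simp only [dilate, abs_mul, abs_of_pos (hm i)]
        exact mul_lt_of_lt_one_right (hm i) (mem_box_one.1 hη i)
      rw [(fderiv_hess_pert_modelPhase hβ hb hU hUb hη').2]
      refine Finset.sum_congr rfl fun i _ => ?_
      simp only [dilate]
      rw [mul_div_right_comm]
    rw [(heq.iteratedFDeriv ℝ n).eq_of_nhds]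
    have hi := fun i : Fin d => norm_iteratedFDeriv_comp_coord_le
      (F := EuclideanSpace ℝ (Fin d) →L[ℝ] EuclideanSpace ℝ (Fin d) →L[ℝ] ℝ)
      (fun n => contDiffOn_curvExcess (β i)) (m i / b i) i (norm_coordSq_le i) n (ξ := ξ)
      ((hτξ i).trans_lt (by linarith))
    refine (norm_iteratedFDeriv_sum_le _ fun i _ => (hi i).1).trans ?_
    calc _ ≤ ∑ _i : Fin d, ε := Finset.sum_le_sum fun i _ => (hi i).2.trans (le_trans ?_
          (hN i n hn _ (hτξ i)))
      _ = d * ε := by simp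
    gcongr
    exact hτ i

/-! ### Affine changes of variables -/

/-- The oscillatory integral `∫ exp(i (t G(ξ) + x·ξ)) f(ξ) dξ` over the whole space. -/
noncomputable def oscInt (G : EuclideanSpace ℝ (Fin d) → ℝ) (f : EuclideanSpace ℝ (Fin d) → ℂ)
    (z : ℝ × EuclideanSpace ℝ (Fin d)) : ℂ :=
  ∫ ξ, Complex.exp (Complex.I * ((z.1 * G ξ + inner ℝ z.2 ξ : ℝ) : ℂ)) * f ξ

lemma norm_exp_I_mul_ofReal (r : ℝ) : ‖Complex.exp (Complex.I * (r : ℂ))‖ = 1 := by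
  rw [mul_comm]
  exact Complex.norm_exp_ofReal_mul_I r

/-- `L` divides Lebesgue measure by `κ`. -/
def ScalesVolume (L : EuclideanSpace ℝ (Fin d) ≃L[ℝ] EuclideanSpace ℝ (Fin d)) (κ : ℝ) : Prop :=
  Measure.map L volume = ENNReal.ofReal κ⁻¹ • volume

lemma map_affine_volume (a : EuclideanSpace ℝ (Fin d))
    {L : EuclideanSpace ℝ (Fin d) ≃L[ℝ] EuclideanSpace ℝ (Fin d)} {κ : ℝ}
    (hL : ScalesVolume L κ) :
    Measure.map (fun ζ => a + L ζ) volume = ENNReal.ofReal κ⁻¹ • volume := by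
  have h2 : (fun ζ => a + L ζ) = (fun ζ => a + ζ) ∘ L := rfl
  rw [h2, ← Measure.map_map (measurable_const_add a) L.continuous.measurable, hL,
    Measure.map_smul, map_add_left_eq_self]

lemma ScalesVolume.trans {L L' : EuclideanSpace ℝ (Fin d) ≃L[ℝ] EuclideanSpace ℝ (Fin d)}
    {κ κ' : ℝ} (hκ : 0 ≤ κ) (h : ScalesVolume L κ) (h' : ScalesVolume L' κ') :
    ScalesVolume (L.trans L') (κ * κ') := by
  have h2 : (L.trans L' : EuclideanSpace ℝ (Fin d) → EuclideanSpace ℝ (Fin d)) = L' ∘ L := rfl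
  rw [ScalesVolume, h2, ← Measure.map_map L'.continuous.measurable L.continuous.measurable, h,
    Measure.map_smul, h', smul_smul, ← ENNReal.ofReal_mul (inv_nonneg.2 hκ), mul_inv]

lemma scalesVolume_isometry (e : EuclideanSpace ℝ (Fin d) ≃ₗᵢ[ℝ] EuclideanSpace ℝ (Fin d)) :
    ScalesVolume e.toContinuousLinearEquiv 1 := by
  simpa [ScalesVolume] using e.measurePreserving.map_eq

/-- The diagonal map `ζ ↦ (r_i ζ_i)_i`. -/
noncomputable def diagL (r : Fin d → ℝ) (hr : ∀ i, r i ≠ 0) :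
    EuclideanSpace ℝ (Fin d) ≃L[ℝ] EuclideanSpace ℝ (Fin d) :=
  LinearEquiv.toContinuousLinearEquiv
    { toFun := fun ζ => WithLp.toLp 2 fun i => r i * ζ i
      invFun := fun ζ => WithLp.toLp 2 fun i => (r i)⁻¹ * ζ i
      map_add' := fun x y => by ext i; simp [mul_add]
      map_smul' := fun c x => by ext i; simp [mul_left_comm]
      left_inv := fun x => by ext i; simp [hr i]
      right_inv := fun x => by ext i; simp [hr i] }

@[simp] lemma diagL_apply (r : Fin d → ℝ) (hr : ∀ i, r i ≠ 0) (ζ : EuclideanSpace ℝ (Fin d))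
    (i : Fin d) : diagL r hr ζ i = r i * ζ i := rfl

lemma scalesVolume_diagL {r : Fin d → ℝ} (hr : ∀ i, 0 < r i) :
    ScalesVolume (diagL r fun i => (hr i).ne') (∏ i, r i) := by
  have hdet : LinearMap.det (diagL r fun i => (hr i).ne' :
      EuclideanSpace ℝ (Fin d) →ₗ[ℝ] EuclideanSpace ℝ (Fin d)) = ∏ i, r i := by
    rw [← LinearMap.det_toMatrix (EuclideanSpace.basisFun (Fin d) ℝ).toBasis,
      ← Matrix.det_diagonal]
    congr 1
    ext i j
    rw [LinearMap.toMatrix_apply]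
    by_cases h : i = j
    · subst h; simp
    · simp [h]
  have hpos : 0 < ∏ i, r i := Finset.prod_pos fun i _ => hr i
  have h := Measure.map_linearMap_addHaar_eq_smul_addHaar
    (volume : Measure (EuclideanSpace ℝ (Fin d))) (f := (diagL r fun i => (hr i).ne' :
      EuclideanSpace ℝ (Fin d) →ₗ[ℝ] EuclideanSpace ℝ (Fin d))) (by rw [hdet]; exact hpos.ne')
  rw [hdet, abs_of_pos (inv_pos.2 hpos)] at h
  exact h

/-- The map `(t, x) ↦ (t, L (x + t b))`. -/
noncomputable def shear (L : EuclideanSpace ℝ (Fin d) ≃L[ℝ] EuclideanSpace ℝ (Fin d))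
    (b : EuclideanSpace ℝ (Fin d)) :
    ℝ × EuclideanSpace ℝ (Fin d) ≃ₜ ℝ × EuclideanSpace ℝ (Fin d) where
  toFun z := (z.1, L (z.2 + z.1 • b))
  invFun z := (z.1, L.symm z.2 - z.1 • b)
  left_inv z := by simp
  right_inv z := by simp
  continuous_toFun := by fun_prop
  continuous_invFun := by fun_prop

/-- By Fubini: for fixed t the map is affine in x with linear part L. -/
lemma map_shear_volume {L : EuclideanSpace ℝ (Fin d) ≃L[ℝ] EuclideanSpace ℝ (Fin d)}
    (b : EuclideanSpace ℝ (Fin d)) {κ : ℝ} (hL : ScalesVolume L κ) :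
    Measure.map (shear L b) volume = ENNReal.ofReal κ⁻¹ • volume := by
  have h := (MeasurePreserving.id (volume : Measure ℝ)).skew_product
    (μc := (volume : Measure (EuclideanSpace ℝ (Fin d)))) (μd := ENNReal.ofReal κ⁻¹ • volume)
    (g := fun t x => L (x + t • b)) (by unfold Function.uncurry; fun_prop)
    (.of_forall fun t => by
      have := map_affine_volume (L (t • b)) hL
      rw [← this]
      congr 1
      ext1 x
      simp [add_comm])
  have h' := h.map_eq
  rw [Measure.prod_smul_right] at h'
  exact h'

lemma shear_apply (L : EuclideanSpace ℝ (Fin d) ≃L[ℝ] EuclideanSpace ℝ (Fin d))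
    (b : EuclideanSpace ℝ (Fin d)) (z : ℝ × EuclideanSpace ℝ (Fin d)) :
    shear L b z = (z.1, L (z.2 + z.1 • b)) := rfl

/-- Transfer of an extension estimate through an affine change of the frequency variables, modulo
adding an affine function to the phase. -/
theorem OpNormLE.affine {G g : EuclideanSpace ℝ (Fin d) → ℝ} {l : Fin d → ℝ≥0∞} {p q B : ℝ≥0∞}
    (h : OpNormLE l g p q B) (a b : EuclideanSpace ℝ (Fin d)) (c : ℝ)
    (L L' : EuclideanSpace ℝ (Fin d) ≃L[ℝ] EuclideanSpace ℝ (Fin d))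
    (hadj : ∀ x ζ, inner ℝ x (L ζ) = inner ℝ (L' x) ζ) {κ : ℝ} (hκ : 0 < κ)
    (hL : ScalesVolume L κ)
    (hL' : ScalesVolume L' κ)
    (hG : ∀ ζ ∈ box l, G (a + L ζ) = c + inner ℝ b (L ζ) + g ζ)
    {f : EuclideanSpace ℝ (Fin d) → ℂ} (hf : Integrable f) (hfp : MemLp f p)
    (hsupp : ∀ ξ, f ξ ≠ 0 → ∃ ζ ∈ box l, a + L ζ = ξ) :
    eLpNorm (oscInt G f) q volume ≤
      ENNReal.ofReal (κ ^ (1 - recip p - recip q)) * B * eLpNorm f p volume := by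
  set A : EuclideanSpace ℝ (Fin d) ≃ₜ EuclideanSpace ℝ (Fin d) :=
    L.toHomeomorph.trans (Homeomorph.addLeft a) with hA
  have hAapp : ∀ ζ, A ζ = a + L ζ := fun ζ => rfl
  have hAmap : Measure.map A volume = ENNReal.ofReal κ⁻¹ • volume := map_affine_volume a hL
  have hκ' : ENNReal.ofReal κ⁻¹ ≠ 0 := by simpa using hκ
  have hκt : ENNReal.ofReal κ⁻¹ ≠ ∞ := ENNReal.ofReal_ne_top
  have hAemb : MeasurableEmbedding A := A.measurableEmbedding
  set F : EuclideanSpace ℝ (Fin d) → ℂ := f ∘ A with hF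
  have hFsupp : ∀ ζ, ζ ∉ box l → F ζ = 0 := by
    intro ζ hζ
    by_contra hne
    obtain ⟨ζ', hζ', h'⟩ := hsupp _ hne
    have : ζ' = ζ := A.injective h'
    exact hζ (this ▸ hζ')
  have hFint : Integrable F := by
    rw [hF, ← hAemb.integrable_map_iff, hAmap]
    exact hf.smul_measure hκt
  have hFnorm : ∀ r, eLpNorm F r volume = ENNReal.ofReal κ⁻¹ ^ (1 / r).toReal *
      eLpNorm f r volume := by
    intro r
    rw [hF, ← hAemb.eLpNorm_map_measure, hAmap, eLpNorm_smul_measure_of_ne_zero hκ', smul_eq_mul]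
  have hFmem : MemLp F p := by
    refine ⟨hFint.1, ?_⟩
    rw [hFnorm]
    exact ENNReal.mul_lt_top (ENNReal.rpow_lt_top_of_nonneg ENNReal.toReal_nonneg hκt) hfp.2
  have hext := h F hFint.integrableOn (hFmem.restrict _)
  -- Substituting ξ = a + Lζ turns tG(ξ) + x·ξ into a term free of ζ plus t g(ζ) + L'(x + tb)·ζ. The
  -- first term has modulus one after exponentiation, and the rest is the extension of F at the
  -- sheared point.
  have hpt : ∀ z, ‖oscInt G f z‖ₑ = ENNReal.ofReal κ * ‖extensionOp l g F (shear L' b z)‖ₑ := by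
    intro z
    set e : EuclideanSpace ℝ (Fin d) → ℂ := fun ξ =>
      Complex.exp (Complex.I * ((z.1 * G ξ + inner ℝ z.2 ξ : ℝ) : ℂ)) * f ξ with he
    have h1 : ∫ ζ, e (A ζ) = κ⁻¹ * oscInt G f z := by
      rw [← hAemb.integral_map, hAmap, integral_smul_measure, ENNReal.toReal_ofReal (by positivity)]
      rw [oscInt, Complex.real_smul]
    have h2 : ∀ ζ, e (A ζ) = Complex.exp (Complex.I * ((z.1 * c + inner ℝ z.2 a : ℝ) : ℂ)) *
        (box l).indicator (fun ζ => Complex.exp (Complex.I *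
          (((shear L' b z).1 * g ζ + inner ℝ (shear L' b z).2 ζ : ℝ) : ℂ)) * F ζ) ζ := by
      intro ζ
      by_cases hζ : ζ ∈ box l
      · rw [Set.indicator_of_mem hζ, ← mul_assoc, ← Complex.exp_add, ← mul_add,
          ← Complex.ofReal_add]
        simp only [he, hF, Function.comp_apply]
        congr 4
        simp only [shear_apply]
        rw [hAapp, hG ζ hζ, ← hadj, inner_add_right, inner_add_left, real_inner_smul_left]
        ring
      · rw [Set.indicator_of_notMem hζ, mul_zero]
        have : f (A ζ) = 0 := hFsupp ζ hζ
        simp [he, this]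
    have h3 : oscInt G f z = κ * (Complex.exp (Complex.I * ((z.1 * c + inner ℝ z.2 a : ℝ) : ℂ)) *
        extensionOp l g F (shear L' b z)) := by
      have hκc : (κ : ℂ) ≠ 0 := by exact_mod_cast hκ.ne'
      rw [extensionOp, ← integral_indicator (isOpen_box l).measurableSet, ← integral_const_mul]
      rw [← integral_congr_ae (.of_forall h2), h1]
      push_cast
      field_simp
    rw [h3, enorm_mul, enorm_mul, ← ofReal_norm, ← ofReal_norm (Complex.exp _),
      norm_exp_I_mul_ofReal, Complex.norm_real, Real.norm_eq_abs, abs_of_pos hκ]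
    simp
  have hsh : MeasurableEmbedding (shear L' b) := (shear L' b).measurableEmbedding
  -- Of the total power of κ, 1 comes from the Jacobian in frequency and -1/q from the shear in
  -- space; -1/p comes later from the norm of F.
  have hnorm : eLpNorm (oscInt G f) q volume = ENNReal.ofReal κ *
      (ENNReal.ofReal κ⁻¹ ^ (1 / q).toReal * eLpNorm (extensionOp l g F) q volume) := by
    have h1 : eLpNorm (oscInt G f) q volume =
        eLpNorm ((κ : ℂ) • (extensionOp l g F ∘ shear L' b)) q volume := by
      refine eLpNorm_congr_enorm_ae (.of_forall fun z => ?_)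
      rw [hpt z, Pi.smul_apply, enorm_smul, ← ofReal_norm (κ : ℂ), Complex.norm_real,
        Real.norm_eq_abs, abs_of_pos hκ]
      rfl
    rw [h1, eLpNorm_const_smul, ← hsh.eLpNorm_map_measure, map_shear_volume b hL',
      eLpNorm_smul_measure_of_ne_zero hκ', smul_eq_mul, ← ofReal_norm (κ : ℂ), Complex.norm_real,
      Real.norm_eq_abs, abs_of_pos hκ]
  have hrec : ∀ r : ℝ≥0∞, ENNReal.ofReal κ⁻¹ ^ (1 / r).toReal =
      ENNReal.ofReal (κ ^ (-recip r)) := by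
    intro r
    rw [ENNReal.ofReal_rpow_of_pos (by positivity), one_div, Real.inv_rpow hκ.le,
      ← Real.rpow_neg hκ.le]
    rfl
  have hle : eLpNorm F p (volume.restrict (box l)) ≤
      ENNReal.ofReal (κ ^ (-recip p)) * eLpNorm f p volume := by
    rw [← hrec, ← hFnorm]
    exact eLpNorm_mono_measure _ Measure.restrict_le_self
  rw [hnorm, hrec]
  calc ENNReal.ofReal κ * (ENNReal.ofReal (κ ^ (-recip q)) * eLpNorm (extensionOp l g F) q volume)
      ≤ ENNReal.ofReal κ * (ENNReal.ofReal (κ ^ (-recip q)) *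
        (B * (ENNReal.ofReal (κ ^ (-recip p)) * eLpNorm f p volume))) := by
        gcongr
        exact hext.trans (by gcongr)
    _ = (ENNReal.ofReal κ * ENNReal.ofReal (κ ^ (-recip q)) * ENNReal.ofReal (κ ^ (-recip p))) *
        B * eLpNorm f p volume := by ring
    _ = _ := by
        rw [← ENNReal.ofReal_mul hκ.le, ← ENNReal.ofReal_mul (by positivity)]
        congr 3
        nth_rewrite 1 [← Real.rpow_one κ]
        rw [← Real.rpow_add hκ, ← Real.rpow_add hκ]
        congr 1
        ring

/-! ### Local estimates for `ℰ_β` -/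

/-- The square root of half the second derivative of `|x|^β` at `a`. -/
noncomputable def curvRoot (β a : ℝ) : ℝ := √(β * (β - 1) / 2) * |a| ^ ((β - 2) / 2)

lemma curvRoot_pos {β a : ℝ} (hβ : 1 < β) (ha : β ≠ 2 → a ≠ 0) : 0 < curvRoot β a := by
  have h1 : 0 < √(β * (β - 1) / 2) := Real.sqrt_pos.2 (by nlinarith)
  by_cases h : β = 2
  · subst h
    simp [curvRoot]
  · exact mul_pos h1 (Real.rpow_pos_of_pos (abs_pos.2 (ha h)) _)

lemma curvRoot_two (a : ℝ) : curvRoot 2 a = 1 := by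
  norm_num [curvRoot]

/-- For β ≠ 2, factor out |a|^β and use b² = (β(β-1)/2)|a|^β, with y = z/b the relative increment.
For β = 2 the remainder is exactly y², so b may be any nonzero number and a may vanish; the linear
coefficient is then 0 by the convention for division by 0. -/
lemma abs_rpow_eq_add_taylorRem {β a b z : ℝ} (hβ : 1 < β) (ha : β ≠ 2 → a ≠ 0)
    (hb : β ≠ 2 → b = curvRoot β a * a) (hb0 : b ≠ 0) (hz : |z / b| < 1) :
    |a + (curvRoot β a)⁻¹ * z| ^ β = |a| ^ β +
      (β * |a| ^ β / a) * ((curvRoot β a)⁻¹ * z) + b ^ 2 * taylorRem β (z / b) := by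
  by_cases h : β = 2
  · subst h
    rw [curvRoot_two, taylorRem]
    norm_num
    by_cases ha0 : a = 0
    · subst ha0
      field_simp
      ring
    · field_simp
      ring
  · have ha0 := ha h
    have hbe := hb h
    have hl := curvRoot_pos hβ ha
    set μ := curvRoot β a with hμ
    set y := z / b with hy
    have hzy : μ⁻¹ * z = a * y := by
      rw [hy, hbe]
      field_simp
    have hy1 : 0 < 1 + y := by rw [abs_lt] at hz; linarith
    have hμ2 : b ^ 2 = β * (β - 1) / 2 * |a| ^ β := by
      have h1 : (|a| ^ ((β - 2) / 2)) ^ 2 = |a| ^ (β - 2) := by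
        rw [← Real.rpow_natCast, ← Real.rpow_mul (abs_nonneg _)]
        norm_num
      have h2 : |a| ^ β = |a| ^ (β - 2) * a ^ 2 := by
        rw [← sq_abs a, ← Real.rpow_natCast |a| 2, ← Real.rpow_add (abs_pos.2 ha0)]
        norm_num
      rw [hbe, mul_pow, hμ, curvRoot, mul_pow, Real.sq_sqrt (by nlinarith), h1, h2]
      ring
    rw [hzy, show a + a * y = a * (1 + y) by ring, abs_mul, abs_of_pos hy1,
      Real.mul_rpow (abs_nonneg _) hy1.le, hμ2, taylorRem]
    have : β - 1 ≠ 0 := by linarith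
    have : β ≠ 0 := by linarith
    field_simp
    ring

/-- The bounds of `exists_opNormLE_prod`, with explicit parameters. -/
def RectBound (d N : ℕ) (ε₀ : ℝ) (p q : ℝ≥0∞) (ε : ℝ) (C : ℝ≥0) : Prop :=
  ∀ u : Fin d → ℝ, (∀ i, 0 ≤ u i) → (∀ i, u i ≤ cap p q) →
    ∑ i, u i = 2 * recip q → ∀ l : Fin d → ℝ, (∀ i, 0 < l i) → Monotone l →
    ∀ R : ℝ, 1 ≤ R → (∀ i j, l i ≤ R * l j) → ∀ g : EuclideanSpace ℝ (Fin d) → ℝ,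
    IsElliptic N ε₀ (fun i => ENNReal.ofReal (l i)) g →
    OpNormLE (fun i => ENNReal.ofReal (l i)) g p q
      (C * ENNReal.ofReal ((∏ i, l i ^ (gap p q - u i)) * R ^ ε))

/-- Centring at a and dividing each coordinate by its curvature root turns the phase, up to an
affine function, into the model phase over a rectangle with sides curvature root times r_i. -/
theorem RectBound.local_bound {N : ℕ} {ε₀ ε η ρ : ℝ} {p q : ℝ≥0∞} {C : ℝ≥0}
    (h : RectBound d N ε₀ p q ε C) {β a r u : Fin d → ℝ} (hβ : ∀ i, 1 < β i)
    (ha : ∀ i, β i ≠ 2 → a i ≠ 0) (hr : ∀ i, 0 < r i) (hρ : 0 < ρ) (hρ' : ρ ≤ 1 / 2)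
    (hra : ∀ i, β i ≠ 2 → r i ≤ ρ * |a i|) (hη : d * η < ε₀)
    (hN : ∀ i, CurvSmall N η (β i) ρ) (hu0 : ∀ i, 0 ≤ u i) (hu1 : ∀ i, u i ≤ cap p q)
    (hu : ∑ i, u i = 2 * recip q) {R : ℝ} (hR : 1 ≤ R)
    (hRl : ∀ i j, curvRoot (β i) (a i) * r i ≤ R * (curvRoot (β j) (a j) * r j))
    {f : EuclideanSpace ℝ (Fin d) → ℂ} (hf : Integrable f) (hfp : MemLp f p)
    (hsupp : ∀ ξ, f ξ ≠ 0 → ∀ i, |ξ i - a i| < r i) :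
    eLpNorm (oscInt (gBeta β) f) q volume ≤
      C * ENNReal.ofReal ((∏ i, r i ^ gap p q * (curvRoot (β i) (a i) * r i) ^ (-u i)) * R ^ ε) *
        eLpNorm f p volume := by
  set μ : Fin d → ℝ := fun i => curvRoot (β i) (a i) with hμ
  have hμ0 : ∀ i, 0 < μ i := fun i => curvRoot_pos (hβ i) (ha i)
  set l : Fin d → ℝ := fun i => μ i * r i with hl
  have hl0 : ∀ i, 0 < l i := fun i => mul_pos (hμ0 i) (hr i)
  -- For β_i = 2 every b_i works, and this one satisfies the smallness condition l_i ≤ ρ|b_i| with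
  -- equality, whatever the side.
  set b : Fin d → ℝ := fun i => if β i = 2 then l i / ρ else μ i * a i with hb
  have hb0 : ∀ i, b i ≠ 0 := fun i => by
    by_cases h2 : β i = 2
    · simp only [hb, h2, if_true]; exact (div_pos (hl0 i) hρ).ne'
    · simp only [hb, h2, if_false]; exact mul_ne_zero (hμ0 i).ne' (ha i h2)
  have hlb : ∀ i, l i ≤ ρ * |b i| := fun i => by
    by_cases h2 : β i = 2
    · simp only [hb, h2, if_true]
      rw [abs_of_pos (div_pos (hl0 i) hρ), mul_div_cancel₀ _ hρ.ne']
    · simp only [hb, h2, if_false, abs_mul, abs_of_pos (hμ0 i), hl]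
      have := mul_le_mul_of_nonneg_left (hra i h2) (hμ0 i).le
      linarith
  -- The conjecture wants increasing sides, so the coordinates are permuted; the weights u travel
  -- with their sides.
  set π : Equiv.Perm (Fin d) := Tuple.sort l with hπ
  have hmono : Monotone (l ∘ π) := Tuple.monotone_sort l
  have hell : IsElliptic N ε₀ (fun i => ENNReal.ofReal ((l ∘ π) i)) (modelPhase (β ∘ π) (b ∘ π)) :=
    isElliptic_modelPhase (fun i => hβ _) (fun i => hb0 _) (fun i => hl0 _) (fun i => hlb _) hρ' hη
      fun i => hN _
  have hop := h (u ∘ π) (fun i => hu0 _) (fun i => hu1 _)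
    (by rw [← hu]; exact Equiv.sum_comp π u) (l ∘ π) (fun i => hl0 _) hmono R hR
    (fun i j => hRl _ _) _ hell
  have hprod : ∏ i, (l ∘ π) i ^ (gap p q - (u ∘ π) i) = ∏ i, l i ^ (gap p q - u i) :=
    Equiv.prod_comp π fun i => l i ^ (gap p q - u i)
  rw [hprod] at hop
  set P := (LinearIsometryEquiv.piLpCongrLeft 2 ℝ ℝ π :
    EuclideanSpace ℝ (Fin d) ≃ₗᵢ[ℝ] EuclideanSpace ℝ (Fin d)) with hP
  have hPapp : ∀ ζ i, P ζ i = ζ (π.symm i) := fun ζ i => rfl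
  have hμi : ∀ i, 0 < (μ i)⁻¹ := fun i => inv_pos.2 (hμ0 i)
  set D := diagL (fun i => (μ i)⁻¹) fun i => (hμi i).ne' with hD
  have hDapp : ∀ ζ i, D ζ i = (μ i)⁻¹ * ζ i := fun ζ i => rfl
  set L := P.toContinuousLinearEquiv.trans D with hL
  have hLapp : ∀ ζ i, L ζ i = (μ i)⁻¹ * ζ (π.symm i) := fun ζ i => rfl
  set L' := D.trans P.symm.toContinuousLinearEquiv with hL'
  have hκ : 0 < ∏ i, (μ i)⁻¹ := Finset.prod_pos fun i _ => hμi i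
  have hLs : ScalesVolume L (∏ i, (μ i)⁻¹) := by
    have := (scalesVolume_isometry P).trans zero_le_one (scalesVolume_diagL hμi)
    rwa [one_mul] at this
  have hLs' : ScalesVolume L' (∏ i, (μ i)⁻¹) := by
    have := (scalesVolume_diagL hμi).trans hκ.le (scalesVolume_isometry P.symm)
    rwa [mul_one] at this
  have hinner : ∀ x y : EuclideanSpace ℝ (Fin d), inner ℝ x y = ∑ i, x i * y i := fun x y => by
    simp [PiLp.inner_apply, mul_comm]
  have hadj : ∀ x ζ, inner ℝ x (L ζ) = inner ℝ (L' x) ζ := fun x ζ => by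
    have h1 : inner ℝ x (L ζ) = inner ℝ (D x) (P ζ) := by
      rw [hinner, hinner]
      exact Finset.sum_congr rfl fun i _ => by rw [hLapp, hDapp, hPapp]; ring
    rw [h1]
    have h2 : L' x = P.symm (D x) := rfl
    rw [h2, ← P.inner_map_map (P.symm (D x)) ζ, P.apply_symm_apply]
  have key := hop.affine (G := gBeta β) (a := WithLp.toLp 2 a)
    (b := WithLp.toLp 2 fun i => β i * |a i| ^ β i / a i) (c := ∑ i, |a i| ^ β i) L L' hadj hκ
    hLs hLs' (fun ζ hζ => by
      rw [hinner, gBeta, modelPhase]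
      rw [← Equiv.sum_comp π.symm fun j => (b ∘ π) j ^ 2 * taylorRem ((β ∘ π) j) (ζ j / (b ∘ π) j),
        ← Finset.sum_add_distrib, ← Finset.sum_add_distrib]
      refine Finset.sum_congr rfl fun i _ => ?_
      have hζi := mem_box_ofReal.1 hζ (π.symm i)
      simp only [Function.comp_apply, Equiv.apply_symm_apply, PiLp.add_apply, hLapp] at hζi ⊢
      refine abs_rpow_eq_add_taylorRem (hβ i) (ha i) (fun h2 => by simp [hb, h2, hμ]) (hb0 i) ?_
      rw [abs_div, div_lt_one (abs_pos.2 (hb0 i))]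
      have := hlb i
      have := abs_pos.2 (hb0 i)
      nlinarith) hf hfp (fun ξ hξ => by
      obtain ⟨ζ, hζ⟩ := L.surjective (ξ - WithLp.toLp 2 a)
      refine ⟨ζ, mem_box_ofReal.2 fun j => ?_, by rw [hζ]; simp⟩
      have h1 := hsupp ξ hξ (π j)
      have h2 : (L ζ) (π j) = ξ (π j) - a (π j) := by rw [hζ]; rfl
      rw [hLapp, Equiv.symm_apply_apply] at h2
      rw [← h2, abs_mul, abs_of_pos (hμi _), inv_mul_lt_iff₀ (hμ0 _)] at h1
      exact h1)
  -- With μ_i the curvature root and l_i = μ_i r_i, the Jacobian power μ_i^{-gap} combines with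
  -- l_i^{gap} to r_i^{gap}.
  refine key.trans (le_of_eq ?_)
  rw [← mul_assoc, mul_comm _ (C : ℝ≥0∞), mul_assoc (C : ℝ≥0∞),
    ← ENNReal.ofReal_mul (by positivity),
    ← mul_assoc]
  congr 4
  rw [← Real.finsetProd_rpow _ _ fun i _ => (hμi i).le, ← Finset.prod_mul_distrib]
  refine Finset.prod_congr rfl fun i _ => ?_
  rw [show (1 - recip p - recip q) = gap p q from rfl, Real.inv_rpow (hμ0 i).le, sub_eq_add_neg,
    Real.rpow_add (hl0 i), ← mul_assoc]
  congr 1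
  rw [hl, Real.mul_rpow (hμ0 i).le (hr i).le, ← mul_assoc, inv_mul_cancel₀, one_mul]
  exact (Real.rpow_pos_of_pos (hμ0 i) _).ne'

/-! ### Dyadic pieces of the cube -/

/-- The dyadic level of `x`; no decomposition is made if `β = 2`. -/
noncomputable def level (β x : ℝ) : ℕ := if β = 2 then 0 else ⌊-Real.logb 2 |x|⌋₊

/-- The points of the cube with levels `k` and position `σ / M` in the rescaled dyadic shell. -/
def piece (β : Fin d → ℝ) (M : ℕ) (k : Fin d → ℕ) (σ : Fin d → ℤ) :
    Set (EuclideanSpace ℝ (Fin d)) :=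
  {ξ | ∀ i, |ξ i| < 1 ∧ ξ i ≠ 0 ∧ level (β i) (ξ i) = k i ∧ ⌊2 ^ k i * ξ i * M⌋ = σ i}

lemma level_two (x : ℝ) : level 2 x = 0 := by simp [level]

lemma two_pow_level {β x : ℝ} (hβ : β ≠ 2) (h1 : |x| < 1) (h0 : x ≠ 0) :
    1 / 2 < 2 ^ level β x * |x| ∧ 2 ^ level β x * |x| ≤ 1 := by
  have hx : 0 < |x| := abs_pos.2 h0
  have ht : 0 ≤ -Real.logb 2 |x| := by
    have := Real.logb_nonpos (b := 2) (by norm_num) hx.le h1.le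
    linarith
  have hxe : |x| = 2 ^ (-(-Real.logb 2 |x|)) := by
    rw [neg_neg, Real.rpow_logb (by norm_num) (by norm_num) hx]
  have hl : level β x = ⌊-Real.logb 2 |x|⌋₊ := by simp [level, hβ]
  rw [hl]
  set t := -Real.logb 2 |x|
  have h2 : (2 : ℝ) ^ ⌊t⌋₊ * |x| = 2 ^ ((⌊t⌋₊ : ℝ) - t) := by
    rw [hxe, ← Real.rpow_natCast, ← Real.rpow_add (by norm_num), sub_eq_add_neg]
  rw [h2]
  have h3 := Nat.floor_le ht
  have h4 := Nat.lt_floor_add_one t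
  constructor
  · have : (1 / 2 : ℝ) = 2 ^ (-1 : ℝ) := by norm_num [Real.rpow_neg_one]
    rw [this]
    exact Real.rpow_lt_rpow_of_exponent_lt (by norm_num) (by linarith)
  · exact Real.rpow_le_one_of_one_le_of_nonpos (by norm_num) (by linarith)

lemma two_pow_level_le {β x : ℝ} (h1 : |x| < 1) (h0 : x ≠ 0) : 2 ^ level β x * |x| ≤ 1 := by
  by_cases hβ : β = 2
  · subst hβ
    simpa [level_two] using h1.le
  · exact (two_pow_level hβ h1 h0).2

/-- The centre of a piece. -/
noncomputable def pieceCenter (M : ℕ) (k : Fin d → ℕ) (σ : Fin d → ℤ) (i : Fin d) : ℝ :=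
  (1 / 2) ^ k i * (σ i / M)

lemma abs_sub_pieceCenter_le {β : Fin d → ℝ} {M : ℕ} (hM : 0 < M) {k : Fin d → ℕ} {σ : Fin d → ℤ}
    {ξ : EuclideanSpace ℝ (Fin d)} (hξ : ξ ∈ piece β M k σ) (i : Fin d) :
    |ξ i - pieceCenter M k σ i| ≤ (1 / 2) ^ k i / M := by
  obtain ⟨-, -, -, hσ⟩ := hξ i
  have hM' : (0 : ℝ) < M := by exact_mod_cast hM
  have h1 := Int.floor_le (2 ^ k i * ξ i * M)
  have h2 := Int.lt_floor_add_one (2 ^ k i * ξ i * M)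
  rw [hσ] at h1 h2
  have hpow : (0 : ℝ) < (1 / 2) ^ k i := by positivity
  have he : ξ i = (1 / 2) ^ k i / M * (2 ^ k i * ξ i * M) := by
    rw [one_div, inv_pow]
    field_simp
  have he' : ξ i - pieceCenter M k σ i = (1 / 2) ^ k i / M * (2 ^ k i * ξ i * M - σ i) := by
    rw [mul_sub, ← he, pieceCenter]
    ring
  rw [he', abs_mul, abs_of_pos (by positivity)]
  refine mul_le_of_le_one_right (by positivity) ?_
  rw [abs_le]
  constructor <;> linarith

/-- At each level only finitely many positions occur, independently of the level, so constants may
depend on σ. -/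
lemma mem_Icc_of_mem_piece {β : Fin d → ℝ} {M : ℕ} {k : Fin d → ℕ} {σ : Fin d → ℤ}
    {ξ : EuclideanSpace ℝ (Fin d)} (hξ : ξ ∈ piece β M k σ) (i : Fin d) :
    σ i ∈ Finset.Icc (-(M : ℤ)) M := by
  obtain ⟨h1, h0, hk, hσ⟩ := hξ i
  have h := two_pow_level_le (β := β i) h1 h0
  rw [hk] at h
  have h' : |2 ^ k i * ξ i * M| ≤ M := by
    rw [abs_mul, abs_mul, abs_of_pos (by positivity : (0 : ℝ) < 2 ^ k i), Nat.abs_cast]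
    exact mul_le_of_le_one_left (Nat.cast_nonneg _) h
  rw [abs_le] at h'
  rw [Finset.mem_Icc, ← hσ]
  constructor
  · rw [Int.le_floor]
    push_cast
    exact h'.1
  · have h3 : (⌊2 ^ k i * ξ i * M⌋ : ℝ) ≤ M := (Int.floor_le _).trans h'.2
    exact_mod_cast h3

/-- The rescaled point has modulus above 1/2, and σ_i/M is within 1/M ≤ 1/4 of it. The centre thus
stays away from the singular hyperplane, at a distance comparable to 2^{-k_i}. -/
lemma quarter_le_of_mem_piece {β : Fin d → ℝ} {M : ℕ} (hM : 4 ≤ M) {k : Fin d → ℕ} {σ : Fin d → ℤ}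
    {ξ : EuclideanSpace ℝ (Fin d)} (hξ : ξ ∈ piece β M k σ) (i : Fin d) (hβ : β i ≠ 2) :
    1 / 4 ≤ |(σ i : ℝ) / M| := by
  obtain ⟨h1, h0, hk, hσ⟩ := hξ i
  have h := (two_pow_level hβ h1 h0).1
  rw [hk] at h
  have hM' : (4 : ℝ) ≤ M := by exact_mod_cast hM
  have hd := abs_sub_pieceCenter_le (by omega) hξ i
  have hpow : (0 : ℝ) < (1 / 2) ^ k i := by positivity
  have h3 : (1 / 2 : ℝ) * (1 / 2) ^ k i ≤ |ξ i| := by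
    have : (2 : ℝ) ^ k i * (1 / 2) ^ k i = 1 := by rw [← mul_pow]; norm_num
    nlinarith
  have h4 : (1 / 2 : ℝ) ^ k i / M ≤ (1 / 4) * (1 / 2) ^ k i := by
    rw [div_le_iff₀ (by linarith)]
    nlinarith
  have h5 : |pieceCenter M k σ i| = (1 / 2) ^ k i * |(σ i : ℝ) / M| := by
    rw [pieceCenter, abs_mul, abs_of_pos hpow]
  have h6 : |ξ i| - |pieceCenter M k σ i| ≤ |ξ i - pieceCenter M k σ i| :=
      abs_sub_abs_le_abs_sub _ _
  rw [h5] at h6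
  nlinarith

lemma half_pow_eq (k : ℕ) : ((1 : ℝ) / 2) ^ k = 2 ^ (-(k : ℝ)) := by
  rw [Real.rpow_neg (by norm_num), Real.rpow_natCast, one_div, inv_pow]

/-- Homogeneity: the curvature root scales like 2^{-k(β-2)/2} and the side like 2^{-k}. Hence βk/2
is the natural scale of a level after normalisation. -/
lemma curvRoot_pieceCenter (β : Fin d → ℝ) (M : ℕ) (k : Fin d → ℕ) (σ : Fin d → ℤ) (i : Fin d) :
    curvRoot (β i) (pieceCenter M k σ i) * ((1 / 2) ^ k i / M) =
      curvRoot (β i) (σ i / M) / M * 2 ^ (-(β i * k i / 2)) := by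
  rw [curvRoot, curvRoot, pieceCenter, abs_mul, half_pow_eq,
    abs_of_pos (Real.rpow_pos_of_pos (by norm_num : (0 : ℝ) < 2) _),
    Real.mul_rpow (Real.rpow_nonneg (by norm_num) _) (abs_nonneg _), ← Real.rpow_mul (by norm_num),
    show -(β i * k i / 2) = -(k i : ℝ) * ((β i - 2) / 2) + -(k i : ℝ) by ring,
    Real.rpow_add (by norm_num)]
  ring

/-- Bounds for the pieces of `ℰ_β`, from the restriction conjecture above rectangles. -/
theorem exists_piece_bound [NeZero d] {p q : ℝ≥0∞} (hT : (p, q) ∈ T d) (hq : q ≠ ∞)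
    (hc : RectConjecture d p q) {β : Fin d → ℝ} (hβ : ∀ i, 1 < β i) :
    ∃ M₀ : ℕ, ∀ M : ℕ, M₀ ≤ M → ∀ ε : ℝ, 0 ≤ ε → (q ≤ p → 0 < ε) →
      ∀ u : Fin d → ℝ, (∀ i, 0 ≤ u i) → (∀ i, u i ≤ cap p q) → ∑ i, u i = 2 * recip q →
      ∃ C : ℝ≥0, ∀ (k : Fin d → ℕ) (σ : Fin d → ℤ) (D : ℝ),
        (∀ i j, β i * k i / 2 - β j * k j / 2 ≤ D) →
        ∀ f : EuclideanSpace ℝ (Fin d) → ℂ, Integrable f → MemLp f p →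
        (∀ ξ, f ξ ≠ 0 → ξ ∈ piece β M k σ) →
        eLpNorm (oscInt (gBeta β) f) q volume ≤
          C * ENNReal.ofReal (2 ^ (-∑ i, k i * (gap p q - u i * β i / 2) + ε * D)) *
            eLpNorm f p volume := by
  obtain ⟨N, ε₀, hε₀, -, hb⟩ := exists_opNormLE_prod hT hq hc
  have hd : (0 : ℝ) < d := by exact_mod_cast NeZero.pos d
  set η := ε₀ / (2 * d) with hη
  have hη0 : 0 < η := by positivity
  have hηd : d * η < ε₀ := by
    rw [hη]
    field_simp
    linarith
  choose ρ hρ0 hρ using fun i => exists_curvSmall N hη0 (β i)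
  obtain ⟨ρ₁, hρ₁0, hρ₁⟩ : ∃ ρ₁ > 0, ∀ i, ρ₁ ≤ ρ i := by
    obtain ⟨i, -, hi⟩ := Finset.exists_min_image Finset.univ ρ ⟨0, Finset.mem_univ _⟩
    exact ⟨ρ i, hρ0 i, fun j => hi j (Finset.mem_univ _)⟩
  set ρ₂ := min (1 / 2) ρ₁ with hρ₂
  have hρ₂0 : 0 < ρ₂ := by positivity
  -- M ≥ 8/ρ₂ gives 2/M ≤ ρ₂/4, and 1/4 is the lower bound for |σ_i|/M; the half-side is then at
  -- most ρ₂ times the distance of the centre from 0.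
  refine ⟨⌈8 / ρ₂⌉₊, fun M hM ε hε hε' u hu0 hu1 hu => ?_⟩
  have hM8 : 8 / ρ₂ ≤ M := (Nat.le_ceil _).trans (by exact_mod_cast hM)
  have hM16 : (16 : ℝ) ≤ M := by
    refine le_trans ?_ hM8
    rw [le_div_iff₀ hρ₂0]
    have : ρ₂ ≤ 1 / 2 := min_le_left _ _
    linarith
  rw [div_le_iff₀ hρ₂0] at hM8
  have hM0 : (0 : ℝ) < M := by linarith
  have hM4 : 4 ≤ M := by
    have : (4 : ℝ) ≤ M := by linarith
    exact_mod_cast this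
  obtain ⟨C, hC⟩ := hb ε hε hε'
  set B : (Fin d → ℤ) → Fin d → ℝ := fun σ i => curvRoot (β i) (σ i / M) with hB
  -- K bounds all ratios of the level-free side factors B, so that the eccentricity of the rectangle
  -- is at most K · 2^D.
  set K : (Fin d → ℤ) → ℝ := fun σ => 1 + ∑ i, ∑ j, |B σ i / B σ j| with hK
  set Cσ : (Fin d → ℤ) → ℝ≥0 := fun σ => C *
    Real.toNNReal ((∏ i, ((2 / M : ℝ) ^ gap p q * (B σ i * (2 / M)) ^ (-u i))) * K σ ^ ε) with hCσ
  refine ⟨∑ σ ∈ Fintype.piFinset fun _ : Fin d => Finset.Icc (-(M : ℤ)) M, Cσ σ,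
    fun k σ D hD f hf hfp hsupp => ?_⟩
  -- A point of the support is needed to know that σ lies in the finite range and that the centre is
  -- away from 0.
  by_cases hne : ∃ ξ, f ξ ≠ 0
  swap
  · push Not at hne
    have : oscInt (gBeta β) f = 0 := by
      ext z
      simp [oscInt, hne]
    rw [this]
    simp
  obtain ⟨ξ₀, hξ₀⟩ := hne
  have hmem := hsupp ξ₀ hξ₀
  have hσ : σ ∈ Fintype.piFinset fun _ : Fin d => Finset.Icc (-(M : ℤ)) M :=
    Fintype.mem_piFinset.2 fun i => mem_Icc_of_mem_piece hmem i
  have hCle : Cσ σ ≤ ∑ σ ∈ Fintype.piFinset fun _ : Fin d => Finset.Icc (-(M : ℤ)) M, Cσ σ :=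
    Finset.single_le_sum (f := Cσ) (fun _ _ => zero_le) hσ
  have hα : ∀ i, β i ≠ 2 → 1 / 4 ≤ |(σ i : ℝ) / M| :=
    fun i hi => quarter_le_of_mem_piece hM4 hmem i hi
  have hB0 : ∀ i, 0 < B σ i := fun i => curvRoot_pos (hβ i) fun hi h0 => by
    have := hα i hi
    rw [h0, abs_zero] at this
    norm_num at this
  -- Twice the distance bound 2^{-k_i}/M, since the rectangles are open and the inequality has to be
  -- strict.
  set r : Fin d → ℝ := fun i => (1 / 2) ^ k i * (2 / M) with hr
  have hr0 : ∀ i, 0 < r i := fun i => by positivity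
  have hlr : ∀ i, curvRoot (β i) (pieceCenter M k σ i) * r i =
      B σ i * (2 / M) * 2 ^ (-(β i * k i / 2)) := fun i => by
    have := curvRoot_pieceCenter β M k σ i
    rw [hr]
    linear_combination 2 * this
  have hD0 : 0 ≤ D := by simpa using hD 0 0
  have hK1 : 1 ≤ K σ := by
    have : 0 ≤ ∑ i, ∑ j, |B σ i / B σ j| :=
      Finset.sum_nonneg fun _ _ => Finset.sum_nonneg fun _ _ => abs_nonneg _
    simp only [hK]
    linarith
  have hBK : ∀ i j, B σ i ≤ K σ * B σ j := fun i j => by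
    rw [← div_le_iff₀ (hB0 j)]
    have h1 : |B σ i / B σ j| ≤ ∑ j, |B σ i / B σ j| :=
      Finset.single_le_sum (f := fun j => |B σ i / B σ j|) (fun _ _ => abs_nonneg _)
        (Finset.mem_univ j)
    have h2 : ∑ j, |B σ i / B σ j| ≤ ∑ i, ∑ j, |B σ i / B σ j| :=
      Finset.single_le_sum (f := fun i => ∑ j, |B σ i / B σ j|)
        (fun _ _ => Finset.sum_nonneg fun _ _ => abs_nonneg _) (Finset.mem_univ i)
    have := le_abs_self (B σ i / B σ j)
    simp only [hK]
    linarith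
  have h2D : (1 : ℝ) ≤ 2 ^ D := Real.one_le_rpow (by norm_num) hD0
  have key := RectBound.local_bound hC hβ (a := pieceCenter M k σ) (r := r) (u := u) (η := η)
    (ρ := ρ₂) (R := K σ * 2 ^ D)
    (fun i hi => mul_ne_zero (by positivity) (by
      intro h0
      have := hα i hi
      rw [h0, abs_zero] at this
      norm_num at this))
    hr0 hρ₂0 (min_le_left _ _)
    (fun i hi => by
      have h1 := hα i hi
      rw [pieceCenter, abs_mul, abs_of_pos (by positivity : (0 : ℝ) < (1 / 2) ^ k i)]
      have h2 : (2 / M : ℝ) ≤ ρ₂ * |(σ i : ℝ) / M| := by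
        rw [div_le_iff₀ hM0]
        have : ρ₂ * (1 / 4) * M ≤ ρ₂ * |(σ i : ℝ) / M| * M := by gcongr
        linarith
      have := mul_le_mul_of_nonneg_left h2 (by positivity : (0 : ℝ) ≤ (1 / 2) ^ k i)
      simp only [hr]
      linarith)
    hηd (fun i => hρ i ρ₂ hρ₂0 ((min_le_right _ _).trans (hρ₁ i))) hu0 hu1 hu
    (by nlinarith)
    (fun i j => by
      rw [hlr, hlr]
      have h1 : (2 : ℝ) ^ (-(β i * k i / 2)) ≤ 2 ^ D * 2 ^ (-(β j * k j / 2)) := by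
        rw [← Real.rpow_add (by norm_num)]
        refine Real.rpow_le_rpow_of_exponent_le (by norm_num) ?_
        have := hD j i
        linarith
      calc B σ i * (2 / M) * 2 ^ (-(β i * k i / 2))
          ≤ (K σ * B σ j) * (2 / M) * (2 ^ D * 2 ^ (-(β j * k j / 2))) := by
            have := hBK i j
            have := (hB0 j).le
            have := (hB0 i).le
            gcongr
        _ = _ := by ring)
    hf hfp (fun ξ hξ i => by
      refine (abs_sub_pieceCenter_le (by omega) (hsupp ξ hξ) i).trans_lt ?_
      have : (0 : ℝ) < (1 / 2) ^ k i / M := by positivity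
      simp only [hr]
      rw [← mul_div_assoc, mul_comm, mul_div_assoc]
      linarith)
  refine key.trans ?_
  gcongr ?_ * _
  have hreal : (∏ i, r i ^ gap p q * (curvRoot (β i) (pieceCenter M k σ i) * r i) ^ (-u i)) *
      (K σ * 2 ^ D) ^ ε = ((∏ i, ((2 / M : ℝ) ^ gap p q * (B σ i * (2 / M)) ^ (-u i))) * K σ ^ ε) *
        2 ^ (-∑ i, k i * (gap p q - u i * β i / 2) + ε * D) := by
    have h1 : ∀ i, r i ^ gap p q * (curvRoot (β i) (pieceCenter M k σ i) * r i) ^ (-u i) =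
        ((2 / M : ℝ) ^ gap p q * (B σ i * (2 / M)) ^ (-u i)) *
          2 ^ (-(k i * (gap p q - u i * β i / 2))) := fun i => by
      have hBi := (hB0 i).le
      rw [hlr]
      simp only [hr]
      rw [half_pow_eq, Real.mul_rpow (by positivity) (by positivity),
        Real.mul_rpow (by positivity) (by positivity), ← Real.rpow_mul (by norm_num),
        ← Real.rpow_mul (by norm_num)]
      rw [show -(k i * (gap p q - u i * β i / 2)) =
        -(k i : ℝ) * gap p q + -(β i * k i / 2) * -u i by ring, Real.rpow_add (by norm_num)]
      ring
    simp_rw [h1]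
    rw [Finset.prod_mul_distrib, Real.mul_rpow (by linarith) (by positivity),
      ← Real.rpow_mul (by norm_num), Real.rpow_add (by norm_num), ← Finset.sum_neg_distrib,
      Real.rpow_sum_of_pos (by norm_num), mul_comm D ε]
    ring
  rw [hreal, ENNReal.ofReal_mul]
  · rw [← mul_assoc]
    gcongr
    refine le_trans (le_of_eq ?_) (ENNReal.coe_le_coe.2 hCle)
    rw [hCσ]
    push_cast
    rfl
  · refine mul_nonneg (Finset.prod_nonneg fun i _ => ?_) (by positivity)
    have := (hB0 i).le
    positivity

/-! ### Almost orthogonality -/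

section Schur

variable {Ω ι : Type*} [MeasurableSpace Ω] {μ : Measure Ω}

lemma rpow_sum_le_sum_rpow (s : Finset ι) (f : ι → ℝ≥0∞) {r : ℝ} (hr0 : 0 < r) (hr1 : r ≤ 1) :
    (∑ i ∈ s, f i) ^ r ≤ ∑ i ∈ s, f i ^ r := by
  classical
  induction s using Finset.induction with
  | empty => simp [hr0]
  | insert i s hi ih =>
    rw [Finset.sum_insert hi, Finset.sum_insert hi]
    exact (ENNReal.rpow_add_le_add_rpow _ _ hr0.le hr1).trans (by gcongr)

/-- Each index fills 2M slots of the M² ordered pairs, and 2M · (q/2) · M^{-2} = q/M. -/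
lemma prod_pair_rpow (M : ℕ) (hM : 0 < M) (x : Fin M → ℝ≥0∞) {q : ℝ} (hq : 0 < q) :
    ∏ ij : Fin M × Fin M, ((x ij.1 * x ij.2) ^ (q / 2)) ^ ((M : ℝ) ^ 2)⁻¹ = ∏ i, x i ^ (q / M) := by
  have hM' : (0 : ℝ) < M := by exact_mod_cast hM
  have h1 : ∀ ij : Fin M × Fin M, ((x ij.1 * x ij.2) ^ (q / 2)) ^ ((M : ℝ) ^ 2)⁻¹ =
      x ij.1 ^ (q / 2 * ((M : ℝ) ^ 2)⁻¹) * x ij.2 ^ (q / 2 * ((M : ℝ) ^ 2)⁻¹) := fun ij => by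
    rw [← ENNReal.rpow_mul, ENNReal.mul_rpow_of_nonneg _ _ (by positivity)]
  have h2 : ∀ y : ℝ≥0∞, (y ^ (q / 2 * ((M : ℝ) ^ 2)⁻¹)) ^ M = y ^ (q / (2 * M)) := fun y => by
    rw [← ENNReal.rpow_natCast, ← ENNReal.rpow_mul]
    congr 1
    field_simp
  simp_rw [h1]
  rw [Finset.prod_mul_distrib, Fintype.prod_prod_type, Fintype.prod_prod_type_right]
  simp only [Finset.prod_const, Finset.card_univ, Fintype.card_fin, h2]
  rw [← Finset.prod_mul_distrib]
  refine Finset.prod_congr rfl fun i _ => ?_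
  rw [← ENNReal.rpow_add_of_nonneg _ _ (by positivity) (by positivity)]
  congr 1
  field_simp
  ring

lemma prod_rpow_le_sum (M : ℕ) (hM : 0 < M) (x : Fin M → ℝ≥0∞) {q : ℝ} :
    ∏ i, x i ^ (q / M) ≤ ∑ i, x i ^ q := by
  have hM' : (0 : ℝ) < M := by exact_mod_cast hM
  calc ∏ i, x i ^ (q / M) ≤ ∏ _i : Fin M, (∑ j, x j ^ q) ^ (M : ℝ)⁻¹ := by
        refine Finset.prod_le_prod' fun i _ => ?_
        rw [div_eq_mul_inv, ENNReal.rpow_mul]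
        gcongr
        exact Finset.single_le_sum (f := fun j => x j ^ q) (fun _ _ => zero_le) (Finset.mem_univ i)
    _ = ∑ i, x i ^ q := by
        rw [Finset.prod_const, Finset.card_univ, Fintype.card_fin, ← ENNReal.rpow_natCast,
          ← ENNReal.rpow_mul, inv_mul_cancel₀ hM'.ne', ENNReal.rpow_one]

/-- Since q ≤ M, the q-th power of the sum is at most the M-th power of ∑ G_i^{q/M}. Expand it. Each
M-fold product is a geometric mean over all M² pairs of its factors, and Hölder reduces its integral
to the pair integrals. -/
lemma lintegral_finset_sum_rpow_le (s : Finset ι) {G : ι → Ω → ℝ≥0∞}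
    (hG : ∀ i, AEMeasurable (G i) μ) {q : ℝ} (hq : 0 < q) {c : ι → ℝ≥0∞} {w : ι → ι → ℝ≥0∞}
    (hw1 : ∀ i j, w i j ≤ 1)
    (hpair : ∀ i j, ∫⁻ x, (G i x * G j x) ^ (q / 2) ∂μ ≤ w i j * (c i * c j) ^ (q / 2))
    {M : ℕ} (hM : 0 < M) (hqM : q ≤ M) {A : ℝ≥0∞}
    (hA : ∀ i, ∑ j ∈ s, w i j ^ ((M : ℝ) ^ 2)⁻¹ ≤ A) :
    ∫⁻ x, (∑ i ∈ s, G i x) ^ q ∂μ ≤ M * A ^ M * ∑ i ∈ s, c i ^ q := by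
  classical
  have hM' : (0 : ℝ) < M := by exact_mod_cast hM
  set η : ℝ := ((M : ℝ) ^ 2)⁻¹ with hη
  have hη0 : 0 ≤ η := by positivity
  set S := Fintype.piFinset fun _ : Fin M => s with hS
  have hpt : ∀ x, (∑ i ∈ s, G i x) ^ q ≤
      ∑ p ∈ S, ∏ ij : Fin M × Fin M, ((G (p ij.1) x * G (p ij.2) x) ^ (q / 2)) ^ η := by
    intro x
    have h1 : (∑ i ∈ s, G i x) ^ q = ((∑ i ∈ s, G i x) ^ (q / M)) ^ M := by
      rw [← ENNReal.rpow_natCast, ← ENNReal.rpow_mul]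
      congr 1
      field_simp
    rw [h1]
    calc ((∑ i ∈ s, G i x) ^ (q / M)) ^ M ≤ (∑ i ∈ s, G i x ^ (q / M)) ^ M := by
          gcongr
          exact rpow_sum_le_sum_rpow _ _ (by positivity) ((div_le_one hM').2 hqM)
      _ = ∏ _i : Fin M, ∑ k ∈ s, G k x ^ (q / M) := by simp
      _ = ∑ p ∈ S, ∏ i, G (p i) x ^ (q / M) := Finset.prod_univ_sum _ _
      _ = _ := Finset.sum_congr rfl fun p _ =>
          (prod_pair_rpow M hM (fun i => G (p i) x) hq).symm
  have hterm : ∀ p : Fin M → ι,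
      ∫⁻ x, ∏ ij : Fin M × Fin M, ((G (p ij.1) x * G (p ij.2) x) ^ (q / 2)) ^ η ∂μ ≤
        ∑ i, c (p i) ^ q * ∏ j, w (p i) (p j) ^ η := by
    intro p
    refine (ENNReal.lintegral_prod_norm_pow_le Finset.univ
      (f := fun (ij : Fin M × Fin M) x => (G (p ij.1) x * G (p ij.2) x) ^ (q / 2))
      (fun ij _ => ((hG _).mul (hG _)).pow_const _) (p := fun _ => η)
      (by simp [hη]; field_simp) fun _ _ => hη0).trans ?_
    calc ∏ ij : Fin M × Fin M, (∫⁻ x, (G (p ij.1) x * G (p ij.2) x) ^ (q / 2) ∂μ) ^ η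
        ≤ ∏ ij : Fin M × Fin M, (w (p ij.1) (p ij.2) * (c (p ij.1) * c (p ij.2)) ^ (q / 2)) ^ η :=
          Finset.prod_le_prod' fun ij _ => by
            gcongr
            exact hpair _ _
      _ = (∏ ij : Fin M × Fin M, w (p ij.1) (p ij.2) ^ η) * ∏ i, c (p i) ^ (q / M) := by
          rw [← prod_pair_rpow M hM (fun i => c (p i)) hq, ← Finset.prod_mul_distrib]
          exact Finset.prod_congr rfl fun ij _ => ENNReal.mul_rpow_of_nonneg _ _ hη0
      _ ≤ (∏ ij : Fin M × Fin M, w (p ij.1) (p ij.2) ^ η) * ∑ i, c (p i) ^ q := by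
          gcongr
          exact prod_rpow_le_sum M hM _
      _ = ∑ i, c (p i) ^ q * ∏ ij : Fin M × Fin M, w (p ij.1) (p ij.2) ^ η := by
          rw [mul_comm, Finset.sum_mul]
      _ ≤ _ := by
          refine Finset.sum_le_sum fun i _ => ?_
          gcongr
          -- Only the factors w in the row of the chosen index i are kept; all the others are at
          -- most 1.
          rw [Fintype.prod_prod_type]
          refine (Finset.prod_le_prod_of_subset_of_le_one' (Finset.subset_univ {i})
            fun k _ _ => Finset.prod_le_one' fun j _ => ?_).trans_eq (Finset.prod_singleton _ _)
          exact ENNReal.rpow_le_one (hw1 _ _) hη0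
  have hmeas : ∀ p ∈ S, AEMeasurable (fun x => ∏ ij : Fin M × Fin M,
      ((G (p ij.1) x * G (p ij.2) x) ^ (q / 2)) ^ η) μ := fun p _ =>
    Finset.aemeasurable_fun_prod _ fun ij _ => (((hG _).mul (hG _)).pow_const _).pow_const _
  calc ∫⁻ x, (∑ i ∈ s, G i x) ^ q ∂μ
      ≤ ∫⁻ x, ∑ p ∈ S, ∏ ij : Fin M × Fin M,
          ((G (p ij.1) x * G (p ij.2) x) ^ (q / 2)) ^ η ∂μ := lintegral_mono hpt
    _ = ∑ p ∈ S, ∫⁻ x, ∏ ij : Fin M × Fin M,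
          ((G (p ij.1) x * G (p ij.2) x) ^ (q / 2)) ^ η ∂μ := lintegral_finsetSum' _ hmeas
    _ ≤ ∑ p ∈ S, ∑ i, c (p i) ^ q * ∏ j, w (p i) (p j) ^ η :=
        Finset.sum_le_sum fun p _ => hterm p
    -- The chosen entry p_i is replaced by a free index k ∈ s, summed independently of p. The sum
    -- over p then factors into M equal row sums.
    _ ≤ ∑ p ∈ S, ∑ _i : Fin M, ∑ k ∈ s, c k ^ q * ∏ j, w k (p j) ^ η := by
        refine Finset.sum_le_sum fun p hp => Finset.sum_le_sum fun i _ => ?_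
        exact Finset.single_le_sum (f := fun k => c k ^ q * ∏ j, w k (p j) ^ η)
          (fun _ _ => zero_le) (Fintype.mem_piFinset.1 hp i)
    _ = M * ∑ k ∈ s, c k ^ q * (∑ j ∈ s, w k j ^ η) ^ M := by
        simp only [Finset.sum_const, Finset.card_univ, Fintype.card_fin, nsmul_eq_mul]
        rw [← Finset.mul_sum, Finset.sum_comm]
        congr 1
        refine Finset.sum_congr rfl fun k _ => ?_
        rw [← Finset.mul_sum]
        congr 1
        have := Finset.prod_univ_sum (fun _ : Fin M => s) fun _ j => w k j ^ η
        rw [← this]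
        simp
    _ ≤ M * ∑ k ∈ s, c k ^ q * A ^ M := by
        gcongr with k _
        exact hA k
    _ = M * A ^ M * ∑ i ∈ s, c i ^ q := by
        rw [← Finset.sum_mul]
        ring

/-- If the products of pairs of functions are small off the diagonal, in the sense of Schur's test,
then the `q`-th power of the norm of the sum is controlled by the sum of the `q`-th powers. -/
theorem lintegral_tsum_rpow_le [Countable ι] {G : ι → Ω → ℝ≥0∞}
    (hG : ∀ i, AEMeasurable (G i) μ) {q : ℝ} (hq : 0 < q) {c : ι → ℝ≥0∞} {w : ι → ι → ℝ≥0∞}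
    (hw1 : ∀ i j, w i j ≤ 1)
    (hpair : ∀ i j, ∫⁻ x, (G i x * G j x) ^ (q / 2) ∂μ ≤ w i j * (c i * c j) ^ (q / 2))
    {M : ℕ} (hM : 0 < M) (hqM : q ≤ M) {A : ℝ≥0∞}
    (hA : ∀ i, ∑' j, w i j ^ ((M : ℝ) ^ 2)⁻¹ ≤ A) :
    ∫⁻ x, (∑' i, G i x) ^ q ∂μ ≤ M * A ^ M * ∑' i, c i ^ q := by
  have h1 : ∀ x, (∑' i, G i x) ^ q = ⨆ s : Finset ι, (∑ i ∈ s, G i x) ^ q := by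
    intro x
    rw [ENNReal.tsum_eq_iSup_sum]
    exact (ENNReal.orderIsoRpow q hq).map_iSup _
  simp_rw [h1]
  rw [lintegral_iSup_directed
    (fun s => (Finset.aemeasurable_fun_sum _ fun i _ => hG i).pow_const _)]
  · refine iSup_le fun s => (lintegral_finset_sum_rpow_le s hG hq hw1 hpair hM hqM
      fun i => (ENNReal.sum_le_tsum s).trans (hA i)).trans ?_
    gcongr
    exact ENNReal.sum_le_tsum s
  · refine Monotone.directed_le fun s t hst x => ?_
    simp only
    gcongr

end Schur

/-! ### Decomposition of `ℰ_β` into pieces -/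

lemma continuous_gBeta {β : Fin d → ℝ} (hβ : ∀ i, 1 < β i) : Continuous (gBeta β) := by
  unfold gBeta
  refine continuous_finsetSum _ fun i _ => Continuous.rpow_const (by fun_prop) fun ξ => Or.inr ?_
  linarith [hβ i]

lemma continuous_oscInt {G : EuclideanSpace ℝ (Fin d) → ℝ} (hG : Continuous G)
    {f : EuclideanSpace ℝ (Fin d) → ℂ} (hf : Integrable f) : Continuous (oscInt G f) := by
  refine continuous_of_dominated (bound := fun ξ => ‖f ξ‖) ?_ ?_ hf.norm ?_
  · intro z
    exact (Continuous.aestronglyMeasurable (by fun_prop)).mul hf.1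
  · intro z
    refine .of_forall fun ξ => ?_
    rw [norm_mul, norm_exp_I_mul_ofReal, one_mul]
  · refine .of_forall fun ξ => ?_
    fun_prop

/-- The cube `(-1,1)^d`. -/
def cube (d : ℕ) : Set (EuclideanSpace ℝ (Fin d)) := box fun _ => 1

lemma measurableSet_cube : MeasurableSet (cube d) := (isOpen_box _).measurableSet

lemma volume_cube_lt_top : volume (cube d) < ∞ := by
  refine Bornology.IsBounded.measure_lt_top ?_
  refine (Metric.isBounded_closedBall (x := (0 : EuclideanSpace ℝ (Fin d)))
    (r := √d)).subset fun ξ hξ => ?_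
  rw [mem_closedBall_zero_iff, EuclideanSpace.norm_eq]
  refine Real.sqrt_le_sqrt ?_
  have h := mem_box_one.1 hξ
  calc ∑ i, ‖ξ i‖ ^ 2 ≤ ∑ _i : Fin d, (1 : ℝ) :=
        Finset.sum_le_sum fun i _ => pow_le_one₀ (norm_nonneg _) (h i).le
    _ = d := by simp

instance : IsFiniteMeasure (volume.restrict (cube d)) :=
  ⟨by simpa using volume_cube_lt_top⟩

lemma extBeta_eq_oscInt (β : Fin d → ℝ) (f : EuclideanSpace ℝ (Fin d) → ℂ) :
    extBeta β f = oscInt (gBeta β) ((cube d).indicator f) := by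
  ext z
  rw [extBeta, extensionOp, oscInt, ← integral_indicator (isOpen_box _).measurableSet]
  change ∫ ξ, (cube d).indicator _ ξ = _
  congr 1
  ext ξ
  by_cases h : ξ ∈ cube d
  · rw [Set.indicator_of_mem h, Set.indicator_of_mem h]
  · rw [Set.indicator_of_notMem h, Set.indicator_of_notMem h, mul_zero]

lemma continuous_extBeta {β : Fin d → ℝ} (hβ : ∀ i, 1 < β i) {f : EuclideanSpace ℝ (Fin d) → ℂ}
    (hf : IntegrableOn f (cube d)) : Continuous (extBeta β f) := by
  rw [extBeta_eq_oscInt]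
  exact continuous_oscInt (continuous_gBeta hβ) (hf.integrable_indicator measurableSet_cube)

lemma measurable_level (b : ℝ) : Measurable (level b) := by
  unfold level
  by_cases h : b = 2
  · simp [h]
  · simp only [h, if_false]
    refine Nat.measurable_floor.comp ?_
    unfold Real.logb
    fun_prop

lemma measurableSet_piece (β : Fin d → ℝ) (M : ℕ) (k : Fin d → ℕ) (σ : Fin d → ℤ) :
    MeasurableSet (piece β M k σ) := by
  have : piece β M k σ = ⋂ i, ({ξ | |ξ i| < 1} ∩ ({ξ | ξ i ≠ 0} ∩
      ((fun ξ : EuclideanSpace ℝ (Fin d) => level (β i) (ξ i)) ⁻¹' {k i} ∩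
      (fun ξ : EuclideanSpace ℝ (Fin d) => ⌊2 ^ k i * ξ i * M⌋) ⁻¹' {σ i}))) := by
    ext ξ
    simp [piece]
  rw [this]
  refine MeasurableSet.iInter fun i => ?_
  have hc : Measurable fun ξ : EuclideanSpace ℝ (Fin d) => ξ i := (coordL i).continuous.measurable
  refine (measurableSet_lt (by fun_prop) measurable_const).inter (MeasurableSet.inter ?_
    (MeasurableSet.inter ?_ ?_))
  · exact (measurableSet_eq_fun hc measurable_const).compl
  · exact ((measurable_level _).comp hc) (measurableSet_singleton _)
  · exact (Int.measurable_floor.comp (by fun_prop)) (measurableSet_singleton _)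

/-- The indices of the pieces. -/
abbrev Idx (d M : ℕ) : Type := (Fin d → ℕ) × (Fin d → Finset.Icc (-(M : ℤ)) M)

/-- The piece with a given index. -/
def idxPiece (β : Fin d → ℝ) (M : ℕ) (i : Idx d M) : Set (EuclideanSpace ℝ (Fin d)) :=
  piece β M i.1 fun j => (i.2 j : ℤ)

lemma measurableSet_idxPiece (β : Fin d → ℝ) (M : ℕ) (i : Idx d M) :
    MeasurableSet (idxPiece β M i) := measurableSet_piece _ _ _ _

lemma idxPiece_subset (β : Fin d → ℝ) (M : ℕ) (i : Idx d M) : idxPiece β M i ⊆ cube d :=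
  fun _ hξ => mem_box_one.2 fun j => (hξ j).1

lemma pairwise_disjoint_idxPiece (β : Fin d → ℝ) (M : ℕ) :
    Pairwise fun i j => Disjoint (idxPiece β M i) (idxPiece β M j) := by
  intro i j hij
  rw [Set.disjoint_left]
  intro ξ hi hj
  refine hij (Prod.ext ?_ ?_)
  · ext n
    rw [← (hi n).2.2.1, ← (hj n).2.2.1]
  · ext n
    have h1 := (hi n).2.2
    have h2 := (hj n).2.2
    simp only at h1 h2
    rw [← h1.2, ← h2.2, ← h1.1, ← h2.1]

/-- The points of the cube that no piece contains lie on the coordinate hyperplanes, which are null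
sets. -/
lemma iUnion_idxPiece_ae_eq (β : Fin d → ℝ) (M : ℕ) :
    (⋃ i, idxPiece β M i : Set (EuclideanSpace ℝ (Fin d))) =ᵐ[volume] cube d := by
  have hnull : ∀ i : Fin d, ∀ᵐ ξ : EuclideanSpace ℝ (Fin d), ξ i ≠ 0 := by
    intro i
    have hne : LinearMap.ker (coordL i : EuclideanSpace ℝ (Fin d) →ₗ[ℝ] ℝ) ≠ ⊤ := by
      intro h
      rw [LinearMap.ker_eq_top] at h
      have := LinearMap.congr_fun h (EuclideanSpace.single i 1)
      simp at this
    have h := Measure.addHaar_submodule (volume : Measure (EuclideanSpace ℝ (Fin d))) _ hne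
    rw [ae_iff]
    refine measure_mono_null (fun ξ hξ => ?_) h
    simpa using hξ
  have hall : ∀ᵐ ξ : EuclideanSpace ℝ (Fin d), ∀ i, ξ i ≠ 0 := ae_all_iff.2 hnull
  filter_upwards [hall] with ξ hξ
  refine propext ⟨fun h => ?_, fun h => ?_⟩
  · obtain ⟨i, hi⟩ := Set.mem_iUnion.1 h
    exact idxPiece_subset β M i hi
  · have h1 := mem_box_one.1 h
    have hm : ξ ∈ piece β M (fun i => level (β i) (ξ i))
        fun i => ⌊2 ^ level (β i) (ξ i) * ξ i * M⌋ := fun i => ⟨h1 i, hξ i, rfl, rfl⟩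
    exact Set.mem_iUnion.2 ⟨(fun i => level (β i) (ξ i),
      fun i => ⟨_, mem_Icc_of_mem_piece hm i⟩), hm⟩

/-- The part of `ℰ_β f` coming from one piece. -/
noncomputable def pieceExt (β : Fin d → ℝ) (M : ℕ) (f : EuclideanSpace ℝ (Fin d) → ℂ)
    (i : Idx d M) : ℝ × EuclideanSpace ℝ (Fin d) → ℂ :=
  oscInt (gBeta β) ((idxPiece β M i).indicator f)

lemma integrable_indicator_idxPiece (β : Fin d → ℝ) (M : ℕ) {f : EuclideanSpace ℝ (Fin d) → ℂ}
    (hf : IntegrableOn f (cube d)) (i : Idx d M) : Integrable ((idxPiece β M i).indicator f) :=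
  (hf.mono_set (idxPiece_subset β M i)).integrable_indicator (measurableSet_idxPiece β M i)

/-- Countable additivity of the integral over the disjoint pieces, then the triangle inequality,
pointwise in z. -/
lemma enorm_extBeta_le (β : Fin d → ℝ) (hβ : ∀ i, 1 < β i) (M : ℕ)
    {f : EuclideanSpace ℝ (Fin d) → ℂ} (hf : IntegrableOn f (cube d))
    (z : ℝ × EuclideanSpace ℝ (Fin d)) :
    ‖extBeta β f z‖ₑ ≤ ∑' i, ‖pieceExt β M f i z‖ₑ := by
  set e : EuclideanSpace ℝ (Fin d) → ℂ := fun ξ =>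
    Complex.exp (Complex.I * ((z.1 * gBeta β ξ + inner ℝ z.2 ξ : ℝ) : ℂ)) * f ξ with he
  have hint : IntegrableOn e (cube d) := by
    refine Integrable.mono hf (AEStronglyMeasurable.mul ?_ hf.1) (.of_forall fun ξ => ?_)
    · have := continuous_gBeta hβ
      exact Continuous.aestronglyMeasurable (by fun_prop)
    · rw [he, norm_mul, norm_exp_I_mul_ofReal, one_mul]
  have h1 : extBeta β f z = ∑' i, pieceExt β M f i z := by
    have h2 : extBeta β f z = ∫ ξ in ⋃ i, idxPiece β M i, e ξ := by
      rw [setIntegral_congr_set (iUnion_idxPiece_ae_eq β M)]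
      rfl
    rw [h2, integral_iUnion (measurableSet_idxPiece β M) (pairwise_disjoint_idxPiece β M)
      (hint.mono_set (Set.iUnion_subset (idxPiece_subset β M)))]
    refine tsum_congr fun i => ?_
    rw [pieceExt, oscInt, ← integral_indicator (measurableSet_idxPiece β M i)]
    congr 1
    ext ξ
    by_cases h : ξ ∈ idxPiece β M i
    · rw [Set.indicator_of_mem h, Set.indicator_of_mem h]
    · rw [Set.indicator_of_notMem h, Set.indicator_of_notMem h, mul_zero]
  rw [h1]
  exact enorm_tsum_le_tsum_enorm

lemma integrableOn_cube {p : ℝ≥0∞} (hp : 1 ≤ p) {f : EuclideanSpace ℝ (Fin d) → ℂ}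
    (hf : MemLp f p (volume.restrict (cube d))) : IntegrableOn f (cube d) :=
  hf.integrable hp

lemma memLp_indicator_idxPiece (β : Fin d → ℝ) (M : ℕ) {p : ℝ≥0∞}
    {f : EuclideanSpace ℝ (Fin d) → ℂ} (hf : MemLp f p (volume.restrict (cube d))) (i : Idx d M) :
    MemLp ((idxPiece β M i).indicator f) p := by
  rw [memLp_indicator_iff_restrict (measurableSet_idxPiece β M i)]
  exact hf.mono_measure (Measure.restrict_mono (idxPiece_subset β M i) le_rfl)

lemma eLpNorm_indicator_idxPiece_le (β : Fin d → ℝ) (M : ℕ) (p : ℝ≥0∞)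
    (f : EuclideanSpace ℝ (Fin d) → ℂ) (i : Idx d M) :
    eLpNorm ((idxPiece β M i).indicator f) p volume ≤ eLpNorm f p (volume.restrict (cube d)) := by
  rw [eLpNorm_indicator_eq_eLpNorm_restrict (measurableSet_idxPiece β M i)]
  exact eLpNorm_mono_measure _ (Measure.restrict_mono (idxPiece_subset β M i) le_rfl)

lemma tsum_eLpNorm_indicator_rpow_le (β : Fin d → ℝ) (M : ℕ) {p : ℝ≥0∞} (hp0 : p ≠ 0)
    (hp : p ≠ ∞) (f : EuclideanSpace ℝ (Fin d) → ℂ) :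
    ∑' i : Idx d M, eLpNorm ((idxPiece β M i).indicator f) p volume ^ p.toReal ≤
      eLpNorm f p (volume.restrict (cube d)) ^ p.toReal := by
  have hp' : 0 < p.toReal := ENNReal.toReal_pos hp0 hp
  have h : ∀ s : Set (EuclideanSpace ℝ (Fin d)), eLpNorm f p (volume.restrict s) ^ p.toReal =
      ∫⁻ ξ in s, ‖f ξ‖ₑ ^ p.toReal := fun s => by
    rw [eLpNorm_eq_lintegral_rpow_enorm_toReal hp0 hp, ← ENNReal.rpow_mul, one_div,
      inv_mul_cancel₀ hp'.ne', ENNReal.rpow_one]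
  simp_rw [eLpNorm_indicator_eq_eLpNorm_restrict (measurableSet_idxPiece β M _), h]
  rw [← lintegral_iUnion (measurableSet_idxPiece β M) (pairwise_disjoint_idxPiece β M)]
  exact lintegral_mono_set (Set.iUnion_subset (idxPiece_subset β M))

/-- The embedding ℓ^p ⊂ ℓ^q. In the critical strong type bound the pieces have no decay, and this is
what sums their L^p norms. -/
lemma tsum_rpow_le_rpow_tsum {ι : Type*} (x : ι → ℝ≥0∞) {p q : ℝ} (hp : 0 < p) (hpq : p ≤ q) :
    ∑' i, x i ^ q ≤ (∑' i, x i ^ p) ^ (q / p) := by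
  set X := ∑' i, x i ^ p with hX
  have hr : 0 ≤ q / p - 1 := by rw [sub_nonneg, one_le_div hp]; exact hpq
  have h1 : ∀ y : ℝ≥0∞, y ^ q = y ^ p * (y ^ p) ^ (q / p - 1) := fun y => by
    rw [← ENNReal.rpow_mul, ← ENNReal.rpow_add_of_nonneg _ _ hp.le (by positivity)]
    congr 1
    field_simp
    ring
  calc ∑' i, x i ^ q ≤ ∑' i, x i ^ p * X ^ (q / p - 1) := by
        refine ENNReal.tsum_le_tsum fun i => ?_
        rw [h1]
        gcongr
        exact ENNReal.le_tsum i
    _ = X ^ (1 : ℝ) * X ^ (q / p - 1) := by rw [ENNReal.tsum_mul_right, ENNReal.rpow_one]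
    _ = X ^ (q / p) := by
        rw [← ENNReal.rpow_add_of_nonneg _ _ zero_le_one hr]
        congr 1
        ring

/-! ### Convergent sums -/

lemma tsum_geometric_lt_top {t : ℝ} (ht : 0 < t) :
    ∑' m : ℕ, ENNReal.ofReal (2 ^ (-(t * m))) < ∞ := by
  have h : ∀ m : ℕ, ENNReal.ofReal (2 ^ (-(t * m))) = ENNReal.ofReal (2 ^ (-t)) ^ m := fun m => by
    rw [← ENNReal.ofReal_pow (by positivity), ← Real.rpow_natCast, ← Real.rpow_mul (by norm_num)]
    congr 2
    ring
  simp_rw [h]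
  rw [ENNReal.tsum_geometric, ENNReal.inv_lt_top, tsub_pos_iff_lt, ENNReal.ofReal_lt_one]
  exact Real.rpow_lt_one_of_one_lt_of_neg (by norm_num) (by linarith)

/-- The points a·n are a-separated, so n is determined by the side of x on which a·n lies and by the
integer part of its distance from x in units of a. The two sides give the factor 2. -/
lemma tsum_two_rpow_abs_le {δ a : ℝ} (hδ : 0 < δ) (ha : 0 < a) (x : ℝ) :
    ∑' n : ℕ, ENNReal.ofReal (2 ^ (-(δ * |a * n - x|))) ≤
      2 * ∑' m : ℕ, ENNReal.ofReal (2 ^ (-(δ * a * m))) := by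
  set e : ℕ → ℕ × Bool := fun n => (⌊|a * n - x| / a⌋₊, decide (x ≤ a * n)) with he
  have hinj : Function.Injective e := by
    intro n n' h
    rw [he, Prod.mk.injEq, decide_eq_decide] at h
    obtain ⟨h1, h2⟩ := h
    have key : ∀ y y' : ℝ, 0 ≤ y → 0 ≤ y' → ⌊y⌋₊ = ⌊y'⌋₊ → |y - y'| < 1 := by
      intro y y' hy hy' hyy
      have a1 := Nat.floor_le hy
      have a2 := Nat.lt_floor_add_one y
      have a3 := Nat.floor_le hy'
      have a4 := Nat.lt_floor_add_one y'
      rw [hyy] at a1 a2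
      rw [abs_lt]
      constructor <;> linarith
    have h3 := key _ _ (by positivity) (by positivity) h1
    have h4 : |(n : ℝ) - n'| < 1 := by
      by_cases hx : x ≤ a * n
      · have hx' := h2.1 hx
        rw [abs_of_nonneg (by linarith : 0 ≤ a * n - x),
          abs_of_nonneg (by linarith : 0 ≤ a * n' - x)] at h3
        convert h3 using 2
        field_simp
        ring
      · have hx' : ¬ x ≤ a * n' := fun h => hx (h2.2 h)
        push Not at hx hx'
        rw [abs_of_neg (by linarith : a * n - x < 0),
          abs_of_neg (by linarith : a * n' - x < 0)] at h3
        rw [abs_sub_comm]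
        convert h3 using 2
        field_simp
        ring
    have h5 : |(n : ℤ) - n'| < 1 := by exact_mod_cast h4
    rw [Int.abs_lt_one_iff] at h5
    omega
  calc ∑' n : ℕ, ENNReal.ofReal (2 ^ (-(δ * |a * n - x|)))
      ≤ ∑' n : ℕ, ENNReal.ofReal (2 ^ (-(δ * a * (e n).1))) := by
        refine ENNReal.tsum_le_tsum fun n => ENNReal.ofReal_le_ofReal
          (Real.rpow_le_rpow_of_exponent_le (by norm_num) ?_)
        have h1 : ((e n).1 : ℝ) ≤ |a * n - x| / a := Nat.floor_le (by positivity)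
        rw [le_div_iff₀ ha] at h1
        nlinarith
    _ ≤ ∑' m : ℕ × Bool, ENNReal.ofReal (2 ^ (-(δ * a * m.1))) :=
        ENNReal.tsum_comp_le_tsum_of_injective hinj
          fun m : ℕ × Bool => ENNReal.ofReal (2 ^ (-(δ * a * m.1)))
    _ = _ := by
        rw [ENNReal.tsum_prod']
        simp only [tsum_fintype, Finset.sum_const, Finset.card_univ, Fintype.card_bool,
          nsmul_eq_mul, ENNReal.tsum_mul_left, Nat.cast_ofNat]

lemma tsum_pi_prod_le (φ : Fin d → ℕ → ℝ≥0∞) :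
    ∑' k : Fin d → ℕ, ∏ i, φ i (k i) ≤ ∏ i, ∑' n, φ i n := by
  rw [ENNReal.tsum_eq_iSup_sum]
  refine iSup_le fun s => ?_
  classical
  have hsub : s ⊆ Fintype.piFinset fun i => s.image fun k => k i := fun k hk =>
    Fintype.mem_piFinset.2 fun i => Finset.mem_image_of_mem _ hk
  calc ∑ k ∈ s, ∏ i, φ i (k i)
      ≤ ∑ k ∈ Fintype.piFinset fun i => s.image fun k => k i, ∏ i, φ i (k i) :=
        Finset.sum_le_sum_of_subset hsub
    _ = ∏ i, ∑ n ∈ s.image fun k => k i, φ i n := (Finset.prod_univ_sum _ _).symm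
    _ ≤ _ := Finset.prod_le_prod' fun i _ => ENNReal.sum_le_tsum _

/-- Sums over all pieces of `2^{-δ ∑ |a_i k_i - x_i|}` are bounded uniformly in `x`. -/
lemma exists_tsum_idx_le (M : ℕ) {δ : ℝ} (hδ : 0 < δ) {a : Fin d → ℝ} (ha : ∀ i, 0 < a i) :
    ∃ A : ℝ≥0∞, A ≠ ∞ ∧ ∀ x : Fin d → ℝ,
      ∑' j : Idx d M, ENNReal.ofReal (2 ^ (-(δ * ∑ i, |a i * j.1 i - x i|))) ≤ A := by
  refine ⟨Fintype.card (Fin d → Finset.Icc (-(M : ℤ)) M) *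
    ∏ i, (2 * ∑' m : ℕ, ENNReal.ofReal (2 ^ (-(δ * a i * m)))), ?_, fun x => ?_⟩
  · refine ENNReal.mul_ne_top (ENNReal.natCast_ne_top _) (ENNReal.prod_ne_top fun i _ => ?_)
    exact ENNReal.mul_ne_top (by simp) (tsum_geometric_lt_top (mul_pos hδ (ha i))).ne
  · have h : ∀ k : Fin d → ℕ, ENNReal.ofReal (2 ^ (-(δ * ∑ i, |a i * k i - x i|))) =
        ∏ i, ENNReal.ofReal (2 ^ (-(δ * |a i * k i - x i|))) := fun k => by
      rw [← ENNReal.ofReal_prod_of_nonneg fun i _ => by positivity,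
        ← Real.rpow_sum_of_pos (by norm_num), Finset.sum_neg_distrib, Finset.mul_sum]
    rw [ENNReal.tsum_prod']
    simp only [tsum_fintype, Finset.sum_const, Finset.card_univ, nsmul_eq_mul,
        ENNReal.tsum_mul_left]
    gcongr
    simp_rw [h]
    refine (tsum_pi_prod_le fun i n => ENNReal.ofReal (2 ^ (-(δ * |a i * n - x i|)))).trans ?_
    exact Finset.prod_le_prod' fun i _ => tsum_two_rpow_abs_le hδ (ha i) (x i)

/-! ### Criteria for strong and restricted weak type bounds -/

lemma toReal_pos_of_one_le {q : ℝ≥0∞} (h1 : 1 ≤ q) (hq : q ≠ ∞) : 0 < q.toReal :=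
  ENNReal.toReal_pos (zero_lt_one.trans_le h1).ne' hq

/-- Hölder for the (q/2)-th powers, with the conjugate exponents 2q₁/q and 2q₂/q. The two factors
may be measured in different spaces as long as 1/q is the mean of the reciprocals. -/
lemma lintegral_pair_le {α : Type*} [MeasurableSpace α] {μ : Measure α} {F F' : α → ℂ}
    (hF : AEStronglyMeasurable F μ) (hF' : AEStronglyMeasurable F' μ) {q q₁ q₂ : ℝ≥0∞}
    (hq1 : 1 ≤ q) (hq : q ≠ ∞) (hq₁1 : 1 ≤ q₁) (hq₁ : q₁ ≠ ∞) (hq₂1 : 1 ≤ q₂) (hq₂ : q₂ ≠ ∞)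
    (h : recip q₁ + recip q₂ = 2 * recip q) :
    ∫⁻ x, (‖F x‖ₑ * ‖F' x‖ₑ) ^ (q.toReal / 2) ∂μ ≤
      (eLpNorm F q₁ μ * eLpNorm F' q₂ μ) ^ (q.toReal / 2) := by
  have h0 := toReal_pos_of_one_le hq1 hq
  have h₁ := toReal_pos_of_one_le hq₁1 hq₁
  have h₂ := toReal_pos_of_one_le hq₂1 hq₂
  rw [recip_eq_inv, recip_eq_inv, recip_eq_inv] at h
  set a := q.toReal / 2 with ha
  have ha0 : 0 < a := by positivity
  have hsum : (q₁.toReal / a)⁻¹ + (q₂.toReal / a)⁻¹ = 1 := by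
    rw [inv_div, inv_div, div_eq_mul_inv, div_eq_mul_inv, ← mul_add, h, ha]
    field_simp
  have hconj : (q₁.toReal / a).HolderConjugate (q₂.toReal / a) := by
    rw [Real.holderConjugate_iff]
    refine ⟨?_, hsum⟩
    have h3 : 0 < (q₂.toReal / a)⁻¹ := by positivity
    have h4 : (q₁.toReal / a)⁻¹ < 1 := by linarith
    exact (inv_lt_one₀ (by positivity)).1 h4
  have hn : ∀ (F : α → ℂ) (r : ℝ≥0∞), 1 ≤ r → r ≠ ∞ →
      (∫⁻ x, (‖F x‖ₑ ^ a) ^ (r.toReal / a) ∂μ) ^ (1 / (r.toReal / a)) = eLpNorm F r μ ^ a := by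
    intro F r hr1 hr
    have hr0 := toReal_pos_of_one_le hr1 hr
    rw [eLpNorm_eq_lintegral_rpow_enorm_toReal (zero_lt_one.trans_le hr1).ne' hr,
      ← ENNReal.rpow_mul]
    simp_rw [← ENNReal.rpow_mul]
    congr 2
    · ext x
      congr 1
      field_simp
    · field_simp
  have key := ENNReal.lintegral_mul_le_Lp_mul_Lq μ hconj (hF.enorm.pow_const a)
    (hF'.enorm.pow_const a)
  rw [hn F q₁ hq₁1 hq₁, hn F' q₂ hq₂1 hq₂] at key
  rw [ENNReal.mul_rpow_of_nonneg _ _ ha0.le]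
  refine le_trans (le_of_eq ?_) key
  refine lintegral_congr fun x => ?_
  rw [ENNReal.mul_rpow_of_nonneg _ _ ha0.le]
  rfl

lemma continuous_pieceExt {β : Fin d → ℝ} (hβ : ∀ i, 1 < β i) (M : ℕ)
    {f : EuclideanSpace ℝ (Fin d) → ℂ} (hf : IntegrableOn f (cube d)) (i : Idx d M) :
    Continuous (pieceExt β M f i) :=
  continuous_oscInt (continuous_gBeta hβ) (integrable_indicator_idxPiece β M hf i)

/-- Strong type bounds from off-diagonal decay of the products of pairs of pieces. -/
theorem strongType_of_pairs {β : Fin d → ℝ} (hβ : ∀ i, 1 < β i) {p q : ℝ≥0∞} (hp : 1 ≤ p)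
    (hq1 : 1 ≤ q) (hq : q ≠ ∞) (M : ℕ) {δ : ℝ} (hδ : 0 < δ) {C : ℝ≥0∞} (hC : C ≠ ∞)
    (h : ∀ f : EuclideanSpace ℝ (Fin d) → ℂ, MemLp f p (volume.restrict (cube d)) →
      ∃ c : Idx d M → ℝ≥0∞,
        ∑' i, c i ^ q.toReal ≤ (C * eLpNorm f p (volume.restrict (cube d))) ^ q.toReal ∧
        ∀ i j, ∃ q₁ q₂ : ℝ≥0∞, 1 ≤ q₁ ∧ q₁ ≠ ∞ ∧ 1 ≤ q₂ ∧ q₂ ≠ ∞ ∧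
          recip q₁ + recip q₂ = 2 * recip q ∧
          eLpNorm (pieceExt β M f i) q₁ volume * eLpNorm (pieceExt β M f j) q₂ volume ≤
            ENNReal.ofReal (2 ^ (-(δ * ∑ n, |(i.1 n : ℝ) - j.1 n|))) * (c i * c j)) :
    StrongType β p q := by
  have hq0 := toReal_pos_of_one_le hq1 hq
  -- The order of the expansion in the Schur test, which must be a positive integer at least q.
  set N : ℕ := ⌈q.toReal⌉₊ + 1 with hN
  have hNq : q.toReal ≤ N := (Nat.le_ceil _).trans (by rw [hN]; push_cast; linarith)
  have hN0 : 0 < N := by omega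
  have hN0' : (0 : ℝ) < N := by exact_mod_cast hN0
  -- The decay rate that survives the power q/2 of the pair bound and the power N^{-2} of the Schur
  -- test.
  set t : ℝ := δ * (q.toReal / 2) * ((N : ℝ) ^ 2)⁻¹ with ht
  have ht0 : 0 < t := by positivity
  obtain ⟨A, hA, hAle⟩ := exists_tsum_idx_le (d := d) M ht0 (a := fun _ => 1) fun _ => one_pos
  set B : ℝ≥0∞ := (N * A ^ N) ^ q.toReal⁻¹ * C with hB
  have hBt : B ≠ ∞ := ENNReal.mul_ne_top (ENNReal.rpow_ne_top_of_nonneg (by positivity)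
    (ENNReal.mul_ne_top (ENNReal.natCast_ne_top _) (ENNReal.pow_ne_top hA))) hC
  have hbound : ∀ f : EuclideanSpace ℝ (Fin d) → ℂ, MemLp f p (volume.restrict (cube d)) →
      eLpNorm (extBeta β f) q volume ≤ B * eLpNorm f p (volume.restrict (cube d)) := by
    intro f hf
    have hfi := integrableOn_cube hp hf
    obtain ⟨c, hc, hpair⟩ := h f hf
    set w : Idx d M → Idx d M → ℝ≥0∞ := fun i j =>
      ENNReal.ofReal (2 ^ (-(δ * ∑ n, |(i.1 n : ℝ) - j.1 n|))) ^ (q.toReal / 2) with hw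
    have hsch := lintegral_tsum_rpow_le (μ := volume) (G := fun i z => ‖pieceExt β M f i z‖ₑ)
      (fun i => (continuous_pieceExt hβ M hfi i).enorm.measurable.aemeasurable) hq0 (c := c)
      (w := w)
      (fun i j => ENNReal.rpow_le_one (by
        rw [ENNReal.ofReal_le_one]
        refine Real.rpow_le_one_of_one_le_of_nonpos (by norm_num) ?_
        have : 0 ≤ ∑ n, |(i.1 n : ℝ) - j.1 n| := Finset.sum_nonneg fun _ _ => abs_nonneg _
        nlinarith) (by positivity))
      (fun i j => by
        obtain ⟨q₁, q₂, h1, h2, h3, h4, h5, h6⟩ := hpair i j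
        refine (lintegral_pair_le (continuous_pieceExt hβ M hfi i).aestronglyMeasurable
          (continuous_pieceExt hβ M hfi j).aestronglyMeasurable hq1 hq h1 h2 h3 h4 h5).trans ?_
        rw [hw, ← ENNReal.mul_rpow_of_nonneg _ _ (by positivity)]
        gcongr)
      hN0 hNq (A := A) (fun i => by
        refine le_trans (le_of_eq (tsum_congr fun j => ?_)) (hAle fun n => i.1 n)
        rw [hw, ← ENNReal.rpow_mul, ENNReal.ofReal_rpow_of_pos (by positivity),
          ← Real.rpow_mul (by norm_num)]
        congr 2
        simp only [one_mul, abs_sub_comm ((i.1 _ : ℕ) : ℝ)]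
        rw [ht]
        ring)
    rw [eLpNorm_eq_lintegral_rpow_enorm_toReal (zero_lt_one.trans_le hq1).ne' hq]
    have h1 : ∫⁻ z, ‖extBeta β f z‖ₑ ^ q.toReal ≤
        N * A ^ N * (C * eLpNorm f p (volume.restrict (cube d))) ^ q.toReal := by
      refine le_trans (lintegral_mono fun z => ?_) (hsch.trans (by gcongr))
      gcongr
      exact enorm_extBeta_le β hβ M hfi z
    calc (∫⁻ z, ‖extBeta β f z‖ₑ ^ q.toReal) ^ (1 / q.toReal)
        ≤ (N * A ^ N * (C * eLpNorm f p (volume.restrict (cube d))) ^ q.toReal) ^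
            (1 / q.toReal) := by
          gcongr
      _ = B * eLpNorm f p (volume.restrict (cube d)) := by
          rw [ENNReal.mul_rpow_of_nonneg _ _ (by positivity), ← ENNReal.rpow_mul,
            mul_one_div_cancel hq0.ne', ENNReal.rpow_one, hB, one_div, mul_assoc]
  refine ⟨B.toNNReal, fun f hf => ?_⟩
  rw [ENNReal.coe_toNNReal hBt]
  have hf' : MemLp f p (volume.restrict (cube d)) := hf
  exact ⟨⟨(continuous_extBeta hβ (integrableOn_cube hp hf')).aestronglyMeasurable,
    (hbound f hf').trans_lt (ENNReal.mul_lt_top hBt.lt_top hf'.2)⟩, hbound f hf'⟩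

/-- The trivial bound, with values in `L^∞`. -/
theorem strongType_top {β : Fin d → ℝ} (hβ : ∀ i, 1 < β i) {p : ℝ≥0∞} (hp : 1 ≤ p) :
    StrongType β p ∞ := by
  set B : ℝ≥0∞ := (volume.restrict (cube d)) Set.univ ^
    (1 / (1 : ℝ≥0∞).toReal - 1 / p.toReal) with hB
  have hBt : B ≠ ∞ := by
    refine ENNReal.rpow_ne_top_of_nonneg ?_ (measure_ne_top _ _)
    rw [ENNReal.toReal_one, div_one, one_div, ← recip_eq_inv, sub_nonneg]
    exact recip_le_one hp
  refine ⟨B.toNNReal, fun f hf => ?_⟩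
  rw [ENNReal.coe_toNNReal hBt]
  have hf' : MemLp f p (volume.restrict (cube d)) := hf
  have hbound : eLpNorm (extBeta β f) ∞ volume ≤ B * eLpNorm f p (volume.restrict (cube d)) := by
    have h1 := eLpNorm_le_eLpNorm_mul_rpow_measure_univ hp hf'.1
    rw [mul_comm, eLpNorm_one_eq_lintegral_enorm] at h1
    refine le_trans ?_ h1
    rw [eLpNorm_exponent_top]
    refine eLpNormEssSup_le_of_ae_enorm_bound (.of_forall fun z => ?_)
    refine (enorm_integral_le_lintegral_enorm _).trans (le_of_eq ?_)
    refine lintegral_congr fun ξ => ?_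
    rw [enorm_mul, ← ofReal_norm (Complex.exp _), norm_exp_I_mul_ofReal, ENNReal.ofReal_one,
        one_mul]
  exact ⟨⟨(continuous_extBeta hβ (integrableOn_cube hp hf')).aestronglyMeasurable,
    hbound.trans_lt (ENNReal.mul_lt_top hBt.lt_top hf'.2)⟩, hbound⟩

/-- Restricted weak type bounds from bounds in two spaces `L^{q₁}`, `L^{q₂}`, with opposite
exponential weights, for the pieces. -/
theorem restrictedWeakType_of_pieces {β : Fin d → ℝ} (hβ : ∀ i, 1 < β i) {p q q₁ q₂ : ℝ≥0∞}
    (hp : 1 ≤ p) (hq1 : 1 ≤ q) (hq₁1 : 1 ≤ q₁) (hq₁ : q₁ ≠ ∞) (hq₂1 : 1 ≤ q₂) (hq₂ : q₂ ≠ ∞)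
    {η : ℝ} (hη₁ : recip q₁ = recip q - η) (hη₂ : recip q₂ = recip q + η)
    (M : ℕ) {e δ : ℝ} (he : 0 < e) (hδ : 0 < δ) {C : ℝ≥0}
    (h : ∀ f : EuclideanSpace ℝ (Fin d) → ℂ, MemLp f p (volume.restrict (cube d)) →
      ∀ (i : Idx d M) (x : ℝ), ∃ X : ℝ, X ≤ -(δ * ∑ n, |β n / 2 * i.1 n - x|) ∧
        (eLpNorm (pieceExt β M f i) q₁ volume ≤
            C * ENNReal.ofReal (2 ^ (X - e * x)) * eLpNorm f p (volume.restrict (cube d)) ∨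
          eLpNorm (pieceExt β M f i) q₂ volume ≤
            C * ENNReal.ofReal (2 ^ (X + e * x)) * eLpNorm f p (volume.restrict (cube d)))) :
    RestrictedWeakType β p q := by
  obtain ⟨A, hA, hAle⟩ := exists_tsum_idx_le (d := d) M hδ (a := fun n => β n / 2)
    fun n => by linarith [hβ n]
  refine ⟨C * A.toReal, fun E F f g hE hF hEt hFt hf hg hfE hgF => ?_⟩
  set vF := volume.real F with hvF
  -- Null sets F are treated separately because the logarithm of |F| is taken below.
  rcases (measureReal_nonneg (μ := volume) (s := F)).eq_or_lt with hF0 | hFpos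
  · have hF0' : volume F = 0 := by
      rw [Measure.real] at hF0
      exact ((ENNReal.toReal_eq_zero_iff _).1 hF0.symm).resolve_right hFt.ne
    have : ∫ z, extBeta β f z * (starRingEnd ℂ) (g z) = 0 := by
      refine integral_eq_zero_of_ae ?_
      have hz : ∀ᵐ z, z ∉ F := measure_eq_zero_iff_ae_notMem.1 hF0'
      filter_upwards [hz] with z hz
      have := hgF z
      rw [Set.indicator_of_notMem hz, norm_le_zero_iff] at this
      simp [this]
    rw [this, norm_zero]
    positivity
  have hfE' : ∀ ξ, ‖f ξ‖ₑ ≤ ‖E.indicator (fun _ => (1 : ℝ)) ξ‖ₑ := fun ξ => by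
    rw [enorm_le_iff_norm_le]
    exact (hfE ξ).trans (le_abs_self _)
  have hfnorm : eLpNorm f p (volume.restrict (cube d)) ≤
      ENNReal.ofReal (volume.real E ^ recip p) := by
    have h1 : eLpNorm f p volume ≤ volume E ^ recip p := by
      refine (eLpNorm_mono_enorm hfE').trans ?_
      by_cases hpt : p = ∞
      · subst hpt
        rw [recip_top, ENNReal.rpow_zero]
        refine (eLpNorm_indicator_const_le (1 : ℝ) ∞).trans ?_
        simp
      · rw [eLpNorm_indicator_const hE (zero_lt_one.trans_le hp).ne' hpt, recip_eq_inv]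
        simp
    refine (eLpNorm_mono_measure _ Measure.restrict_le_self).trans (h1.trans (le_of_eq ?_))
    rw [← ENNReal.ofReal_rpow_of_nonneg measureReal_nonneg (recip_nonneg p), Measure.real,
      ENNReal.ofReal_toReal hEt.ne]
  have hfmem : MemLp f p (volume.restrict (cube d)) :=
    ⟨hf.aestronglyMeasurable, hfnorm.trans_lt ENNReal.ofReal_lt_top⟩
  have hfi := integrableOn_cube hp hfmem
  -- Then 2^{ex} = |F|^η. The weight 2^{∓ex} in the bounds exactly offsets the change |F|^{±η} in
  -- Hölder's inequality on F, so that either exponent gives |F|^{1/q'}.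
  set x : ℝ := η / e * Real.logb 2 vF with hx
  have h2x : ∀ t : ℝ, 2 ^ (t * (e * x)) = vF ^ (t * η) := fun t => by
    have : t * (e * x) = Real.logb 2 vF * (t * η) := by
      rw [hx]
      field_simp
    rw [this, Real.rpow_mul (by norm_num), Real.rpow_logb (by norm_num) (by norm_num) hFpos]
  have hHol : ∀ (i : Idx d M) (r : ℝ≥0∞), 1 ≤ r → r ≠ ∞ → ∫⁻ z in F, ‖pieceExt β M f i z‖ₑ ≤
      eLpNorm (pieceExt β M f i) r volume * ENNReal.ofReal (vF ^ (1 - recip r)) := by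
    intro i r hr1 hr
    have h1 := eLpNorm_le_eLpNorm_mul_rpow_measure_univ (μ := volume.restrict F) hr1
      (continuous_pieceExt hβ M hfi i).aestronglyMeasurable
    rw [eLpNorm_one_eq_lintegral_enorm] at h1
    refine h1.trans ?_
    rw [ENNReal.toReal_one, div_one, one_div, ← recip_eq_inv, Measure.restrict_apply_univ,
      ← ENNReal.ofReal_rpow_of_nonneg measureReal_nonneg (by linarith [recip_le_one hr1]),
      Measure.real, ENNReal.ofReal_toReal hFt.ne]
    gcongr
    exact Measure.restrict_le_self
  have hpiece : ∀ i : Idx d M, ∫⁻ z in F, ‖pieceExt β M f i z‖ₑ ≤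
      C * ENNReal.ofReal (volume.real E ^ recip p) * ENNReal.ofReal (vF ^ recip' q) *
        ENNReal.ofReal (2 ^ (-(δ * ∑ n, |β n / 2 * i.1 n - x|))) := by
    intro i
    obtain ⟨X, hX, hor⟩ := h f hfmem i x
    have hfin : ∀ (r : ℝ≥0∞) (t : ℝ), 1 ≤ r → r ≠ ∞ → recip r = recip q + t * η →
        eLpNorm (pieceExt β M f i) r volume ≤
          C * ENNReal.ofReal (2 ^ (X + t * (e * x))) * eLpNorm f p (volume.restrict (cube d)) →
        ∫⁻ z in F, ‖pieceExt β M f i z‖ₑ ≤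
          C * ENNReal.ofReal (volume.real E ^ recip p) * ENNReal.ofReal (vF ^ recip' q) *
            ENNReal.ofReal (2 ^ (-(δ * ∑ n, |β n / 2 * i.1 n - x|))) := by
      intro r t hr1 hr hrt hle
      have hreal : (2 : ℝ) ^ (X + t * (e * x)) * vF ^ (1 - recip r) = vF ^ recip' q * 2 ^ X := by
        rw [Real.rpow_add (by norm_num), h2x, mul_assoc, ← Real.rpow_add hFpos, hrt, recip'_eq hq1,
          mul_comm]
        congr 2
        ring
      calc ∫⁻ z in F, ‖pieceExt β M f i z‖ₑ
          ≤ (C * ENNReal.ofReal (2 ^ (X + t * (e * x))) *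
              ENNReal.ofReal (volume.real E ^ recip p)) *
            ENNReal.ofReal (vF ^ (1 - recip r)) := by
            refine (hHol i r hr1 hr).trans ?_
            gcongr
            exact hle.trans (by gcongr)
        _ = C * ENNReal.ofReal (volume.real E ^ recip p) *
            ENNReal.ofReal (2 ^ (X + t * (e * x)) * vF ^ (1 - recip r)) := by
            rw [ENNReal.ofReal_mul (by positivity)]
            ring
        _ = C * ENNReal.ofReal (volume.real E ^ recip p) * ENNReal.ofReal (vF ^ recip' q) *
            ENNReal.ofReal (2 ^ X) := by
            rw [hreal, ENNReal.ofReal_mul (by positivity), ← mul_assoc]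
        _ ≤ _ := by
            gcongr
            norm_num
    rcases hor with h1 | h2
    · exact hfin q₁ (-1) hq₁1 hq₁ (by rw [hη₁]; ring) (by rwa [neg_one_mul, ← sub_eq_add_neg])
    · exact hfin q₂ 1 hq₂1 hq₂ (by rw [hη₂]; ring) (by rwa [one_mul])
  have htot : ‖∫ z, extBeta β f z * (starRingEnd ℂ) (g z)‖ₑ ≤
      ENNReal.ofReal (C * A.toReal * volume.real E ^ recip p * vF ^ recip' q) := by
    calc ‖∫ z, extBeta β f z * (starRingEnd ℂ) (g z)‖ₑ
        ≤ ∫⁻ z, ‖extBeta β f z * (starRingEnd ℂ) (g z)‖ₑ := enorm_integral_le_lintegral_enorm _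
      _ ≤ ∫⁻ z, F.indicator (fun z => ∑' i, ‖pieceExt β M f i z‖ₑ) z := by
          refine lintegral_mono fun z => ?_
          rw [enorm_mul]
          by_cases hz : z ∈ F
          · rw [Set.indicator_of_mem hz]
            have h1 := hgF z
            rw [Set.indicator_of_mem hz] at h1
            have h2 : ‖(starRingEnd ℂ) (g z)‖ₑ ≤ 1 := by
              rw [← ofReal_norm, RCLike.norm_conj]
              exact ENNReal.ofReal_le_one.2 h1
            exact (mul_le_of_le_one_right' h2).trans (enorm_extBeta_le β hβ M hfi z)
          · have := hgF z
            rw [Set.indicator_of_notMem hz, norm_le_zero_iff] at this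
            simp [this]
      _ = ∑' i, ∫⁻ z in F, ‖pieceExt β M f i z‖ₑ := by
          rw [lintegral_indicator hF, lintegral_tsum fun i =>
            (continuous_pieceExt hβ M hfi i).enorm.measurable.aemeasurable]
      _ ≤ ∑' i : Idx d M, C * ENNReal.ofReal (volume.real E ^ recip p) *
            ENNReal.ofReal (vF ^ recip' q) *
            ENNReal.ofReal (2 ^ (-(δ * ∑ n, |β n / 2 * i.1 n - x|))) := ENNReal.tsum_le_tsum hpiece
      _ ≤ C * ENNReal.ofReal (volume.real E ^ recip p) * ENNReal.ofReal (vF ^ recip' q) * A := by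
          rw [ENNReal.tsum_mul_left]
          gcongr
          exact hAle fun _ => x
      _ = _ := by
          rw [ENNReal.ofReal_mul (by positivity), ENNReal.ofReal_mul (by positivity),
            ENNReal.ofReal_mul (by positivity), ENNReal.ofReal_toReal hA, ENNReal.ofReal_coe_nnreal]
          ring
  rw [← ofReal_norm] at htot
  exact (ENNReal.ofReal_le_ofReal_iff (by positivity)).1 htot

/-! ### The non-critical case -/

lemma exists_pos_forall_le {ι : Type*} [Finite ι] (x : ι → ℝ) :
    ∃ γ > 0, ∀ i, 0 < x i → γ ≤ x i := by
  cases nonempty_fintype ι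
  rcases isEmpty_or_nonempty ι with h | h
  · exact ⟨1, one_pos, fun i => h.elim i⟩
  · obtain ⟨i, -, hi⟩ := Finset.exists_min_image Finset.univ
      (fun i => if 0 < x i then x i else 1) Finset.univ_nonempty
    refine ⟨if 0 < x i then x i else 1, by split_ifs with h; exacts [h, one_pos], fun j hj => ?_⟩
    have := hi j (Finset.mem_univ _)
    simpa only [hj, if_true] using this

lemma level_eq_zero_of_mem_piece {β : Fin d → ℝ} {M : ℕ} {k : Fin d → ℕ} {σ : Fin d → ℤ}
    {ξ : EuclideanSpace ℝ (Fin d)} (hξ : ξ ∈ piece β M k σ) {n : Fin d} (hn : β n = 2) :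
    k n = 0 := by
  rw [← (hξ n).2.2.1, hn, level_two]

lemma pieceExt_eq_zero {β : Fin d → ℝ} {M : ℕ} (f : EuclideanSpace ℝ (Fin d) → ℂ) {i : Idx d M}
    (hi : ¬ ∀ n, β n = 2 → i.1 n = 0) : pieceExt β M f i = 0 := by
  have h : idxPiece β M i = ∅ := by
    rw [Set.eq_empty_iff_forall_notMem]
    exact fun ξ hξ => hi fun n hn => level_eq_zero_of_mem_piece hξ hn
  ext z
  simp [pieceExt, h, oscInt]

lemma mem_piece_of_indicator_ne_zero {β : Fin d → ℝ} {M : ℕ} {f : EuclideanSpace ℝ (Fin d) → ℂ}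
    {i : Idx d M} {ξ : EuclideanSpace ℝ (Fin d)} (h : (idxPiece β M i).indicator f ξ ≠ 0) :
    ξ ∈ piece β M i.1 fun j => (i.2 j : ℤ) :=
  Set.mem_of_indicator_ne_zero h

/-- Strong type bounds, if the bounds for the pieces decay in all levels. -/
theorem strongType_of_strict [NeZero d] {p q : ℝ≥0∞} (hT : (p, q) ∈ T d) (hq : q ≠ ∞)
    (hc : RectConjecture d p q) {β : Fin d → ℝ} (hβ : ∀ i, 1 < β i) {u : Fin d → ℝ}
    (hu0 : ∀ i, 0 ≤ u i) (hu1 : ∀ i, u i ≤ cap p q) (hu : ∑ i, u i = 2 * recip q)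
    (hstrict : ∀ i, β i ≠ 2 → u i * β i < 2 * gap p q) : StrongType β p q := by
  have hp : 1 ≤ p := hT.1
  have hq1 : 1 ≤ q := hT.2.1
  have hq0 := toReal_pos_of_one_le hq1 hq
  -- The smallest of the positive decay rates; where β_i = 2 the rate may be 0, but there only level
  -- 0 occurs.
  obtain ⟨γ, hγ, hγle⟩ := exists_pos_forall_le fun i => gap p q - u i * β i / 2
  set S := ∑ i, β i with hS
  have hβS : ∀ i, β i ≤ S := fun i =>
    Finset.single_le_sum (fun j _ => by linarith [hβ j]) (Finset.mem_univ i)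
  have hS0 : 0 < S := by linarith [hβ 0, hβS 0]
  obtain ⟨M, hM⟩ := exists_piece_bound hT hq hc hβ
  -- With D = ∑ β_n k_n/2 below, the loss (γ/S)·D is at most (γ/2)∑ k_n, half of the gain.
  obtain ⟨C, hC⟩ := hM M le_rfl (γ / S) (by positivity) (fun _ => by positivity) u hu0 hu1 hu
  have hpiece : ∀ f : EuclideanSpace ℝ (Fin d) → ℂ, MemLp f p (volume.restrict (cube d)) →
      ∀ i : Idx d M, eLpNorm (pieceExt β M f i) q volume ≤
        C * ENNReal.ofReal (2 ^ (-(γ / 2 * ∑ n, (i.1 n : ℝ)))) *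
          eLpNorm f p (volume.restrict (cube d)) := by
    intro f hf i
    by_cases hi : ∀ n, β n = 2 → i.1 n = 0
    swap
    · rw [pieceExt_eq_zero f hi]
      simp
    have hm : ∀ j, 0 ≤ β j * i.1 j / 2 := fun j => by
      have := hβ j
      positivity
    refine (hC i.1 (fun j => i.2 j) (∑ n, β n * i.1 n / 2) (fun a b => ?_) _
      (integrable_indicator_idxPiece β M (integrableOn_cube hp hf) i)
      (memLp_indicator_idxPiece β M hf i) fun ξ hξ => mem_piece_of_indicator_ne_zero hξ).trans ?_
    · have := Finset.single_le_sum (fun j _ => hm j) (Finset.mem_univ a)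
      linarith [hm b]
    · gcongr
      · norm_num
      · have h1 : γ * ∑ n, (i.1 n : ℝ) ≤ ∑ n, (i.1 n : ℝ) * (gap p q - u n * β n / 2) := by
          rw [Finset.mul_sum]
          refine Finset.sum_le_sum fun n _ => ?_
          by_cases hn : β n = 2
          · simp [hi n hn]
          · rw [mul_comm]
            have := hγle n (by linarith [hstrict n hn])
            gcongr
        have h2 : γ / S * ∑ n, β n * i.1 n / 2 ≤ γ / 2 * ∑ n, (i.1 n : ℝ) := by
          rw [Finset.mul_sum, Finset.mul_sum]
          refine Finset.sum_le_sum fun n _ => ?_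
          have h3 : β n * i.1 n ≤ S * i.1 n := by
            have := hβS n
            gcongr
          calc γ / S * (β n * i.1 n / 2) ≤ γ / S * (S * i.1 n / 2) := by gcongr
            _ = γ / 2 * i.1 n := by field_simp
        linarith
      · exact eLpNorm_indicator_idxPiece_le β M p f i
  obtain ⟨A, hA, hAle⟩ := exists_tsum_idx_le (d := d) M (δ := γ / 4 * q.toReal) (by positivity)
    (a := fun _ => 1) fun _ => one_pos
  -- The decay γ/2 is halved: one part makes the q-th powers of the c_i summable, the other becomes
  -- off-diagonal decay, as |k - k'| ≤ k + k'.
  refine strongType_of_pairs hβ hp hq1 hq M (δ := γ / 4) (by positivity)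
    (C := C * A ^ q.toReal⁻¹) (ENNReal.mul_ne_top ENNReal.coe_ne_top
      (ENNReal.rpow_ne_top_of_nonneg (by positivity) hA)) fun f hf => ?_
  set nf := eLpNorm f p (volume.restrict (cube d)) with hnf
  refine ⟨fun i => C * ENNReal.ofReal (2 ^ (-(γ / 4 * ∑ n, (i.1 n : ℝ)))) * nf, ?_, fun i j => ?_⟩
  · have h1 : ∀ i : Idx d M, (C * ENNReal.ofReal (2 ^ (-(γ / 4 * ∑ n, (i.1 n : ℝ)))) * nf) ^
      q.toReal =
        (C * nf) ^ q.toReal * ENNReal.ofReal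
          (2 ^ (-(γ / 4 * q.toReal * ∑ n, |1 * (i.1 n : ℝ) - 0|))) := fun i => by
      rw [mul_right_comm, ENNReal.mul_rpow_of_nonneg _ _ hq0.le,
        ENNReal.ofReal_rpow_of_pos (by positivity), ← Real.rpow_mul (by norm_num)]
      congr 3
      simp only [one_mul, sub_zero, Nat.abs_cast]
      ring
    simp_rw [h1]
    rw [ENNReal.tsum_mul_left, mul_right_comm, ENNReal.mul_rpow_of_nonneg _ (A ^ _) hq0.le,
      ← ENNReal.rpow_mul, inv_mul_cancel₀ hq0.ne', ENNReal.rpow_one]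
    gcongr
    exact hAle fun _ => 0
  · refine ⟨q, q, hq1, hq, hq1, hq, by ring, ?_⟩
    refine (mul_le_mul' (hpiece f hf i) (hpiece f hf j)).trans ?_
    have h2 : ∑ n, |(i.1 n : ℝ) - j.1 n| ≤ ∑ n, (i.1 n : ℝ) + ∑ n, (j.1 n : ℝ) := by
      rw [← Finset.sum_add_distrib]
      refine Finset.sum_le_sum fun n _ => ?_
      rw [abs_le]
      have h3 : (0 : ℝ) ≤ i.1 n := Nat.cast_nonneg _
      have h4 : (0 : ℝ) ≤ j.1 n := Nat.cast_nonneg _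
      constructor <;> linarith
    set a := ∑ n, (i.1 n : ℝ)
    set b := ∑ n, (j.1 n : ℝ)
    have h5 : ∀ a : ℝ, ENNReal.ofReal (2 ^ (-(γ / 2 * a))) =
        ENNReal.ofReal (2 ^ (-(γ / 4 * a))) * ENNReal.ofReal (2 ^ (-(γ / 4 * a))) := fun a => by
      rw [← ENNReal.ofReal_mul (by positivity), ← Real.rpow_add (by norm_num)]
      congr 2
      ring
    have h6 : ENNReal.ofReal (2 ^ (-(γ / 4 * a))) * ENNReal.ofReal (2 ^ (-(γ / 4 * b))) ≤
        ENNReal.ofReal (2 ^ (-(γ / 4 * ∑ n, |(i.1 n : ℝ) - j.1 n|))) := by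
      rw [← ENNReal.ofReal_mul (by positivity), ← Real.rpow_add (by norm_num)]
      refine ENNReal.ofReal_le_ofReal (Real.rpow_le_rpow_of_exponent_le (by norm_num) ?_)
      nlinarith
    rw [h5 a, h5 b]
    calc _ = (ENNReal.ofReal (2 ^ (-(γ / 4 * a))) * ENNReal.ofReal (2 ^ (-(γ / 4 * b)))) *
          ((C * ENNReal.ofReal (2 ^ (-(γ / 4 * a))) * nf) *
            (C * ENNReal.ofReal (2 ^ (-(γ / 4 * b))) * nf)) := by ring
      _ ≤ _ := by gcongr

/-! ### The critical case -/

/-- The weights `min (2/β) 1`. -/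
noncomputable def critWeight (β : Fin d → ℝ) (i : Fin d) : ℝ := if 2 < β i then 2 / β i else 1

lemma critWeight_pos {β : Fin d → ℝ} (i : Fin d) : 0 < critWeight β i := by
  unfold critWeight
  split_ifs with h
  · have : 0 < β i := by linarith
    positivity
  · exact one_pos

lemma critWeight_le_one {β : Fin d → ℝ} (i : Fin d) : critWeight β i ≤ 1 := by
  unfold critWeight
  split_ifs with h
  · rw [div_le_one (by linarith)]
    exact h.le
  · exact le_rfl

lemma critWeight_lt_one {β : Fin d → ℝ} {i : Fin d} (h : 2 < β i) : critWeight β i < 1 := by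
  simp only [critWeight, h, if_true]
  rw [div_lt_one (by linarith)]
  exact h

/-- Bounds for the pieces, when the total weight `2/q` differs by `e` from that of the critical
weights. The excess may be put on any of the exponents `β_i > 2`. -/
lemma exists_piece_bound_excess [NeZero d] {p r : ℝ≥0∞} (hT : (p, r) ∈ T d) (hr : r ≠ ∞)
    (hc : RectConjecture d p r) {β : Fin d → ℝ} (hβ : ∀ i, 1 < β i) {e γ : ℝ}
    (hγ : ∀ j, β j < 2 → γ ≤ gap p r * (1 - β j / 2)) (hlt : (∃ i, β i ≤ 2) → p < r)
    (hsum : gap p r * ∑ i, critWeight β i - e = 2 * recip r)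
    (hadm : ∀ i, 2 < β i → 0 ≤ gap p r * critWeight β i - e ∧
      gap p r * critWeight β i - e ≤ cap p r)
    (hadm' : ∀ i, gap p r * critWeight β i ≤ cap p r) :
    ∃ M₀ : ℕ, ∀ M : ℕ, M₀ ≤ M → ∀ ε : ℝ, 0 < ε →
      ∃ C : ℝ≥0, ∀ (k : Fin d → ℕ) (σ : Fin d → ℤ) (D : ℝ), (∀ n, β n = 2 → k n = 0) →
        (∀ i j, 2 < β i → 2 < β j → β i * k i / 2 - β j * k j / 2 ≤ D) →
        ∀ f : EuclideanSpace ℝ (Fin d) → ℂ, Integrable f → MemLp f p →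
        (∀ ξ, f ξ ≠ 0 → ξ ∈ piece β M k σ) → ∀ i, 2 < β i →
        eLpNorm (oscInt (gBeta β) f) r volume ≤
          C * ENNReal.ofReal (2 ^ (-(e * (β i * k i / 2)) + ε * D -
            γ * ∑ j with ¬ 2 < β j, (k j : ℝ))) * eLpNorm f p volume := by
  obtain ⟨M₀, hM₀⟩ := exists_piece_bound hT hr hc hβ
  refine ⟨M₀, fun M hM ε hε => ?_⟩
  have hgap := gap_pos hT hr
  classical
  -- If some β_i ≤ 2, then p < r and no loss occurs. This matters because D controls only the levels
  -- with β_i > 2.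
  set ε' : ℝ := if ∃ i, β i ≤ 2 then 0 else ε with hε'
  have hε'0 : 0 ≤ ε' := by rw [hε']; split_ifs; exacts [le_rfl, hε.le]
  have hε'pos : r ≤ p → 0 < ε' := by
    intro h
    rw [hε', if_neg fun h' => (hlt h').not_ge h]
    exact hε
  -- Critical weights, corrected by e in the single coordinate i so that the total is 2/r.
  set u : Fin d → Fin d → ℝ := fun i j =>
    gap p r * critWeight β j - if j = i then e else 0 with hu
  have hex : ∀ i, ∃ C : ℝ≥0, 2 < β i → ∀ (k : Fin d → ℕ) (σ : Fin d → ℤ) (D : ℝ),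
        (∀ i j, β i * k i / 2 - β j * k j / 2 ≤ D) →
        ∀ f : EuclideanSpace ℝ (Fin d) → ℂ, Integrable f → MemLp f p →
        (∀ ξ, f ξ ≠ 0 → ξ ∈ piece β M k σ) →
        eLpNorm (oscInt (gBeta β) f) r volume ≤
          C * ENNReal.ofReal (2 ^ (-∑ j, k j * (gap p r - u i j * β j / 2) + ε' * D)) *
            eLpNorm f p volume := by
    intro i
    by_cases hi : 2 < β i
    · obtain ⟨C, hC⟩ := hM₀ M hM ε' hε'0 hε'pos (u i)
        (fun j => by
          simp only [hu]
          by_cases hj : j = i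
          · subst hj
            simpa using (hadm j hi).1
          · simpa [hj] using mul_nonneg hgap.le (critWeight_pos j).le)
        (fun j => by
          simp only [hu]
          by_cases hj : j = i
          · subst hj
            simpa using (hadm j hi).2
          · simpa [hj] using hadm' j)
        (by
          simp only [hu, Finset.sum_sub_distrib, ← Finset.mul_sum]
          rw [← hsum]
          simp)
      exact ⟨C, fun _ => hC⟩
    · exact ⟨0, fun h => (hi h).elim⟩
  choose C hC using hex
  refine ⟨∑ i, C i, fun k σ D hk hD f hf hfp hsupp i hi => ?_⟩
  have hD0 : 0 ≤ D := by simpa using hD i i hi hi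
  obtain ⟨D', hD', hεD⟩ : ∃ D' : ℝ, (∀ i j, β i * k i / 2 - β j * k j / 2 ≤ D') ∧
      ε' * D' ≤ ε * D := by
    by_cases h2 : ∃ i, β i ≤ 2
    · refine ⟨∑ i, ∑ j, |β i * k i / 2 - β j * k j / 2|, fun a b => ?_, ?_⟩
      · refine (le_abs_self _).trans ((Finset.single_le_sum (f := fun b =>
          |β a * k a / 2 - β b * k b / 2|) (fun _ _ => abs_nonneg _) (Finset.mem_univ b)).trans ?_)
        exact Finset.single_le_sum (f := fun a => ∑ b, |β a * k a / 2 - β b * k b / 2|)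
          (fun _ _ => Finset.sum_nonneg fun _ _ => abs_nonneg _) (Finset.mem_univ a)
      · rw [hε', if_pos h2, zero_mul]
        positivity
    · refine ⟨D, fun a b => ?_, by rw [hε', if_neg h2]⟩
      push Not at h2
      exact hD a b (h2 a) (h2 b)
  refine (hC i hi k σ D' hD' f hf hfp hsupp).trans ?_
  gcongr
  · exact Finset.single_le_sum (f := C) (fun _ _ => zero_le) (Finset.mem_univ i)
  · norm_num
  -- Coordinates with β_j > 2 contribute nothing except for the excess in i; those with β_j < 2 keep
  -- a decay of at least γ k_j, and k_j = 0 where β_j = 2.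
  · have h1 : e * (β i * k i / 2) + γ * ∑ j with ¬ 2 < β j, (k j : ℝ) ≤
        ∑ j, k j * (gap p r - u i j * β j / 2) := by
      have h2 : e * (β i * k i / 2) = ∑ j, if j = i then e * (β j * k j / 2) else 0 := by simp
      rw [h2, Finset.sum_filter, Finset.mul_sum, ← Finset.sum_add_distrib]
      refine Finset.sum_le_sum fun j _ => ?_
      have hkj : (0 : ℝ) ≤ k j := Nat.cast_nonneg _
      by_cases hj : 2 < β j
      · have hβj : β j ≠ 0 := by linarith
        have hw : critWeight β j = 2 / β j := by simp [critWeight, hj]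
        simp only [hu, hw, hj, not_true_eq_false, if_false, mul_zero, add_zero]
        by_cases hji : j = i
        · simp only [hji, if_true]
          rw [hji] at hβj
          refine le_of_eq ?_
          field_simp
          ring
        · simp only [hji, if_false, sub_zero]
          refine le_of_eq ?_
          field_simp
          ring
      · have hji : j ≠ i := fun h => hj (h ▸ hi)
        have hw : critWeight β j = 1 := by simp [critWeight, hj]
        simp only [hu, hw, hj, hji, not_false_eq_true, if_true, if_false, zero_add, sub_zero,
          mul_one]
        rcases eq_or_lt_of_le (not_lt.1 hj) with h | h
        · simp [hk j h]
        · have := mul_le_mul_of_nonneg_right (hγ j h) hkj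
          linarith
    linarith

/-! ### Exponents on both sides of the critical one. -/

lemma eventually_mul_lt (K : ℝ) {c : ℝ} (hc : 0 < c) :
    ∀ᶠ η in nhdsWithin (0 : ℝ) (Set.Ioi 0), η * K < c := by
  have h : Filter.Tendsto (fun η : ℝ => η * K) (nhds 0) (nhds (0 * K)) :=
    (continuous_id.mul continuous_const).tendsto 0
  rw [zero_mul] at h
  exact (h.mono_left nhdsWithin_le_nhds).eventually_lt_const hc

lemma recip_ofReal_inv {x : ℝ} (hx : 0 ≤ x) : recip (ENNReal.ofReal x⁻¹) = x := by
  rw [recip_eq_inv, ENNReal.toReal_ofReal (inv_nonneg.2 hx), inv_inv]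

lemma ofReal_recip_inv {q : ℝ≥0∞} (hq : q ≠ ∞) : ENNReal.ofReal (recip q)⁻¹ = q := by
  rw [recip_eq_inv, inv_inv, ENNReal.ofReal_toReal hq]

/-- Exponents close to `q` on which the conjecture is still available. -/
lemma eventually_mem_of_isOpen {p q : ℝ≥0∞} (hq1 : 1 ≤ q) (hq : q ≠ ∞)
    {U : Set (ℝ≥0∞ × ℝ≥0∞)} (hU : IsOpen U) (hmem : (p, q) ∈ U) (σ : ℝ) :
    ∀ᶠ η in nhdsWithin (0 : ℝ) (Set.Ioi 0), (p, ENNReal.ofReal (recip q + σ * η)⁻¹) ∈ U := by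
  have hQ := recip_pos hq1 hq
  have h1 : ContinuousAt (fun η : ℝ => (recip q + σ * η)⁻¹) 0 :=
    ContinuousAt.inv₀ (by fun_prop) (by simpa using hQ.ne')
  have h2 : ContinuousAt (fun η : ℝ => (p, ENNReal.ofReal (recip q + σ * η)⁻¹)) 0 :=
    continuousAt_const.prodMk (ENNReal.continuous_ofReal.continuousAt.comp h1)
  refine (h2.eventually_mem ?_).filter_mono nhdsWithin_le_nhds
  simpa [ofReal_recip_inv hq] using hU.mem_nhds hmem

lemma mem_T_ofReal_inv {p : ℝ≥0∞} (hp : 1 ≤ p) {x : ℝ} (hx : 0 < x)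
    (h1 : x < (d : ℝ) / (2 * ((d : ℝ) + 1))) (h2 : ((d : ℝ) + 2) / d * x ≤ 1 - recip p) :
    (p, ENNReal.ofReal x⁻¹) ∈ T d := by
  refine ⟨hp, ?_, by simpa only [recip_ofReal_inv hx.le] using h1,
    by simpa only [recip_ofReal_inv hx.le, recip'_eq hp] using h2⟩
  rw [← ENNReal.ofReal_one]
  refine ENNReal.ofReal_le_ofReal ((one_le_inv₀ hx).2 (h1.le.trans ?_))
  rw [div_le_one (by positivity)]
  linarith [(Nat.cast_nonneg d : (0 : ℝ) ≤ d)]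

lemma lt_of_recip_lt {p r : ℝ≥0∞} (hr : 1 ≤ r) (h : recip r < recip p) : p < r := by
  by_contra! h'
  exact (recip_le_recip hr h').not_gt h

/-- In the critical case the bounds for the pieces at exponents above and below `q` grow in
opposite ways. -/
lemma exists_critical_bounds [NeZero d] {p q : ℝ≥0∞} (hT : (p, q) ∈ T d) (hq : q ≠ ∞)
    {U : Set (ℝ≥0∞ × ℝ≥0∞)} (hU : IsOpen U) (hmem : (p, q) ∈ U)
    (hconj : ∀ r ∈ U ∩ T d, RectConjecture d r.1 r.2) {β : Fin d → ℝ} (hβ : ∀ i, 1 < β i)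
    (hne : ∃ i, 2 < β i) (hS : ∀ i, 2 < β i → gap p q * critWeight β i < cap p q)
    (hS' : (∃ i, β i ≤ 2) → p < q) (hsum : gap p q * ∑ i, critWeight β i = 2 * recip q) :
    ∃ (q₁ q₂ : ℝ≥0∞) (η e γ : ℝ) (M : ℕ) (C : ℝ≥0), 1 ≤ q₁ ∧ q₁ ≠ ∞ ∧ 1 ≤ q₂ ∧ q₂ ≠ ∞ ∧
      recip q₁ = recip q - η ∧ recip q₂ = recip q + η ∧ 0 < e ∧ 0 < γ ∧
      ∀ f : EuclideanSpace ℝ (Fin d) → ℂ, MemLp f p (volume.restrict (cube d)) →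
      ∀ i : Idx d M, (∀ n, β n = 2 → i.1 n = 0) → ∀ D : ℝ,
        (∀ a b, 2 < β a → 2 < β b → β a * i.1 a / 2 - β b * i.1 b / 2 ≤ D) → ∀ a, 2 < β a →
        eLpNorm (pieceExt β M f i) q₁ volume ≤
          C * ENNReal.ofReal (2 ^ (-(e * (β a * i.1 a / 2)) + e / 4 * D -
            γ * ∑ j with ¬ 2 < β j, (i.1 j : ℝ))) *
              eLpNorm ((idxPiece β M i).indicator f) p volume ∧
        eLpNorm (pieceExt β M f i) q₂ volume ≤
          C * ENNReal.ofReal (2 ^ (e * (β a * i.1 a / 2) + e / 4 * D -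
            γ * ∑ j with ¬ 2 < β j, (i.1 j : ℝ))) *
              eLpNorm ((idxPiece β M i).indicator f) p volume := by
  have hp : 1 ≤ p := hT.1
  have hq1 : 1 ≤ q := hT.2.1
  have hQ := recip_pos hq1 hq
  have hs := gap_pos hT hq
  have hd : (0 : ℝ) < d := by exact_mod_cast NeZero.pos d
  have hTQ : recip q < (d : ℝ) / (2 * ((d : ℝ) + 1)) := hT.2.2.1
  set s := gap p q with hsdef
  set Q := recip q with hQdef
  set W := ∑ i, critWeight β i with hW
  have hWpos : 0 < W := Finset.sum_pos (fun i _ => critWeight_pos i) Finset.univ_nonempty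
  have hWlt : W < d := by
    obtain ⟨i, hi⟩ := hne
    calc W < ∑ _i : Fin d, (1 : ℝ) := Finset.sum_lt_sum (fun i _ => critWeight_le_one i)
          ⟨i, Finset.mem_univ i, critWeight_lt_one hi⟩
      _ = d := by simp
  -- One β_i > 2 makes the total critical weight W less than d, so that q > ((d+2)/d) p' strictly.
  -- There is thus room inside `T` to lower q with p fixed.
  have hslack : ((d : ℝ) + 2) / d * Q < 1 - recip p := by
    have h1 : 2 * Q < s * d := by rw [← hsum]; exact mul_lt_mul_of_pos_left hWlt hs
    have h2 : 1 - recip p = s + Q := by rw [hsdef]; unfold gap; ring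
    rw [h2, div_mul_eq_mul_div, div_lt_iff₀ hd]
    linarith
  -- All requirements hold for small η: they are strict inequalities at η = 0, or membership in the
  -- open set U.
  have hex : ∃ η : ℝ, 0 < η ∧ η * 2 < Q ∧ η * 1 < (d : ℝ) / (2 * ((d : ℝ) + 1)) - Q ∧
      η * (((d : ℝ) + 2) / d) < 1 - recip p - ((d : ℝ) + 2) / d * Q ∧ η * 2 < s ∧
      (∀ i, 2 < β i → η * (2 + W) < s * critWeight β i) ∧
      (∀ i, 2 < β i → η * (4 + W) < cap p q - s * critWeight β i) ∧
      (p < q → η * 1 < recip p - Q) ∧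
      (p, ENNReal.ofReal (Q + -1 * η)⁻¹) ∈ U ∧ (p, ENNReal.ofReal (Q + 1 * η)⁻¹) ∈ U := by
    refine Filter.Eventually.exists (f := nhdsWithin (0 : ℝ) (Set.Ioi 0)) ?_
    refine (eventually_mem_nhdsWithin (a := (0 : ℝ)) (s := Set.Ioi 0)).and ?_
    refine (eventually_mul_lt _ hQ).and <| (eventually_mul_lt _ (sub_pos.2 hTQ)).and <|
      (eventually_mul_lt _ (sub_pos.2 hslack)).and <| (eventually_mul_lt _ hs).and <|
      (Filter.eventually_all.2 fun i => ?_).and <| (Filter.eventually_all.2 fun i => ?_).and <|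
      Filter.Eventually.and ?_ <| (eventually_mem_of_isOpen hq1 hq hU hmem _).and
        (eventually_mem_of_isOpen hq1 hq hU hmem _)
    · have := critWeight_pos (β := β) i
      exact (eventually_mul_lt _ (by positivity)).mono fun η h _ => h
    · by_cases hi : 2 < β i
      · exact (eventually_mul_lt _ (sub_pos.2 (hS i hi))).mono fun η h _ => h
      · exact Filter.Eventually.of_forall fun η h => absurd h hi
    · by_cases hi : p < q
      · exact (eventually_mul_lt _ (sub_pos.2 (recip_lt_recip hp hi))).mono fun η h _ => h
      · exact Filter.Eventually.of_forall fun η h => absurd h hi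
  obtain ⟨η, hη0, hη1, hη2, hη3, hη4, hη5, hη6, hη7, hU₁, hU₂⟩ := hex
  have e1 : Q + -1 * η = Q - η := by ring
  rw [e1] at hU₁
  rw [one_mul] at hU₂
  have hdd : 0 ≤ ((d : ℝ) + 2) / d := by positivity
  have hT₁ : (p, ENNReal.ofReal (Q - η)⁻¹) ∈ T d :=
    mem_T_ofReal_inv hp (by linarith) (by linarith) (by nlinarith)
  have hT₂ : (p, ENNReal.ofReal (Q + η)⁻¹) ∈ T d :=
    mem_T_ofReal_inv hp (by linarith) (by linarith) (by linarith)
  have hr₁ : recip (ENNReal.ofReal (Q - η)⁻¹) = Q - η := recip_ofReal_inv (by linarith)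
  have hr₂ : recip (ENNReal.ofReal (Q + η)⁻¹) = Q + η := recip_ofReal_inv (by linarith)
  have hc₁ := hconj _ ⟨hU₁, hT₁⟩
  have hc₂ := hconj _ ⟨hU₂, hT₂⟩
  simp only at hc₁ hc₂
  have ht₁ : ENNReal.ofReal (Q - η)⁻¹ ≠ ∞ := ENNReal.ofReal_ne_top
  have ht₂ : ENNReal.ofReal (Q + η)⁻¹ ≠ ∞ := ENNReal.ofReal_ne_top
  generalize ENNReal.ofReal (Q - η)⁻¹ = q₁ at *
  generalize ENNReal.ofReal (Q + η)⁻¹ = q₂ at *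
  have hg₁ : gap p q₁ = s + η := by rw [hsdef]; unfold gap; rw [hr₁]; ring
  have hg₂ : gap p q₂ = s - η := by rw [hsdef]; unfold gap; rw [hr₂]; ring
  have hcs : cap p q ≤ s := min_le_left _ _
  have hcQ : cap p q ≤ 1 - 2 * Q := min_le_right _ _
  have hcap₁ : ∀ y, y ≤ cap p q → y ≤ cap p q₁ := fun y hy => by
    unfold cap
    rw [hg₁, hr₁]
    exact le_min (by linarith) (by linarith)
  have hcap₂ : ∀ y, y ≤ cap p q - 2 * η → y ≤ cap p q₂ := fun y hy => by
    unfold cap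
    rw [hg₂, hr₂]
    exact le_min (by linarith) (by linarith)
  have hw : ∀ i, ¬ 2 < β i → critWeight β i = 1 := fun i hi => if_neg hi
  have hlow : (∃ i, β i ≤ 2) → η < recip p - Q := fun h => by simpa using hη7 (hS' h)
  have hsQ : s = 1 - recip p - Q := rfl
  -- Both shifted gaps s ± η exceed s/2, so this rate serves for both exponents.
  obtain ⟨γ, hγ, hγle⟩ := exists_pos_forall_le fun j => s / 2 * (1 - β j / 2)
  have hγ' : ∀ j, β j < 2 → γ ≤ s / 2 * (1 - β j / 2) := fun j hj =>
    hγle j (mul_pos (by linarith) (by linarith))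
  have hprod : ∀ i, 0 ≤ η * critWeight β i ∧ η * critWeight β i ≤ η := fun i =>
    ⟨mul_nonneg hη0.le (critWeight_pos i).le, by
      simpa using mul_le_mul_of_nonneg_left (critWeight_le_one (β := β) i) hη0.le⟩
  have hηW : 0 < η * W := mul_pos hη0 hWpos
  -- At 1/q₁ = Q - η the gap is s + η. The critical weights then have total (s + η)W = 2Q + ηW,
  -- which exceeds 2(Q - η) by e = η(2 + W). At q₂ the same computation gives -e.
  obtain ⟨M₁, hM₁⟩ := exists_piece_bound_excess hT₁ ht₁ hc₁ hβ (e := η * (2 + W)) (γ := γ)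
    (fun j hj => (hγ' j hj).trans (by
      rw [hg₁]; exact mul_le_mul_of_nonneg_right (by linarith) (by linarith)))
    (fun h => lt_of_recip_lt hT₁.2.1 (by rw [hr₁]; linarith [hlow h]))
    (by rw [hg₁, hr₁]; linear_combination hsum)
    (fun i hi => by
      have h1 := hη5 i hi
      have h2 := hη6 i hi
      have h3 := hprod i
      rw [hg₁]
      exact ⟨by nlinarith, hcap₁ _ (by nlinarith)⟩)
    (fun i => by
      by_cases hi : 2 < β i
      · have h2 := hη6 i hi
        have h3 := hprod i
        rw [hg₁]
        exact hcap₁ _ (by nlinarith)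
      · rw [hw i hi, mul_one]
        unfold cap
        rw [hg₁, hr₁]
        have := hlow ⟨i, not_lt.1 hi⟩
        exact le_min le_rfl (by linarith))
  obtain ⟨M₂, hM₂⟩ := exists_piece_bound_excess hT₂ ht₂ hc₂ hβ (e := -(η * (2 + W))) (γ := γ)
    (fun j hj => (hγ' j hj).trans (by
      rw [hg₂]; exact mul_le_mul_of_nonneg_right (by linarith) (by linarith)))
    (fun h => lt_of_recip_lt hT₂.2.1 (by rw [hr₂]; linarith [hlow h]))
    (by rw [hg₂, hr₂]; linear_combination hsum)
    (fun i hi => by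
      have h1 := hη5 i hi
      have h2 := hη6 i hi
      have h3 := hprod i
      rw [hg₂]
      exact ⟨by nlinarith, hcap₂ _ (by nlinarith)⟩)
    (fun i => by
      by_cases hi : 2 < β i
      · have h2 := hη6 i hi
        have h3 := hprod i
        rw [hg₂]
        exact hcap₂ _ (by nlinarith)
      · rw [hw i hi, mul_one]
        unfold cap
        rw [hg₂, hr₂]
        have := hlow ⟨i, not_lt.1 hi⟩
        exact le_min le_rfl (by linarith))
  have he : 0 < η * (2 + W) := by positivity
  obtain ⟨C₁, hC₁⟩ := hM₁ (max M₁ M₂) (le_max_left _ _) (η * (2 + W) / 4) (by positivity)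
  obtain ⟨C₂, hC₂⟩ := hM₂ (max M₁ M₂) (le_max_right _ _) (η * (2 + W) / 4) (by positivity)
  refine ⟨q₁, q₂, η, η * (2 + W), γ, max M₁ M₂, max C₁ C₂, hT₁.2.1, ht₁, hT₂.2.1, ht₂, hr₁, hr₂,
    he, hγ, fun f hf i hi D hD a ha => ⟨?_, ?_⟩⟩
  · refine (hC₁ i.1 (fun j => i.2 j) D hi hD _
      (integrable_indicator_idxPiece β _ (integrableOn_cube hp hf) i)
      (memLp_indicator_idxPiece β _ hf i) (fun ξ hξ => mem_piece_of_indicator_ne_zero hξ)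
      a ha).trans ?_
    gcongr
    exact le_max_left _ _
  · refine (hC₂ i.1 (fun j => i.2 j) D hi hD _
      (integrable_indicator_idxPiece β _ (integrableOn_cube hp hf) i)
      (memLp_indicator_idxPiece β _ hf i) (fun ξ hξ => mem_piece_of_indicator_ne_zero hξ)
      a ha).trans ?_
    rw [neg_mul, neg_neg]
    gcongr
    exact le_max_right _ _

/-- Strong type bounds in the critical case. -/
theorem strongType_of_critical [NeZero d] {p q : ℝ≥0∞} (hT : (p, q) ∈ T d) (hq : q ≠ ∞)
    {U : Set (ℝ≥0∞ × ℝ≥0∞)} (hU : IsOpen U) (hmem : (p, q) ∈ U)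
    (hconj : ∀ r ∈ U ∩ T d, RectConjecture d r.1 r.2) {β : Fin d → ℝ} (hβ : ∀ i, 1 < β i)
    (hne : ∃ i, 2 < β i) (hS : ∀ i, 2 < β i → gap p q * critWeight β i < cap p q)
    (hS' : (∃ i, β i ≤ 2) → p < q) (hsum : gap p q * ∑ i, critWeight β i = 2 * recip q)
    (hpq : p ≤ q) : StrongType β p q := by
  have hp : 1 ≤ p := hT.1
  have hq1 : 1 ≤ q := hT.2.1
  have hpt : p ≠ ∞ := (hpq.trans_lt hq.lt_top).ne
  have hp0 := toReal_pos_of_one_le hp hpt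
  have hq0 := toReal_pos_of_one_le hq1 hq
  have hd : (0 : ℝ) < d := by exact_mod_cast NeZero.pos d
  obtain ⟨q₁, q₂, η, e, γ, M, C, hq₁1, hq₁, hq₂1, hq₂, hr₁, hr₂, he, hγ, hb⟩ :=
    exists_critical_bounds hT hq hU hmem hconj hβ hne hS hS' hsum
  have hδ : 0 < min (e / (2 * d)) γ := lt_min (by positivity) hγ
  refine strongType_of_pairs hβ hp hq1 hq M hδ (C := C) ENNReal.coe_ne_top fun f hf =>
    ⟨fun i => C * eLpNorm ((idxPiece β M i).indicator f) p volume, ?_, fun i j => ?_⟩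
  · simp_rw [ENNReal.mul_rpow_of_nonneg _ _ hq0.le]
    rw [ENNReal.tsum_mul_left]
    gcongr
    -- The disjoint pieces of f add up in ℓ^p, and p ≤ q passes to ℓ^q.
    refine (tsum_rpow_le_rpow_tsum _ hp0 (ENNReal.toReal_mono hq hpq)).trans ?_
    refine (ENNReal.rpow_le_rpow (tsum_eLpNorm_indicator_rpow_le β M
      (zero_lt_one.trans_le hp).ne' hpt f) (by positivity)).trans ?_
    rw [← ENNReal.rpow_mul, mul_div_cancel₀ _ hp0.ne']
  set δ := min (e / (2 * d)) γ with hδdef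
  have hδe : δ * d ≤ e / 2 := by
    calc δ * d ≤ e / (2 * d) * d := by gcongr; exact min_le_left _ _
      _ = e / 2 := by field_simp
  by_cases hi : ∀ n, β n = 2 → i.1 n = 0
  swap
  -- An index with a positive level where β_n = 2 belongs to an empty piece, so any pair of
  -- exponents will do.
  · refine ⟨q, q, hq1, hq, hq1, hq, by ring, ?_⟩
    rw [pieceExt_eq_zero f hi]
    simp
  by_cases hj : ∀ n, β n = 2 → j.1 n = 0
  swap
  · refine ⟨q, q, hq1, hq, hq1, hq, by ring, ?_⟩
    rw [pieceExt_eq_zero f hj]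
    simp
  have hSne : (Finset.univ.filter fun n => 2 < β n).Nonempty := by
    obtain ⟨n, hn⟩ := hne
    exact ⟨n, by simpa using hn⟩
  have hext : ∀ i : Idx d M, ∃ a b, 2 < β a ∧ 2 < β b ∧ ∀ n, 2 < β n →
      β n * i.1 n / 2 ≤ β a * i.1 a / 2 ∧ β b * i.1 b / 2 ≤ β n * i.1 n / 2 := fun i => by
    obtain ⟨a, ha, ha'⟩ := Finset.exists_max_image _ (fun n => β n * i.1 n / 2) hSne
    obtain ⟨b, hb, hb'⟩ := Finset.exists_min_image _ (fun n => β n * i.1 n / 2) hSne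
    simp only [Finset.mem_filter, Finset.mem_univ, true_and] at ha ha' hb hb'
    exact ⟨a, b, ha, hb, fun n hn => ⟨ha' n hn, hb' n hn⟩⟩
  obtain ⟨a, b, ha, hb1, hab⟩ := hext i
  obtain ⟨a', b', ha1', hb1', hab'⟩ := hext j
  set mi : Fin d → ℝ := fun n => β n * i.1 n / 2 with hmi
  set mj : Fin d → ℝ := fun n => β n * j.1 n / 2 with hmj
  set Yi := ∑ n with ¬ 2 < β n, (i.1 n : ℝ) with hYi
  set Yj := ∑ n with ¬ 2 < β n, (j.1 n : ℝ) with hYj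
  have hDi := fun n n' (hn : 2 < β n) (hn' : 2 < β n') =>
    sub_le_sub (hab n hn).1 (hab n' hn').2
  have hDj := fun n n' (hn : 2 < β n) (hn' : 2 < β n') =>
    sub_le_sub (hab' n hn).1 (hab' n' hn').2
  have hi' := hb f hf i hi _ hDi
  have hj' := hb f hf j hj _ hDj
  have hsumle : ∀ L : ℝ, (∀ n, 2 < β n → |mi n - mj n| ≤ L) →
      δ * ∑ n, |(i.1 n : ℝ) - j.1 n| ≤ e / 2 * L + γ * (Yi + Yj) := by
    intro L hL
    have hL0 : 0 ≤ L := (abs_nonneg _).trans (hL a ha)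
    rw [← Finset.sum_filter_add_sum_filter_not Finset.univ (fun n => 2 < β n), mul_add]
    have h1 : ∑ n with 2 < β n, |(i.1 n : ℝ) - j.1 n| ≤ d * L := by
      calc ∑ n with 2 < β n, |(i.1 n : ℝ) - j.1 n| ≤ ∑ n with 2 < β n, L := by
            refine Finset.sum_le_sum fun n hn => ?_
            simp only [Finset.mem_filter, Finset.mem_univ, true_and] at hn
            refine le_trans ?_ (hL n hn)
            have : mi n - mj n = β n / 2 * ((i.1 n : ℝ) - j.1 n) := by
              simp only [hmi, hmj]; ring
            rw [this, abs_mul]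
            refine le_mul_of_one_le_left (abs_nonneg _) (le_trans ?_ (le_abs_self _))
            linarith
        _ ≤ ∑ n : Fin d, L := Finset.sum_le_sum_of_subset_of_nonneg (Finset.filter_subset _ _)
            fun _ _ _ => hL0
        _ = d * L := by simp
    have h2 : ∑ n with ¬ 2 < β n, |(i.1 n : ℝ) - j.1 n| ≤ Yi + Yj := by
      rw [hYi, hYj, ← Finset.sum_add_distrib]
      refine Finset.sum_le_sum fun n _ => ?_
      have h3 : (0 : ℝ) ≤ i.1 n := Nat.cast_nonneg _
      have h4 : (0 : ℝ) ≤ j.1 n := Nat.cast_nonneg _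
      rw [abs_le]
      constructor <;> linarith
    have hY : 0 ≤ Yi + Yj := by positivity
    calc _ ≤ δ * (d * L) + δ * (Yi + Yj) := by gcongr
      _ ≤ e / 2 * L + γ * (Yi + Yj) := by
        rw [← mul_assoc]
        gcongr
        exact min_le_right _ _
  have hfin : ∀ {F G x y : ℝ≥0∞} {u v w : ℝ}, u + v ≤ w → F ≤ C * ENNReal.ofReal (2 ^ u) * x →
      G ≤ C * ENNReal.ofReal (2 ^ v) * y → F * G ≤ ENNReal.ofReal (2 ^ w) * (C * x * (C * y)) := by
    intro F G x y u v w huv hF hG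
    calc F * G ≤ C * ENNReal.ofReal (2 ^ u) * x * (C * ENNReal.ofReal (2 ^ v) * y) :=
          mul_le_mul' hF hG
      _ = ENNReal.ofReal (2 ^ u) * ENNReal.ofReal (2 ^ v) * (C * x * (C * y)) := by ring
      _ = ENNReal.ofReal (2 ^ (u + v)) * (C * x * (C * y)) := by
        rw [← ENNReal.ofReal_mul (by positivity), ← Real.rpow_add (by norm_num)]
      _ ≤ _ := by
        gcongr
        norm_num
  -- Let L be the larger of max m_i - min m_j and max m_j - min m_i, extremes over β_n > 2. It
  -- bounds every |m_i - m_j|. Taking the growing bound at the minimum and the decaying one at the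
  -- maximum gains eL. The two eccentricities sum to at most 2L and cost (e/4)·2L, so eL/2 remains.
  rcases le_total (mj a' - mi b) (mi a - mj b') with h | h
  · refine ⟨q₁, q₂, hq₁1, hq₁, hq₂1, hq₂, by rw [hr₁, hr₂]; ring,
      hfin ?_ (hi' a ha).1 (hj' b' hb1').2⟩
    have h1 := hsumle (mi a - mj b') fun n hn => by
      have := hab n hn
      have := hab' n hn
      rw [abs_le]
      constructor <;> simp only [hmi, hmj] at * <;> linarith
    have h2 : e * ((mi a - mi b) + (mj a' - mj b')) ≤ e * (2 * (mi a - mj b')) := by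
      gcongr; linarith
    simp only [hmi, hmj] at *
    linarith
  · refine ⟨q₂, q₁, hq₂1, hq₂, hq₁1, hq₁, by rw [hr₁, hr₂]; ring,
      hfin ?_ (hi' b hb1).2 (hj' a' ha1').1⟩
    have h1 := hsumle (mj a' - mi b) fun n hn => by
      have := hab n hn
      have := hab' n hn
      rw [abs_le]
      constructor <;> simp only [hmi, hmj] at * <;> linarith
    have h2 : e * ((mi a - mi b) + (mj a' - mj b')) ≤ e * (2 * (mj a' - mi b)) := by
      gcongr; linarith
    simp only [hmi, hmj] at *
    linarith

/-- Restricted weak type bounds in the critical case. -/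
theorem restrictedWeakType_of_critical [NeZero d] {p q : ℝ≥0∞} (hT : (p, q) ∈ T d) (hq : q ≠ ∞)
    {U : Set (ℝ≥0∞ × ℝ≥0∞)} (hU : IsOpen U) (hmem : (p, q) ∈ U)
    (hconj : ∀ r ∈ U ∩ T d, RectConjecture d r.1 r.2) {β : Fin d → ℝ}
    (hβ : ∀ i, 2 < β i) (hS : ∀ i, gap p q * critWeight β i < cap p q)
    (hsum : gap p q * ∑ i, critWeight β i = 2 * recip q) : RestrictedWeakType β p q := by
  have hβ1 : ∀ i, 1 < β i := fun i => one_lt_two.trans (hβ i)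
  have hd : (0 : ℝ) < d := by exact_mod_cast NeZero.pos d
  obtain ⟨q₁, q₂, η, e, γ, M, C, hq₁1, hq₁, hq₂1, hq₂, hr₁, hr₂, he, hγ, hb⟩ :=
    exists_critical_bounds hT hq hU hmem hconj hβ1 ⟨0, hβ 0⟩ (fun i _ => hS i)
      (fun ⟨i, hi⟩ => absurd (hβ i) hi.not_gt) hsum
  refine restrictedWeakType_of_pieces hβ1 hT.1 hT.2.1 hq₁1 hq₁ hq₂1 hq₂ hr₁ hr₂ M he
    (δ := e / (2 * d)) (by positivity) (C := C) fun f hf i x => ?_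
  obtain ⟨a, -, ha⟩ := Finset.exists_max_image Finset.univ (fun n => β n * i.1 n / 2)
    Finset.univ_nonempty
  obtain ⟨b, -, hb'⟩ := Finset.exists_min_image Finset.univ (fun n => β n * i.1 n / 2)
    Finset.univ_nonempty
  simp only [Finset.mem_univ, true_implies] at ha hb'
  have hpc := hb f hf i (fun n hn => absurd (hβ n) (by rw [hn]; exact lt_irrefl _)) _
    fun n n' _ _ => sub_le_sub (ha n) (hb' n')
  simp only [hβ, not_true_eq_false, Finset.filter_false, Finset.sum_empty, mul_zero, sub_zero,
    true_implies] at hpc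
  set A := β a * i.1 a / 2
  set B := β b * i.1 b / 2
  have hL : ∀ L : ℝ, (∀ n, |β n / 2 * i.1 n - x| ≤ L) →
      e / (2 * d) * ∑ n, |β n / 2 * i.1 n - x| ≤ e / 2 * L := by
    intro L hL
    calc e / (2 * d) * ∑ n, |β n / 2 * i.1 n - x| ≤ e / (2 * d) * ∑ _n : Fin d, L := by
          gcongr with n
          exact hL n
      _ = e / 2 * L := by
        simp only [Finset.sum_const, Finset.card_univ, Fintype.card_fin, nsmul_eq_mul]
        field_simp
  have hsp := eLpNorm_indicator_idxPiece_le β M p f i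
  -- The extreme level farther from x, at distance L, decides: the maximum A with q₁ or the minimum
  -- B with q₂. The gain is eL and the loss (e/4)(A - B) ≤ eL/2, while every level lies within L of
  -- x.
  rcases le_total (x - B) (A - x) with h | h
  · refine ⟨e * x - e * A + e / 4 * (A - B), ?_, .inl ?_⟩
    · have h1 := hL (A - x) fun n => by
        have := ha n
        have := hb' n
        rw [abs_le]
        constructor <;> linarith
      have h2 : e * (A - B) ≤ e * (2 * (A - x)) := by gcongr; linarith
      linarith
    · refine (hpc a).1.trans ?_
      have : -(e * A) + e / 4 * (A - B) = e * x - e * A + e / 4 * (A - B) - e * x := by ring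
      rw [this]
      gcongr
  · refine ⟨e * B - e * x + e / 4 * (A - B), ?_, .inr ?_⟩
    · have h1 := hL (x - B) fun n => by
        have := ha n
        have := hb' n
        rw [abs_le]
        constructor <;> linarith
      have h2 : e * (A - B) ≤ e * (2 * (x - B)) := by gcongr; linarith
      linarith
    · refine (hpc b).2.trans ?_
      have : e * B + e / 4 * (A - B) = e * B - e * x + e / 4 * (A - B) + e * x := by ring
      rw [this]
      gcongr

/-! ### Partial heights and the cases of the theorem -/

lemma exists_iff_val_lt (P : Fin d → Prop) (hP : ∀ i j, i ≤ j → P j → P i) :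
    ∃ n ≤ d, ∀ i, P i ↔ (i : ℕ) < n := by
  classical
  have h : ∃ n, ∀ h : n < d, ¬ P ⟨n, h⟩ := ⟨d, fun h => absurd h (lt_irrefl d)⟩
  refine ⟨Nat.find h, Nat.find_min' h fun h => absurd h (lt_irrefl d),
    fun i => ⟨fun hi => ?_, fun hi => ?_⟩⟩
  · by_contra! hle
    exact Nat.find_spec h (hle.trans_lt i.2) (hP _ i hle hi)
  · have := Nat.find_min h hi
    push Not at this
    exact this.2

/-- The sum of the minima of `x/β_i` and `c` in terms of the partial heights. -/
lemma exists_sum_min_eq {β : Fin d → ℝ} (hβ : ∀ i, 0 < β i) (hanti : Antitone β) {x : ℝ}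
    (hx : 0 ≤ x) (c : ℝ) :
    ∃ n ≤ d, ∑ i, min (x / β i) c = x * J β n + ((d : ℝ) - n) * c := by
  -- As β decreases, the coordinates where x/β_i is the strict minimum form an initial segment, and
  -- n is its length.
  obtain ⟨n, hn, hP⟩ := exists_iff_val_lt (fun i => x / β i < c) fun i j hij hj =>
    (div_le_div_of_nonneg_left hx (hβ j) (hanti hij)).trans_lt hj
  refine ⟨n, hn, ?_⟩
  rw [← Finset.sum_filter_add_sum_filter_not Finset.univ (fun i : Fin d => (i : ℕ) < n)]
  congr 1
  · rw [J, Finset.mul_sum]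
    refine Finset.sum_congr rfl fun i hi => ?_
    simp only [Finset.mem_filter, Finset.mem_univ, true_and] at hi
    rw [min_eq_left ((hP i).2 hi).le, mul_one_div]
  · have h1 : ∀ i ∈ Finset.univ.filter (fun i : Fin d => ¬ (i : ℕ) < n), min (x / β i) c = c :=
      fun i hi => by
        simp only [Finset.mem_filter, Finset.mem_univ, true_and] at hi
        exact min_eq_right (not_lt.1 (mt (hP i).1 hi))
    have h2 := Finset.card_filter_add_card_filter_not (s := (Finset.univ : Finset (Fin d)))
      (fun i : Fin d => (i : ℕ) < n)
    rw [Fin.card_filter_val_lt, min_eq_right hn, Finset.card_univ, Fintype.card_fin] at h2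
    rw [Finset.sum_congr rfl h1, Finset.sum_const, nsmul_eq_mul, ← h2]
    rw [Nat.cast_add, add_sub_cancel_left]
    congr!

lemma critWeight_eq_min {β : Fin d → ℝ} (hβ : ∀ i, 0 < β i) (i : Fin d) :
    critWeight β i = min (2 / β i) 1 := by
  unfold critWeight
  split_ifs with h
  · rw [min_eq_left]
    rw [div_le_one (hβ i)]
    exact h.le
  · rw [min_eq_right]
    rw [one_le_div (hβ i)]
    exact not_lt.1 h

lemma J_last (β : Fin d → ℝ) : J β d = ∑ i, 1 / β i := by
  simp [J]

lemma J_pred_add [NeZero d] (β : Fin d → ℝ) : J β (d - 1) + 1 / β ⊤ = J β d := by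
  rw [J_last, ← Finset.sum_erase_add _ _ (Finset.mem_univ (⊤ : Fin d)), J]
  congr 2
  ext i
  have hd := NeZero.pos d
  have htop : ((⊤ : Fin d) : ℕ) = d - 1 := by simp
  simp only [Finset.mem_filter, Finset.mem_univ, true_and, Finset.mem_erase, and_true, ne_eq,
    Fin.ext_iff, htop]
  have := i.2
  omega

/-- Strong type bounds, if the weights `min (2 gap / β_i) c` have total weight above `2/q`. -/
theorem strongType_of_scaled [NeZero d] {p q : ℝ≥0∞} (hT : (p, q) ∈ T d) (hq : q ≠ ∞)
    (hc : RectConjecture d p q) {β : Fin d → ℝ} (hβ : ∀ i, 1 < β i) {c : ℝ} (hc0 : 0 ≤ c)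
    (hcap : c ≤ cap p q)
    (hsum : 2 * recip q < ∑ i, min (2 * gap p q / β i) c) : StrongType β p q := by
  have hs := gap_pos hT hq
  have hQ := recip_pos hT.2.1 hq
  set S := ∑ i, min (2 * gap p q / β i) c with hS
  have hS0 : 0 < S := by linarith
  -- Scaling the weights by this factor makes their total exactly 2/q; as it is less than 1, u_i β_i
  -- < 2 gap becomes strict.
  have hτ : 2 * recip q / S < 1 := (div_lt_one hS0).2 hsum
  have hτ0 : 0 < 2 * recip q / S := by positivity
  have hm : ∀ i, 0 ≤ min (2 * gap p q / β i) c := fun i =>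
    le_min (div_nonneg (by linarith) (by linarith [hβ i])) hc0
  refine strongType_of_strict hT hq hc hβ
    (u := fun i => 2 * recip q / S * min (2 * gap p q / β i) c)
    (fun i => mul_nonneg hτ0.le (hm i)) (fun i => ?_) ?_ fun i _ => ?_
  · exact (mul_le_of_le_one_left (hm i) hτ.le).trans ((min_le_right _ _).trans hcap)
  · rw [← Finset.mul_sum, ← hS, div_mul_cancel₀ _ hS0.ne']
  · have hβ0 : 0 < β i := by linarith [hβ i]
    calc 2 * recip q / S * min (2 * gap p q / β i) c * β i
        ≤ 2 * recip q / S * (2 * gap p q / β i) * β i := by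
          gcongr; exact min_le_left _ _
      _ = 2 * recip q / S * (2 * gap p q) := by field_simp
      _ < 2 * gap p q := mul_lt_of_lt_one_left (by linarith) hτ

/-! ### The conditions of the theorem in terms of weights. -/

lemma recip_lt_half [NeZero d] {p q : ℝ≥0∞} (hT : (p, q) ∈ T d) : recip q < 1 / 2 := by
  refine hT.2.2.1.trans ?_
  have hd : (0 : ℝ) ≤ d := Nat.cast_nonneg d
  rw [div_lt_div_iff₀ (by positivity) (by norm_num)]
  linarith

lemma cap_eq_of_le {p q : ℝ≥0∞} (hq : 1 ≤ q) (h : q ≤ p) : cap p q = 1 - 2 * recip q := by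
  have := recip_le_recip hq h
  refine min_eq_right ?_
  unfold gap
  linarith

lemma cap_eq_of_lt {p q : ℝ≥0∞} (hp : 1 ≤ p) (h : p < q) : cap p q = gap p q := by
  have := recip_lt_recip hp h
  refine min_eq_left ?_
  unfold gap
  linarith

/-- Here p < q and the cap is the gap, so the condition at the relevant n says that the critical
weights have total at least 2/q. With strict inequality they can be scaled down; with equality the
case is critical, unless no β_i exceeds 2. -/
theorem strongType_of_condI [NeZero d] {p q : ℝ≥0∞} (hT : (p, q) ∈ T d) (hq : q ≠ ∞)
    {U : Set (ℝ≥0∞ × ℝ≥0∞)} (hU : IsOpen U) (hmem : (p, q) ∈ U)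
    (hconj : ∀ r ∈ U ∩ T d, RectConjecture d r.1 r.2) {β : Fin d → ℝ} (hβ : ∀ i, 1 < β i)
    (hanti : Antitone β) (h : CondI β p q) : StrongType β p q := by
  obtain ⟨hpq, hn⟩ := h
  have hs := gap_pos hT hq
  have hc : RectConjecture d p q := hconj (p, q) ⟨hmem, hT⟩
  have hcap := cap_eq_of_lt hT.1 hpq
  have hβ0 : ∀ i, 0 < β i := fun i => one_pos.trans (hβ i)
  obtain ⟨n, hnd, hsum⟩ := exists_sum_min_eq hβ0 hanti zero_le_two (1 : ℝ)
  simp_rw [← critWeight_eq_min hβ0, mul_one] at hsum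
  have hW : 0 < ∑ i, critWeight β i :=
    Finset.sum_pos (fun i _ => critWeight_pos i) Finset.univ_nonempty
  have hle : 2 * recip q ≤ gap p q * ∑ i, critWeight β i := by
    have h1 := hn n hnd
    have h2 : J β n + ((d : ℝ) - n) / 2 = (∑ i, critWeight β i) / 2 := by rw [hsum]; ring
    rw [h2, recip'_eq hT.1] at h1
    have h3 : 2 * recip q / ∑ i, critWeight β i ≤ gap p q := by
      unfold gap
      have : 1 / ((∑ i, critWeight β i) / 2) * recip q = 2 * recip q / ∑ i, critWeight β i := by
        field_simp
      linarith
    rwa [div_le_iff₀ hW] at h3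
  have hmin : ∀ i, min (2 * gap p q / β i) (gap p q) = gap p q * critWeight β i := fun i => by
    rw [critWeight_eq_min hβ0, mul_min_of_nonneg _ _ hs.le, mul_one]
    congr 1
    ring
  rcases hle.lt_or_eq with hlt | heq
  · refine strongType_of_scaled hT hq hc hβ hs.le hcap.ge ?_
    simp_rw [hmin, ← Finset.mul_sum]
    exact hlt
  by_cases hne : ∃ i, 2 < β i
  · refine strongType_of_critical hT hq hU hmem hconj hβ hne (fun i hi => ?_) (fun _ => hpq)
      heq.symm hpq.le
    rw [hcap]
    exact mul_lt_of_lt_one_right hs (critWeight_lt_one hi)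
  -- Every critical weight is then the full gap, and coordinates with β_i < 2 decay while those with
  -- β_i = 2 have no levels.
  · push Not at hne
    refine strongType_of_strict hT hq hc hβ (u := fun _ => gap p q) (fun _ => hs.le)
      (fun _ => hcap.ge) ?_ fun i hi => ?_
    · rw [heq, Finset.mul_sum]
      exact Finset.sum_congr rfl fun i _ => by rw [critWeight, if_neg (hne i).not_gt, mul_one]
    · have : β i < 2 := lt_of_le_of_ne (hne i) hi
      nlinarith

/-- With the cap 1 - 2/q, the strict inequality at n says exactly that 2/q < 2 gap · J_n + (d - n)(1
- 2/q). -/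
theorem strongType_of_condII [NeZero d] {p q : ℝ≥0∞} (hT : (p, q) ∈ T d) (hq : q ≠ ∞)
    (hc : RectConjecture d p q) {β : Fin d → ℝ} (hβ : ∀ i, 1 < β i)
    (hanti : Antitone β) (h : CondII β p q) : StrongType β p q := by
  obtain ⟨hpq, hn⟩ := h
  have hs := gap_pos hT hq
  have hcap := cap_eq_of_le hT.2.1 hpq
  have hhalf := recip_lt_half hT
  obtain ⟨n, hnd, hsum⟩ := exists_sum_min_eq (fun i => one_pos.trans (hβ i)) hanti
    (mul_nonneg zero_le_two hs.le) (1 - 2 * recip q)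
  refine strongType_of_scaled hT hq hc hβ (c := 1 - 2 * recip q) (by linarith) hcap.ge ?_
  rw [hsum]
  have h1 := hn n hnd
  rw [StrictAt, recip'_eq hT.1] at h1
  unfold gap
  linarith

/-- If equality holds for `n = d` only, then all exponents exceed `2`, and the weights are
critical. -/
lemma critical_of_eq [NeZero d] {p q : ℝ≥0∞} (hT : (p, q) ∈ T d) (hq : q ≠ ∞)
    {β : Fin d → ℝ} (hβ : ∀ i, 1 < β i) (hanti : Antitone β) (hpq : q ≤ p)
    (heq : (1 + J β d) * recip q = J β d * recip' p) (h : ∀ n < d, StrictAt β p q n) :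
    (∀ i, 2 < β i) ∧ (∀ i, gap p q * critWeight β i < cap p q) ∧
      gap p q * ∑ i, critWeight β i = 2 * recip q := by
  have hs := gap_pos hT hq
  have hd := NeZero.pos d
  have hβ0 : ∀ i, 0 < β i := fun i => one_pos.trans (hβ i)
  rw [recip'_eq hT.1] at heq
  have hJ : gap p q * J β d = recip q := by unfold gap; linarith
  have h1 := h (d - 1) (by omega)
  rw [StrictAt, recip'_eq hT.1, Nat.cast_sub hd, Nat.cast_one] at h1
  -- Compare the equality gap · J_d = 1/q with the strict inequality at n = d - 1. The smallest
  -- exponent β_d is the worst case, and since the cap is at most the gap, this also forces β_d > 2.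
  have h2 : 2 * gap p q * (1 / β ⊤) < cap p q := by
    have h3 : 1 / β ⊤ = J β d - J β (d - 1) := by rw [← J_pred_add]; ring
    have h4 : gap p q * J β (d - 1) = J β (d - 1) * (1 - recip p) - J β (d - 1) * recip q := by
      unfold gap; ring
    rw [h3, cap_eq_of_le hT.2.1 hpq]
    linarith
  have h5 : ∀ i, 2 * gap p q * (1 / β i) < cap p q := fun i =>
    lt_of_le_of_lt (by
      have := one_div_le_one_div_of_le (hβ0 ⊤) (hanti (le_top : i ≤ ⊤))
      gcongr) h2
  have h6 : ∀ i, 2 < β i := fun i => by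
    have h7 := (h5 i).trans_le (min_le_left _ _)
    rw [mul_one_div, div_lt_iff₀ (hβ0 i), mul_comm] at h7
    exact lt_of_mul_lt_mul_left h7 hs.le
  have h8 : ∀ i, critWeight β i = 2 * (1 / β i) := fun i => by
    rw [critWeight, if_pos (h6 i)]; ring
  refine ⟨h6, fun i => ?_, ?_⟩
  · rw [h8]
    linarith [h5 i]
  · simp_rw [h8]
    rw [← Finset.mul_sum, ← J_last]
    linarith

end RectRestriction

theorem theorem1p6 (d : ℕ) [NeZero d] (β : Fin d → ℝ) (hβ : ∀ i, 1 < β i) (hβ_anti : Antitone β)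
    (p q : ℝ≥0∞) (V : Set (ℝ≥0∞ × ℝ≥0∞))
    (hVopen : ∃ U : Set (ℝ≥0∞ × ℝ≥0∞), IsOpen U ∧ V = U ∩ RectRestriction.T d)
    (hpq : (p, q) ∈ V)
    (hconj : ∀ r ∈ V, RectRestriction.RectConjecture d r.1 r.2) :
    ((RectRestriction.CondI β p q ∨ RectRestriction.CondII β p q ∨
        RectRestriction.CondIII β p q) → RectRestriction.StrongType β p q) ∧
      (RectRestriction.CondIV β p q → RectRestriction.RestrictedWeakType β p q) := by
  obtain ⟨U, hU, rfl⟩ := hVopen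
  obtain ⟨hmem, hT⟩ := hpq
  constructor
  · intro h
    by_cases hq : q = ∞
    · subst hq
      exact RectRestriction.strongType_top hβ hT.1
    rcases h with h | h | ⟨h, heq, hn⟩
    · exact RectRestriction.strongType_of_condI hT hq hU hmem hconj hβ hβ_anti h
    · exact RectRestriction.strongType_of_condII hT hq (hconj (p, q) ⟨hmem, hT⟩) hβ hβ_anti h
    · obtain ⟨h2, hS, hsum⟩ := RectRestriction.critical_of_eq hT hq hβ hβ_anti h.le heq hn
      exact RectRestriction.strongType_of_critical hT hq hU hmem hconj hβ ⟨0, h2 0⟩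
        (fun i _ => hS i) (fun ⟨i, hi⟩ => absurd (h2 i) hi.not_gt) hsum h.ge
  · rintro ⟨h, heq, hn⟩
    -- For q = ∞ also p = ∞, and the equality would give J_d = 0.
    have hq : q ≠ ∞ := by
      rintro rfl
      obtain rfl : p = ∞ := top_le_iff.1 h
      rw [RectRestriction.recip'_eq hT.1, RectRestriction.recip_top, RectRestriction.J_last] at heq
      have : 0 < ∑ i, 1 / β i := Finset.sum_pos
        (fun i _ => one_div_pos.2 (one_pos.trans (hβ i))) Finset.univ_nonempty
      linarith
    obtain ⟨h2, hS, hsum⟩ := RectRestriction.critical_of_eq hT hq hβ hβ_anti h heq hn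
    exact RectRestriction.restrictedWeakType_of_critical hT hq hU hmem hconj h2 hS hsum
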